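/- Let $k$ be an algebraically closed field, let $X$ be an irreducible projective variety over $k$ (an integral closed subscheme of some $\mathbb P^n_k$), and let $E$ be a vector bundle of rank $d$ on $X$. An étale covering of degree $d$ of $X$ means a finite étale morphism $f\colon Y\to X$ of degree $d$ at every point of $X$; the scheme $Y$ need not be connected. For a closed point $x\in X$, a Lie subalgebra of $\mathrm{End}(E_x)$, where $E_x$ is the ($d$-dimensional) fiber of $E$ at $x$, is called a Cartan subalgebra if it has dimension $d$ and there is a basis of $E_x$ in which all its elements are diagonal. A subbundle $\mathcal A\subset\mathrm{End}(E)$ is a vector bundle $\mathcal A$ with an $\mathcal O_X$-linear map to $\mathrm{End}(E)$ that is injective on all fibers. The following two statements are equivalent: 1. There are a projective $k$-scheme $Y$, an étale covering $f\colon Y\to X$ of degree $d$ (over $k$), and a line bundle $L$ on $Y$ such that $f_*L\cong E$. 2. There is a subbundle $\mathcal A\subset\mathrm{End}(E)$ of rank $d$ such that for every closed point $x\in X$ the subspace $\mathcal A_x\subset\mathrm{End}(E)_x=\mathrm{End}(E_x)$ is a Cartan subalgebra. Moreover, let $\mathcal A\subset\mathrm{End}(E)$ be any subbundle as in (2). Then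 $Y$, $f$, $L$ and the isomorphism $f_*L\cong E$ in (1) can be chosen so that $\mathcal A=f_*\mathcal O_Y$ inside $\mathrm{End}(E)\cong\mathrm{End}(f_*L)$, where $f_*\mathcal O_Y$ acts on $f_*L$ by multiplication. Furthermore, for every étale covering $f\colon Y\to X$ of degree $d$ with $f_*\mathcal O_Y\cong\mathcal A$ as $\mathcal O_X$-modules, the number of connected components of $Y$ and $\dim_k H^0(X,\mathcal A)$ are finite and equal. -/

import Mathlib

open CategoryTheory AlgebraicGeometry TopologicalSpace TensorProduct Opposite

universe u

namespace EtaleDirectImage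

noncomputable section

/-! ### Projective schemes over a field -/

section Projective

attribute [local instance] MvPolynomial.gradedAlgebra

/-- Projective space `ℙⁿ` over `k`, as `Proj k[x₀, …, xₙ]`. -/
def ProjectiveSpace (k : Type u) [Field k] (n : ℕ) : Scheme.{u} :=
  Proj (MvPolynomial.homogeneousSubmodule (Fin (n + 1)) k)

/-- The structure morphism `ℙⁿ ⟶ Spec k`. -/
def ProjectiveSpace.toSpec (k : Type u) [Field k] (n : ℕ) :
    ProjectiveSpace k n ⟶ Spec (.of k) :=
  Proj.toSpecZero (MvPolynomial.homogeneousSubmodule (Fin (n + 1)) k) ≫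
    Spec.map (CommRingCat.ofHom
      (algebraMap k (MvPolynomial.homogeneousSubmodule (Fin (n + 1)) k 0)))

/-- A `k`-scheme `π : X ⟶ Spec k` is projective if it is isomorphic over `k` to a closed subscheme
of some projective space over `k`. -/
def IsProjective {k : Type u} [Field k] {X : Scheme.{u}} (π : X ⟶ Spec (.of k)) : Prop :=
  ∃ (n : ℕ) (i : X ⟶ ProjectiveSpace k n),
    IsClosedImmersion i ∧ i ≫ ProjectiveSpace.toSpec k n = π

end Projective

/-! ### Étale coverings -/

/-- `f : Y ⟶ X` is an étale covering of degree `d`: it is finite and étale, and the locally free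
sheaf `f_* 𝒪_Y` has rank `d` at every point. (For `d ≥ 1` such an `f` is surjective; `Y` is not
assumed to be connected.) -/
structure IsEtaleCovering {X Y : Scheme.{u}} (f : Y ⟶ X) (d : ℕ) : Prop where
  isFinite : IsFinite f
  etale : Etale f
  degree : ∀ x : X, f.finrank x = d

/-! ### Sections, vector bundles, cohomology in degree zero -/

section Bundles

variable {X : Scheme.{u}}

/-- Restriction of sections of an `𝒪_X`-module. -/
def res (M : X.Modules) {V U : X.Opens} (h : V ≤ U) : Γ(M, U) →+ Γ(M, V) :=
  (M.presheaf.map (homOfLE h).op).hom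

/-- Restriction of functions. -/
def resO {V U : X.Opens} (h : V ≤ U) : Γ(X, U) →+* Γ(X, V) :=
  (X.presheaf.map (homOfLE h).op).hom

/-- `M` is a vector bundle of rank `d`, i.e. locally isomorphic to `𝒪_X ^ d`: around every point
there is a frame `s₁, …, s_d ∈ Γ(M, U)`, that is, `c ↦ ∑ cᵢ sᵢ` is an isomorphism of sheaves
`𝒪_U ^ d ≅ M|_U`. -/
def IsVectorBundle (M : X.Modules) (d : ℕ) : Prop :=
  ∀ x : X, ∃ U : X.Opens, x ∈ U ∧ ∃ s : Fin d → Γ(M, U), ∀ (V : X.Opens) (h : V ≤ U),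
    Function.Bijective fun c : Fin d → Γ(X, V) => ∑ i, c i • res M h (s i)

/-- The structure sheaf as a module over itself. -/
def structureSheaf (X : Scheme.{u}) : X.Modules := SheafOfModules.unit X.ringCatSheaf

/-- A function on `U`, seen as a section of the `𝒪_X`-module `𝒪_X`. -/
def toSection {U : X.Opens} (a : Γ(X, U)) : Γ(structureSheaf X, U) := a

/-- `H⁰(X, M)` for a scheme `π : X ⟶ Spec k` over `k`. -/
def H0 {k : Type u} [Field k] (_π : X ⟶ Spec (.of k)) (M : X.Modules) : Type u := Γ(M, ⊤)

instance {k : Type u} [Field k] (π : X ⟶ Spec (.of k)) (M : X.Modules) :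
    AddCommGroup (H0 π M) := inferInstanceAs (AddCommGroup Γ(M, ⊤))

/-- The `k`-vector space structure of `H⁰(X, M)`, through `k → Γ(X, 𝒪_X)`. -/
instance {k : Type u} [Field k] (π : X ⟶ Spec (.of k)) (M : X.Modules) :
    Module k (H0 π M) :=
  letI : Module Γ(X, ⊤) (H0 π M) := inferInstanceAs (Module Γ(X, ⊤) Γ(M, ⊤))
  Module.compHom (H0 π M) (((Scheme.ΓSpecIso (.of k)).inv ≫ π.appTop).hom : k →+* Γ(X, ⊤))

end Bundles

section Res

variable {X : Scheme.{u}} (M : X.Modules)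

theorem res_smul {V U : X.Opens} (h : V ≤ U) (r : Γ(X, U)) (s : Γ(M, U)) :
    res M h (r • s) = resO h r • res M h s :=
  Scheme.Modules.map_smul M (homOfLE h) r s

theorem res_res {W V U : X.Opens} (h : V ≤ U) (h' : W ≤ V) (s : Γ(M, U)) :
    res M h' (res M h s) = res M (h'.trans h) s := by
  simp only [res, ← AddCommGrpCat.comp_apply, ← Functor.map_comp]
  rfl

theorem res_self {U : X.Opens} (h : U ≤ U) (s : Γ(M, U)) : res M h s = s := by
  simp [res]

theorem resO_resO {W V U : X.Opens} (h : V ≤ U) (h' : W ≤ V) (s : Γ(X, U)) :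
    resO h' (resO h s) = resO (h'.trans h) s := by
  simp only [resO, ← CommRingCat.comp_apply, ← Functor.map_comp]
  rfl

theorem res_ext {ι : Type u} {V : X.Opens} {W : ι → X.Opens} (hW : ∀ i, W i ≤ V)
    (hV : V ≤ iSup W) {s t : Γ(M, V)} (h : ∀ i, res M (hW i) s = res M (hW i) t) : s = t :=
  TopCat.Sheaf.eq_of_locally_eq' (X := X.toTopCat) ⟨M.presheaf, M.isSheaf⟩ W V
    (fun i => homOfLE (hW i)) hV s t h

theorem res_glue {ι : Type u} {V : X.Opens} {W : ι → X.Opens} (hW : ∀ i, W i ≤ V)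
    (hV : V ≤ iSup W) (s : ∀ i, Γ(M, W i))
    (h : ∀ i j, res M (inf_le_left : W i ⊓ W j ≤ W i) (s i) =
      res M (inf_le_right : W i ⊓ W j ≤ W j) (s j)) :
    ∃ t : Γ(M, V), ∀ i, res M (hW i) t = s i :=
  (TopCat.Sheaf.existsUnique_gluing' (X := X.toTopCat) ⟨M.presheaf, M.isSheaf⟩ W V
    (fun i => homOfLE (hW i)) hV s h).exists

theorem resO_self {U : X.Opens} (h : U ≤ U) (s : Γ(X, U)) : resO h s = s := by
  simp [resO]

end Res

/-! ### The sheaf `End(E)` -/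

/-- A section of `End(E)` over `U`, i.e. an `𝒪_U`-linear endomorphism of `E|_U`. -/
@[ext]
structure EndSection {X : Scheme.{u}} (E : X.Modules) (U : X.Opens) where
  app (V : X.Opens) (h : V ≤ U) : Γ(E, V) →ₗ[Γ(X, V)] Γ(E, V)
  map_app {V W : X.Opens} (hV : V ≤ U) (hW : W ≤ V) (s : Γ(E, V)) :
    app W (hW.trans hV) (res E hW s) = res E hW (app V hV s)

namespace EndSection

variable {X : Scheme.{u}} {E : X.Modules} {U : X.Opens}

instance : Zero (EndSection E U) := ⟨⟨fun _ _ => 0, by simp⟩⟩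
instance : Add (EndSection E U) :=
  ⟨fun φ ψ => ⟨fun V h => φ.app V h + ψ.app V h, fun hV hW s => by
    simp [φ.map_app hV hW, ψ.map_app hV hW]⟩⟩
instance : Neg (EndSection E U) :=
  ⟨fun φ => ⟨fun V h => - φ.app V h, fun hV hW s => by simp [φ.map_app hV hW]⟩⟩
instance : SMul Γ(X, U) (EndSection E U) :=
  ⟨fun r φ => ⟨fun V h => resO h r • φ.app V h, fun hV hW s => by
    simp [φ.map_app hV hW, res_smul, resO_resO]⟩⟩

@[simp] theorem zero_app (V : X.Opens) (h : V ≤ U) : (0 : EndSection E U).app V h = 0 := rfl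
@[simp] theorem add_app (φ ψ : EndSection E U) (V : X.Opens) (h : V ≤ U) :
    (φ + ψ).app V h = φ.app V h + ψ.app V h := rfl
@[simp] theorem neg_app (φ : EndSection E U) (V : X.Opens) (h : V ≤ U) :
    (-φ).app V h = - φ.app V h := rfl
@[simp] theorem smul_app (r : Γ(X, U)) (φ : EndSection E U) (V : X.Opens) (h : V ≤ U) :
    (r • φ).app V h = resO h r • φ.app V h := rfl

theorem ext' {φ ψ : EndSection E U} (H : ∀ V h, φ.app V h = ψ.app V h) : φ = ψ := by
  ext1; funext V h; exact H V h

instance : AddCommGroup (EndSection E U) where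
  add_assoc a b c := ext' fun V h => by simp [add_assoc]
  zero_add a := ext' fun V h => by simp
  add_zero a := ext' fun V h => by simp
  neg_add_cancel a := ext' fun V h => by simp
  add_comm a b := ext' fun V h => by simp [add_comm]
  nsmul := nsmulRec
  zsmul := zsmulRec

instance : Module Γ(X, U) (EndSection E U) where
  one_smul a := ext' fun V h => by simp
  mul_smul r s a := ext' fun V h => by simp [mul_smul]
  smul_zero r := ext' fun V h => by simp
  smul_add r a b := ext' fun V h => by simp
  add_smul r s a := ext' fun V h => by simp [add_smul]
  zero_smul a := ext' fun V h => by simp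

/-- Restriction of endomorphisms to a smaller open set. -/
def restrict {V : X.Opens} (h : V ≤ U) : EndSection E U →+ EndSection E V where
  toFun φ := ⟨fun W hW => φ.app W (hW.trans h), fun hV hW s => φ.map_app (hV.trans h) hW s⟩
  map_zero' := rfl
  map_add' _ _ := rfl

@[simp] theorem restrict_app {V : X.Opens} (h : V ≤ U) (φ : EndSection E U) (W : X.Opens)
    (hW : W ≤ V) : (restrict h φ).app W hW = φ.app W (hW.trans h) := rfl

end EndSection

section EndSheaf

variable {X : Scheme.{u}} (E : X.Modules)

/-- The presheaf of abelian groups underlying `End(E)`. -/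
def endAbPresheaf : X.Opensᵒᵖ ⥤ Ab.{u} where
  obj U := AddCommGrpCat.of (EndSection E U.unop)
  map i := AddCommGrpCat.ofHom (EndSection.restrict (leOfHom i.unop))

instance (U : X.Opensᵒᵖ) : Module (X.ringCatSheaf.obj.obj U) ((endAbPresheaf E).obj U) :=
  inferInstanceAs (Module Γ(X, U.unop) (EndSection E U.unop))

/-- The presheaf of modules underlying `End(E)`. -/
def endPresheaf : X.PresheafOfModules :=
  PresheafOfModules.ofPresheaf (R := X.ringCatSheaf.obj) (endAbPresheaf E) (by
    intro U V i r φ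
    refine EndSection.ext' (E := E) (U := V.unop) fun W hW => ?_
    exact congrArg (· • EndSection.app (E := E) (U := U.unop) φ W (hW.trans (leOfHom i.unop)))
      (resO_resO (leOfHom i.unop) hW (show Γ(X, U.unop) from r)).symm)

theorem EndSection.exists_glue {E} {ι : Type u} (U : ι → X.Opens) (φ : ∀ i, EndSection E (U i))
    (hφ : ∀ i j, EndSection.restrict inf_le_left (φ i) =
      EndSection.restrict (inf_le_right : U i ⊓ U j ≤ U j) (φ j)) :
    ∃ ψ : EndSection E (iSup U), ∀ i, EndSection.restrict (le_iSup U i) ψ = φ i := by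
  have hφ' : ∀ i j (W : X.Opens) (hi : W ≤ U i) (hj : W ≤ U j),
      (φ i).app W hi = (φ j).app W hj := fun i j W hi hj => by
    have := congrArg (fun θ => EndSection.app θ W (le_inf hi hj)) (hφ i j)
    simpa using this
  have hcov : ∀ V : X.Opens, V ≤ iSup U → V ≤ ⨆ i, V ⊓ U i := fun V hV => by
    rw [← inf_iSup_eq]; exact le_inf le_rfl hV
  have key : ∀ (V : X.Opens) (_ : V ≤ iSup U) (s : Γ(E, V)), ∃ t : Γ(E, V), ∀ i,
      res E (inf_le_left : V ⊓ U i ≤ V) t =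
        (φ i).app (V ⊓ U i) inf_le_right (res E inf_le_left s) := fun V hV s => by
    refine res_glue E (fun i => inf_le_left) (hcov V hV) _ fun i j => ?_
    rw [← (φ i).map_app, ← (φ j).map_app, res_res, res_res]
    exact LinearMap.congr_fun (hφ' i j _ _ _) _
  choose t ht using key
  have ht' : ∀ (V : X.Opens) (hV : V ≤ iSup U) (s : Γ(E, V)) (i) (W : X.Opens) (hWV : W ≤ V)
      (hi : W ≤ U i), res E hWV (t V hV s) = (φ i).app W hi (res E hWV s) := by
    intro V hV s i W hWV hi
    have := congrArg (res E (le_inf hWV hi)) (ht V hV s i)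
    rw [res_res, ← (φ i).map_app, res_res] at this
    exact this
  have huniq : ∀ (V : X.Opens) (_ : V ≤ iSup U) (a b : Γ(E, V)),
      (∀ i, res E (inf_le_left : V ⊓ U i ≤ V) a = res E (inf_le_left : V ⊓ U i ≤ V) b) → a = b :=
    fun V hV a b h => res_ext E (fun i => inf_le_left) (hcov V hV) h
  refine ⟨⟨fun V hV => ⟨⟨t V hV, fun a b => ?_⟩, fun r a => ?_⟩, fun {V W} hV hW s => ?_⟩,
    fun i => EndSection.ext' fun V hV => ?_⟩
  · refine huniq V hV _ _ fun i => ?_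
    simp only [map_add, ht]
  · refine huniq V hV _ _ fun i => ?_
    simp only [RingHom.id_apply, res_smul, ht, map_smul]
  · refine huniq W (hW.trans hV) _ _ fun i => ?_
    simp only [LinearMap.coe_mk, AddHom.coe_mk, res_res]
    rw [ht, ht' _ _ _ i _ _ inf_le_right, res_res]
  · refine LinearMap.ext fun s => ?_
    have := ht' V (hV.trans (le_iSup U i)) s i V le_rfl hV
    rwa [res_self, res_self] at this

theorem EndSection.eq_of_locally_eq {E} {ι : Type u} {U : ι → X.Opens}
    {φ ψ : EndSection E (iSup U)}
    (h : ∀ i, EndSection.restrict (le_iSup U i) φ = EndSection.restrict (le_iSup U i) ψ) :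
    φ = ψ := by
  refine EndSection.ext' fun V hV => LinearMap.ext fun s => ?_
  refine res_ext E (W := fun i => V ⊓ U i) (fun i => inf_le_left)
    (by rw [← inf_iSup_eq]; exact le_inf le_rfl hV) fun i => ?_
  rw [← φ.map_app, ← ψ.map_app]
  exact congrArg (fun θ => EndSection.app θ (V ⊓ U i) inf_le_right _) (h i)

theorem endAbPresheaf_isSheaf : TopCat.Presheaf.IsSheaf (X := X.toTopCat) (endAbPresheaf E) := by
  rw [TopCat.Presheaf.isSheaf_iff_isSheafUniqueGluing]
  intro ι U φ hφ
  obtain ⟨ψ, hψ⟩ := EndSection.exists_glue (E := E) U φ hφ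
  exact ⟨ψ, hψ, fun θ hθ => EndSection.eq_of_locally_eq (E := E) fun i =>
    (hθ i).trans (hψ i).symm⟩

/-- The sheaf of `𝒪_X`-modules `End(E)`. -/
def endSheaf : X.Modules := ⟨endPresheaf E, endAbPresheaf_isSheaf E⟩

/-- A section of `End(E)` over `U` as an endomorphism of `E|_U`. -/
def toEndSection {U : X.Opens} (φ : Γ(endSheaf E, U)) : EndSection E U := φ

end EndSheaf

/-! ### Stalks and fibres -/

section Fibres

variable {X : Scheme.{u}}

instance stalkModule (M : X.Modules) (x : X) :
    Module (X.presheaf.stalk x) (M.presheaf.stalk x) :=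
  PresheafOfModules.instModuleCarrierStalkCommRingCatCarrierAbPresheafOpensCarrier
    (R := X.presheaf) M.val x

/-- The local ring `𝒪_{X,x}`. -/
abbrev localRing (x : X) : Type u := X.presheaf.stalk x

/-- The stalk `M_x`. -/
abbrev Stalk (M : X.Modules) (x : X) : Type u := M.presheaf.stalk x

/-- The germ at `x` of a function on a neighbourhood of `x`. -/
def germO {U : X.Opens} {x : X} (hx : x ∈ U) : Γ(X, U) →+* localRing x :=
  (X.presheaf.germ U x hx).hom

/-- The germ at `x` of a section over a neighbourhood of `x`. -/
def germ (M : X.Modules) {U : X.Opens} {x : X} (hx : x ∈ U) : Γ(M, U) →+ Stalk M x :=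
  (M.presheaf.germ U x hx).hom

theorem germ_smul (M : X.Modules) {x : X} {U : X.Opens} (hx : x ∈ U) (r : Γ(X, U))
    (m : Γ(M, U)) : germ M hx (r • m) = germO hx r • germ M hx m :=
  PresheafOfModules.germ_smul (R := X.presheaf) M.val x U hx r m

theorem germ_res (M : X.Modules) {x : X} {U V : X.Opens} (h : V ≤ U) (hx : x ∈ V) (s : Γ(M, U)) :
    germ M hx (res M h s) = germ M (h hx) s :=
  M.presheaf.germ_res_apply (homOfLE h) x hx s

theorem germO_resO {x : X} {U V : X.Opens} (h : V ≤ U) (hx : x ∈ V) (s : Γ(X, U)) :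
    germO hx (resO h s) = germO (h hx) s :=
  X.presheaf.germ_res_apply (homOfLE h) x hx s

theorem mem_inf {x : X} {U V : X.Opens} (hU : x ∈ U) (hV : x ∈ V) : x ∈ U ⊓ V := ⟨hU, hV⟩

theorem exists_germ (M : X.Modules) {x : X} {U : X.Opens} (hU : x ∈ U) (m : Stalk M x) :
    ∃ (V : X.Opens) (hV : x ∈ V) (_ : V ≤ U) (s : Γ(M, V)), germ M hV s = m := by
  obtain ⟨V, hV, s, rfl⟩ := TopCat.Presheaf.exists_germ_eq M.presheaf m
  exact ⟨V ⊓ U, mem_inf hV hU, inf_le_right, res M inf_le_left s, germ_res M _ _ s⟩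

theorem exists_germO {x : X} (m : localRing x) :
    ∃ (V : X.Opens) (hV : x ∈ V) (s : Γ(X, V)), germO hV s = m :=
  TopCat.Presheaf.exists_germ_eq X.presheaf m

section Lift

variable (M : X.Modules) (x : X) {N : Type u} [AddCommGroup N]
  (f : ∀ U : X.Opens, x ∈ U → (Γ(M, U) →+ N))
  (hres : ∀ (U V : X.Opens) (h : V ≤ U) (hx : x ∈ V) (m : Γ(M, U)),
    f V hx (res M h m) = f U (h hx) m)

/-- An additive map out of a stalk, from a compatible family of additive maps on sections. -/
def stalkLiftAdd : Stalk M x →+ N :=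
  (Limits.colimit.desc ((OpenNhds.inclusion x).op ⋙ M.presheaf)
    { pt := AddCommGrpCat.of N
      ι :=
        { app := fun V => AddCommGrpCat.ofHom (f V.unop.1 V.unop.2)
          naturality := fun V W i => by
            ext m
            exact hres V.unop.1 W.unop.1 (leOfHom i.unop) W.unop.2 m } } :
    M.presheaf.stalk x ⟶ AddCommGrpCat.of N).hom

theorem stalkLiftAdd_germ {U : X.Opens} (hx : x ∈ U) (m : Γ(M, U)) :
    stalkLiftAdd M x f hres (germ M hx m) = f U hx m := by
  have := Limits.colimit.ι_desc (F := (OpenNhds.inclusion x).op ⋙ M.presheaf)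
    { pt := AddCommGrpCat.of N
      ι :=
        { app := fun V => AddCommGrpCat.ofHom (f V.unop.1 V.unop.2)
          naturality := fun V W i => by
            ext m
            exact hres V.unop.1 W.unop.1 (leOfHom i.unop) W.unop.2 m } }
    (op (⟨U, hx⟩ : OpenNhds x))
  exact ConcreteCategory.congr_hom this m

variable [Module (localRing x) N]
  (hsmul : ∀ (U : X.Opens) (hx : x ∈ U) (r : Γ(X, U)) (m : Γ(M, U)),
    f U hx (r • m) = germO hx r • f U hx m)

/-- An `𝒪_{X,x}`-linear map out of a stalk, from a compatible family of maps on sections. -/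
def stalkLift : Stalk M x →ₗ[localRing x] N where
  toFun := stalkLiftAdd M x f hres
  map_add' := map_add _
  map_smul' c m := by
    obtain ⟨U, hU, r, rfl⟩ := exists_germO c
    obtain ⟨V, hV, h, m, rfl⟩ := exists_germ M hU m
    rw [← germO_resO h hV, ← germ_smul, stalkLiftAdd_germ, stalkLiftAdd_germ, hsmul,
      RingHom.id_apply]

theorem stalkLift_germ {U : X.Opens} (hx : x ∈ U) (m : Γ(M, U)) :
    stalkLift M x f hres hsmul (germ M hx m) = f U hx m :=
  stalkLiftAdd_germ M x f hres hx m

end Lift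

/-- The map `M_x → N_x` induced by a morphism of `𝒪_X`-modules. -/
def stalkMap {M N : X.Modules} (φ : M ⟶ N) (x : X) : Stalk M x →ₗ[localRing x] Stalk N x :=
  stalkLift M x (fun U hx => (germ N hx).comp (φ.app U).hom)
    (fun U V h hx m => by
      have : φ.app V (res M h m) = res N h (φ.app U m) :=
        ConcreteCategory.congr_hom (φ.mapPresheaf.naturality (homOfLE h).op) m
      exact (congrArg (germ N hx) this).trans (germ_res N h hx _))
    (fun U hx r m =>
      (congrArg (germ N hx) (Scheme.Modules.Hom.app_smul φ r m)).trans (germ_smul N hx r _))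

theorem stalkMap_germ {M N : X.Modules} (φ : M ⟶ N) {x : X} {U : X.Opens} (hx : x ∈ U)
    (m : Γ(M, U)) : stalkMap φ x (germ M hx m) = germ N hx (φ.app U m) :=
  stalkLift_germ M x _ _ _ hx m

/-- The residue field `κ(x)`. -/
abbrev kappa (x : X) : Type u := IsLocalRing.ResidueField (localRing x)

/-- The fibre `M(x) = κ(x) ⊗ M_x` of an `𝒪_X`-module. -/
abbrev Fibre (M : X.Modules) (x : X) : Type u := kappa x ⊗[localRing x] Stalk M x

/-- The map `M(x) → N(x)` induced by a morphism of `𝒪_X`-modules. -/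
def fibreMap {M N : X.Modules} (φ : M ⟶ N) (x : X) : Fibre M x →ₗ[kappa x] Fibre N x :=
  (stalkMap φ x).baseChange (kappa x)

namespace EndSection

variable {E : X.Modules} {U : X.Opens}

/-- The endomorphism of the stalk `E_x` induced by an endomorphism of `E|_U`, for `x ∈ U`. -/
def stalk (φ : EndSection E U) {x : X} (hx : x ∈ U) : Module.End (localRing x) (Stalk E x) :=
  stalkLift E x
    (fun V hV => ((germ E (U := V ⊓ U) (mem_inf hV hx)).comp
      (φ.app (V ⊓ U) inf_le_right).toAddMonoidHom).comp (res E inf_le_left))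
    (fun V W h hW s => by
      change germ E _ (φ.app (W ⊓ U) _ (res E _ (res E h s))) =
        germ E _ (φ.app (V ⊓ U) _ (res E _ s))
      rw [res_res, ← germ_res E (inf_le_inf_right U h) (mem_inf hW hx), ← φ.map_app, res_res])
    (fun V hV r s => by
      change germ E _ (φ.app (V ⊓ U) _ (res E _ (r • s))) =
        _ • germ E _ (φ.app (V ⊓ U) _ (res E _ s))
      rw [res_smul, map_smul, germ_smul, germO_resO])

theorem stalk_germ (φ : EndSection E U) {x : X} (hx : x ∈ U) {V : X.Opens} (hV : x ∈ V)
    (h : V ≤ U) (s : Γ(E, V)) : φ.stalk hx (germ E hV s) = germ E hV (φ.app V h s) := by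
  refine (stalkLift_germ E x _ _ _ hV s).trans ?_
  change germ E _ (φ.app (V ⊓ U) _ (res E _ s)) = _
  rw [φ.map_app h inf_le_left, germ_res]

theorem stalk_ext {x : X} (hx : x ∈ U) {f g : Module.End (localRing x) (Stalk E x)}
    (h : ∀ (V : X.Opens) (hV : x ∈ V) (_ : V ≤ U) (s : Γ(E, V)),
      f (germ E hV s) = g (germ E hV s)) : f = g := by
  refine LinearMap.ext fun s => ?_
  obtain ⟨V, hV, hVU, s, rfl⟩ := exists_germ E hx s
  exact h V hV hVU s

end EndSection

/-- The canonical map `End(E)_x → End(E_x)` on stalks, sending the germ of an endomorphism of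
`E|_U` to the induced endomorphism of `E_x`. -/
def endStalkMap (E : X.Modules) (x : X) :
    Stalk (endSheaf E) x →ₗ[localRing x] Module.End (localRing x) (Stalk E x) :=
  stalkLift (endSheaf E) x
    (fun U hx => AddMonoidHom.mk' (fun φ => (toEndSection E φ).stalk hx) fun φ ψ =>
      EndSection.stalk_ext hx fun V hV h s => by
        rw [LinearMap.add_apply, EndSection.stalk_germ _ hx hV h,
          EndSection.stalk_germ _ hx hV h, EndSection.stalk_germ _ hx hV h, ← map_add]
        rfl)
    (fun U V h hx φ => EndSection.stalk_ext hx fun W hW hWV s =>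
      (EndSection.stalk_germ _ hx hW hWV s).trans
        (EndSection.stalk_germ (toEndSection E φ) (h hx) hW (hWV.trans h) s).symm)
    (fun U hx r φ => EndSection.stalk_ext hx fun V hV h s => by
      refine (EndSection.stalk_germ _ hx hV h s).trans ?_
      refine Eq.trans ?_ (congrArg (germO hx r • ·)
        (EndSection.stalk_germ (toEndSection E φ) hx hV h s).symm)
      rw [← germO_resO h hV, ← germ_smul]
      rfl)

theorem endStalkMap_germ (E : X.Modules) {x : X} {U : X.Opens} (hx : x ∈ U)
    (φ : Γ(endSheaf E, U)) :
    endStalkMap E x (germ (endSheaf E) hx φ) = (toEndSection E φ).stalk hx :=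
  stalkLift_germ (endSheaf E) x _ _ _ hx φ

/-- The canonical map `End(E)(x) → End(E(x))` from the fibre of `End(E)` to the endomorphisms of
the fibre of `E`; it is an isomorphism if `E` is a vector bundle. -/
def endFibreMap (E : X.Modules) (x : X) :
    Fibre (endSheaf E) x →ₗ[kappa x] Module.End (kappa x) (Fibre E x) :=
  LinearMap.liftBaseChange (kappa x)
    (LinearMap.baseChangeHom (localRing x) (kappa x) (Stalk E x) (Stalk E x) ∘ₗ endStalkMap E x)

end Fibres

/-! ### Cartan subalgebra bundles -/

/-- A Lie subalgebra `B` of the endomorphisms of a `d`-dimensional vector space `V` is a Cartan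
subalgebra if it has dimension `d` and if, in a suitable basis of `V`, all its elements are
diagonal. -/
structure IsCartanSubalgebra {K V : Type u} [Field K] [AddCommGroup V] [Module K V] (d : ℕ)
    (B : Submodule K (Module.End K V)) : Prop where
  lie_mem : ∀ S ∈ B, ∀ T ∈ B, ⁅S, T⁆ ∈ B
  finrank_eq : Module.finrank K B = d
  diagonal : ∃ b : Module.Basis (Fin d) K V, ∀ T ∈ B, (LinearMap.toMatrix b b T).IsDiag

/-- `ι : A ⟶ N` makes `A` a subbundle of rank `d` of the vector bundle `N`: `A` is a vector bundle
of rank `d`, and `ι` is injective on all fibres. -/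
structure IsSubbundle {X : Scheme.{u}} {A N : X.Modules} (ι : A ⟶ N) (d : ℕ) : Prop where
  isVectorBundle : IsVectorBundle A d
  injective : ∀ x : X, Function.Injective (fibreMap ι x)

/-- `ι : A ⟶ End(E)` is a rank `d` subbundle whose fibre at every closed point `x` is a Cartan
subalgebra of `End(E)(x) = End(E(x))`. -/
structure IsCartanSubbundle {X : Scheme.{u}} {A E : X.Modules} (ι : A ⟶ endSheaf E) (d : ℕ) :
    Prop where
  isSubbundle : IsSubbundle ι d
  isCartan : ∀ x : X, IsClosed ({x} : Set X) →
    IsCartanSubalgebra d (LinearMap.range (endFibreMap E x ∘ₗ fibreMap ι x))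

/-! ### Direct images -/

/-- The direct image `f_* M`. -/
abbrev directImage {X Y : Scheme.{u}} (f : Y ⟶ X) (M : Y.Modules) : X.Modules :=
  (Scheme.Modules.pushforward f).obj M

/-- Given `η : f_* L ≅ E`, the subsheaf `ι : A ⟶ End(E)` is `f_* 𝒪_Y`, acting on `f_* L ≅ E` by
multiplication: there is an isomorphism `ψ : f_* 𝒪_Y ≅ A` of `𝒪_X`-modules such that, for a
function `a` on `f ⁻¹ U`, the endomorphism `ι (ψ a)` of `E|_U` corresponds under `η` to
multiplication by `a` on `L`. -/
def IsDirectImageOfStructureSheaf {X Y : Scheme.{u}} (f : Y ⟶ X) {L : Y.Modules}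
    {E A : X.Modules} (η : directImage f L ≅ E) (ι : A ⟶ endSheaf E) : Prop :=
  ∃ ψ : directImage f (structureSheaf Y) ≅ A,
    ∀ (U : X.Opens) (a : Γ(Y, f ⁻¹ᵁ U)) (l : Γ(L, f ⁻¹ᵁ U)),
      (toEndSection E (ι.app U (ψ.hom.app U (toSection a)))).app U le_rfl (η.hom.app U l) =
        η.hom.app U (a • l)

end

end EtaleDirectImage

/-! From a covering to a subbundle. The algebra `f_* 𝒪_Y` acts on `f_* L ≅ E` by multiplication. The
fibres of `f` are finite, so `L` is trivial on the preimage of a neighbourhood of each point of `X`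
(`IsVectorBundle.exists_isFrame_preimage`). Hence `E` is locally free of rank one over `f_* 𝒪_Y`:
evaluation at a local generator `e` identifies `f_* 𝒪_Y` with `E`, which gives the rank `d` and
injectivity on fibres (`isSubbundle_of_isGenerator`). At a closed point the fibre of `f_* 𝒪_Y` is an
étale algebra over an algebraically closed field, so it is a product of `d` copies of that field. A
faithful action of such a product on a `d`-dimensional space is the algebra of all diagonal matrices
in some basis (`isCartanSubalgebra_of_etale`).

From a subbundle to a covering. By its dimension, a Cartan subalgebra consists of all diagonal
matrices in a basis. It is therefore a commutative associative algebra with unit, and a vector with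
all coordinates `1` is cyclic for it. Lifting such a vector gives local sections `e` for which `a ↦
a e` is an isomorphism from `A` to `E` (`exists_isGenerator_of_isCartan`). Since `X` is reduced and
its closed points are dense in every closed subset, identities of endomorphisms can be tested in
closed fibres. With the help of `e`, membership in `A` can be tested there too
(`exists_act_eq_of_fibre`). So `A` is a sheaf of commutative algebras
(`isAlgebraBundle_of_isCartan`), and `Y` is its relative spectrum, finite and locally free of rank
`d` over `X`. Its closed fibres are spanned by idempotents, which derivations kill, so Nakayama's
lemma gives unramifiedness (`formallyUnramified_of_forall_isMaximal`) and hence étaleness. The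
ratios of local generators of `E` are units on `Y` forming a cocycle, whose line bundle `L`
satisfies `f_* L ≅ E` (`DirectImageAction.exists_lineBundle`).

Projectivity of `Y`. The preimages of the standard charts of projective space are affine opens of
`Y` with functions behaving like `x_j / x_i`. Algebra generators of the functions on these opens,
multiplied by a high power of a coordinate, extend to sections of a twisting power. Together with
the powers of the coordinates they embed the proper scheme `Y` in a projective space
(`CoordinateCover.isProjective`).

Components. Global functions on `Y` are integral over the algebraically closed field `k`, so each
takes finitely many values and is locally constant. As `Y` has no nilpotent functions locally over
`X`, a function is determined by its values, and `H⁰` is the space of `k`-valued functions on the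
set of components (`nonempty_globalSections_linearEquiv`). -/

namespace EtaleDirectImage

noncomputable section

/-! ### Frames and values of sections -/

section Frames

variable {X : Scheme.{u}} {M : X.Modules} {d : ℕ} {U V W : X.Opens}

/-- `s₁, …, s_d ∈ Γ(M, U)` is a frame of `M` over `U`. -/
def IsFrame (M : X.Modules) {d : ℕ} {U : X.Opens} (s : Fin d → Γ(M, U)) : Prop :=
  ∀ (V : X.Opens) (h : V ≤ U),
    Function.Bijective fun c : Fin d → Γ(X, V) => ∑ i, c i • res M h (s i)

theorem IsFrame.restrict {s : Fin d → Γ(M, U)} (hs : IsFrame M s) (h : V ≤ U) :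
    IsFrame M fun i => res M h (s i) := fun W hW => by
  simpa only [res_res] using hs W (hW.trans h)

/-- The basis of `Γ(M, V)` given by a frame over `U ⊇ V`. -/
def IsFrame.basis {s : Fin d → Γ(M, U)} (hs : IsFrame M s) (h : V ≤ U) :
    Module.Basis (Fin d) Γ(X, V) Γ(M, V) :=
  .ofEquivFun (LinearEquiv.ofBijective (Fintype.linearCombination Γ(X, V)
    fun i => res M h (s i)) (by
      convert hs V h using 1
      exact funext fun c => Fintype.linearCombination_apply _ _ _)).symm

@[simp]
theorem IsFrame.basis_apply {s : Fin d → Γ(M, U)} (hs : IsFrame M s) (h : V ≤ U) (i : Fin d) :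
    hs.basis h i = res M h (s i) := by
  classical
  simp [IsFrame.basis, Module.Basis.coe_ofEquivFun, Fintype.linearCombination_apply,
    Pi.single_apply]

theorem IsFrame.basis_repr_res {s : Fin d → Γ(M, U)} (hs : IsFrame M s) (h : V ≤ U) (h' : W ≤ V)
    (m : Γ(M, V)) (i : Fin d) :
    (hs.basis (h'.trans h)).repr (res M h' m) i = resO h' ((hs.basis h).repr m i) := by
  have h1 : res M h' m = ∑ j, resO h' ((hs.basis h).repr m j) • hs.basis (h'.trans h) j := by
    conv_lhs => rw [← (hs.basis h).sum_repr m]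
    simp [map_sum, res_smul, res_res]
  rw [h1, (hs.basis _).repr_sum_self]

theorem isFrame_of_basis {s : Fin d → Γ(M, U)}
    (b : ∀ V : X.Opens, V ≤ U → Module.Basis (Fin d) Γ(X, V) Γ(M, V))
    (hb : ∀ V h i, b V h i = res M h (s i)) : IsFrame M s := by
  intro V h
  convert (b V h).equivFun.symm.bijective using 1
  ext c
  simp [Module.Basis.equivFun_symm_apply, hb]

section Stalk

variable {x : X}

/-- The coordinates of a germ in a frame. -/
def IsFrame.stalkRepr {s : Fin d → Γ(M, U)} (hs : IsFrame M s) (hx : x ∈ U) :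
    Stalk M x →ₗ[localRing x] (Fin d → localRing x) :=
  stalkLift M x
    -- A map out of the stalk needs a value on every neighbourhood `V` of `x`, also those not inside
    -- `U`; hence the restriction to `V ⊓ U`.
    (fun V hV => AddMonoidHom.mk' (fun m i => germO (mem_inf hV hx)
        ((hs.basis (inf_le_right : V ⊓ U ≤ U)).repr (res M inf_le_left m) i)) (by
      intro a b; ext i; simp))
    (by
      intro V W h hW m
      ext i
      have := hs.basis_repr_res (inf_le_right : V ⊓ U ≤ U) (inf_le_inf_right U h : W ⊓ U ≤ V ⊓ U)
        (res M inf_le_left m) i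
      simp only [AddMonoidHom.mk'_apply, res_res] at this ⊢
      rw [this, germO_resO])
    (by
      intro V hV r m
      ext i
      simp [res_smul, germO_resO])

theorem IsFrame.stalkRepr_germ {s : Fin d → Γ(M, U)} (hs : IsFrame M s) (hx : x ∈ U) (h : V ≤ U)
    (hV : x ∈ V) (m : Γ(M, V)) (i : Fin d) :
    hs.stalkRepr hx (germ M hV m) i = germO hV ((hs.basis h).repr m i) := by
  have := congrFun (stalkLift_germ M x (N := Fin d → localRing x) (fun V hV =>
    AddMonoidHom.mk' (fun m i => germO (mem_inf hV hx)
        ((hs.basis (inf_le_right : V ⊓ U ≤ U)).repr (res M inf_le_left m) i)) (by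
      intro a b; ext i; simp)) (by
      intro V W h hW m
      ext i
      have := hs.basis_repr_res (inf_le_right : V ⊓ U ≤ U) (inf_le_inf_right U h : W ⊓ U ≤ V ⊓ U)
        (res M inf_le_left m) i
      simp only [AddMonoidHom.mk'_apply, res_res] at this ⊢
      rw [this, germO_resO])
    (by
      intro V hV r m
      ext i
      simp [res_smul, germO_resO]) hV m) i
  refine Eq.trans this ?_
  have h2 := hs.basis_repr_res h (inf_le_left : V ⊓ U ≤ V) m i
  simp only [AddMonoidHom.mk'_apply] at h2 ⊢
  rw [h2, germO_resO]

/-- The basis of the stalk given by a frame. -/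
def IsFrame.stalkBasis {s : Fin d → Γ(M, U)} (hs : IsFrame M s) (hx : x ∈ U) :
    Module.Basis (Fin d) (localRing x) (Stalk M x) :=
  .ofEquivFun (LinearEquiv.ofLinearMap (hs.stalkRepr hx)
    (Fintype.linearCombination (localRing x) fun i => germ M hx (s i))
    (by
      classical
      ext i j
      have := hs.stalkRepr_germ hx le_rfl hx (s i) j
      have h2 : (hs.basis le_rfl) i = s i := by rw [hs.basis_apply, res_self]
      rw [← h2, Module.Basis.repr_self] at this
      simp only [LinearMap.coe_comp, LinearMap.coe_single, Function.comp_apply,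
        Fintype.linearCombination_apply_single, one_smul, LinearMap.id_comp]
      rw [← h2, this, Finsupp.single_apply, Pi.single_apply]
      by_cases hij : i = j
      · simp [hij]
      · simp [hij, Ne.symm hij])
    (by
      refine LinearMap.ext fun m => ?_
      obtain ⟨V, hV, h, m, rfl⟩ := exists_germ M hx m
      simp only [LinearMap.comp_apply, Fintype.linearCombination_apply, LinearMap.id_apply]
      simp_rw [hs.stalkRepr_germ hx h hV]
      conv_rhs => rw [← (hs.basis h).sum_repr m, map_sum]
      refine Finset.sum_congr rfl fun i _ => ?_
      rw [germ_smul, hs.basis_apply, germ_res]))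

theorem IsFrame.stalkBasis_apply {s : Fin d → Γ(M, U)} (hs : IsFrame M s) (hx : x ∈ U)
    (i : Fin d) : hs.stalkBasis hx i = germ M hx (s i) := by
  classical
  simp [IsFrame.stalkBasis, Module.Basis.coe_ofEquivFun]

/-- The value of a section at a point. -/
def val (M : X.Modules) (hx : x ∈ U) : Γ(M, U) →+ Fibre M x :=
  (TensorProduct.mk (localRing x) (kappa x) (Stalk M x) 1).toAddMonoidHom.comp (germ M hx)

/-- The value of a function at a point. -/
def valO (hx : x ∈ U) : Γ(X, U) →+* kappa x :=
  (IsLocalRing.residue (localRing x)).comp (germO hx)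

theorem val_def (hx : x ∈ U) (m : Γ(M, U)) : val M hx m = 1 ⊗ₜ germ M hx m := rfl

theorem val_smul (hx : x ∈ U) (r : Γ(X, U)) (m : Γ(M, U)) :
    val M hx (r • m) = valO hx r • val M hx m := by
  rw [val_def, germ_smul, TensorProduct.tmul_smul, val_def]
  exact (algebraMap_smul (kappa x) (germO hx r) (1 ⊗ₜ[localRing x] germ M hx m)).symm

theorem val_res (h : V ≤ U) (hx : x ∈ V) (m : Γ(M, U)) :
    val M hx (res M h m) = val M (h hx) m := by
  rw [val_def, germ_res, val_def]

theorem valO_resO (h : V ≤ U) (hx : x ∈ V) (m : Γ(X, U)) :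
    valO hx (resO h m) = valO (h hx) m := by
  simp [valO, germO_resO]

/-- An element of a local ring is a unit exactly when its residue is nonzero. This turns vanishing
at points into statements about basic opens. -/
theorem valO_ne_zero_iff (hx : x ∈ U) (r : Γ(X, U)) : valO hx r ≠ 0 ↔ x ∈ X.basicOpen r := by
  rw [X.mem_basicOpen r x hx]
  exact IsLocalRing.residue_ne_zero_iff_isUnit _

theorem exists_valO (hU : x ∈ U) (c : kappa x) :
    ∃ (V : X.Opens) (hV : x ∈ V) (_ : V ≤ U) (r : Γ(X, V)), valO hV r = c := by
  obtain ⟨c, rfl⟩ := IsLocalRing.residue_surjective c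
  obtain ⟨V, hV, r, rfl⟩ := exists_germO c
  exact ⟨V ⊓ U, mem_inf hV hU, inf_le_right, resO inf_le_left r, by
    rw [valO_resO]; rfl⟩

/-- Residue classes lift to functions, so a pure tensor is the value of a function times a section;
two summands are added on the intersection of their domains. -/
theorem exists_val (hU : x ∈ U) (c : Fibre M x) :
    ∃ (V : X.Opens) (hV : x ∈ V) (_ : V ≤ U) (m : Γ(M, V)), val M hV m = c := by
  induction c using TensorProduct.induction_on with
  | zero => exact ⟨U, hU, le_rfl, 0, map_zero _⟩
  | tmul c m =>
    obtain ⟨V, hV, h, r, rfl⟩ := exists_valO hU c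
    obtain ⟨W, hW, h', m, rfl⟩ := exists_germ M hV m
    refine ⟨W, hW, h'.trans h, resO h' r • m, ?_⟩
    rw [val_smul, valO_resO, val_def, TensorProduct.smul_tmul', smul_eq_mul, mul_one]
  | add a b ha hb =>
    obtain ⟨V, hV, h, m, rfl⟩ := ha
    obtain ⟨W, hW, h', n, rfl⟩ := hb
    exact ⟨V ⊓ W, mem_inf hV hW, inf_le_left.trans h, res M inf_le_left m + res M inf_le_right n,
      by rw [map_add, val_res, val_res]⟩

/-- The basis of the fibre given by a frame. -/
def IsFrame.fibreBasis {s : Fin d → Γ(M, U)} (hs : IsFrame M s) (hx : x ∈ U) :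
    Module.Basis (Fin d) (kappa x) (Fibre M x) :=
  (hs.stalkBasis hx).baseChange (kappa x)

theorem IsFrame.fibreBasis_apply {s : Fin d → Γ(M, U)} (hs : IsFrame M s) (hx : x ∈ U)
    (i : Fin d) : hs.fibreBasis hx i = val M hx (s i) := by
  simp [IsFrame.fibreBasis, hs.stalkBasis_apply, val_def]

theorem IsFrame.val_eq_sum {s : Fin d → Γ(M, U)} (hs : IsFrame M s) (hx : x ∈ V) (h : V ≤ U)
    (m : Γ(M, V)) :
    val M hx m = ∑ i, valO hx ((hs.basis h).repr m i) • hs.fibreBasis (h hx) i := by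
  conv_lhs => rw [← (hs.basis h).sum_repr m, map_sum]
  simp [val_smul, hs.fibreBasis_apply, val_res]

theorem IsFrame.fibreBasis_repr_val {s : Fin d → Γ(M, U)} (hs : IsFrame M s) (hx : x ∈ V)
    (h : V ≤ U) (m : Γ(M, V)) (i : Fin d) :
    (hs.fibreBasis (h hx)).repr (val M hx m) i = valO hx ((hs.basis h).repr m i) := by
  rw [hs.val_eq_sum hx h, Module.Basis.repr_sum_self]

end Stalk

theorem IsVectorBundle.exists_isFrame (hM : IsVectorBundle M d) (x : X) :
    ∃ (U : X.Opens) (_ : x ∈ U) (s : Fin d → Γ(M, U)), IsFrame M s := by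
  obtain ⟨U, hU, s, hs⟩ := hM x
  exact ⟨U, hU, s, hs⟩

theorem IsVectorBundle.exists_isFrame_affine (hM : IsVectorBundle M d) {x : X} (hx : x ∈ U) :
    ∃ (V : X.Opens) (_ : x ∈ V) (_ : V ≤ U) (_ : IsAffineOpen V) (s : Fin d → Γ(M, V)),
      IsFrame M s := by
  obtain ⟨V, hV, s, hs⟩ := hM x
  obtain ⟨W, hW, hxW, h⟩ := X.isBasis_affineOpens.exists_subset_of_mem_open
    (show x ∈ ((V ⊓ U : X.Opens) : Set X) from ⟨hV, hx⟩) (V ⊓ U).isOpen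
  obtain ⟨W, hW, rfl⟩ := hW
  exact ⟨W, hxW, fun y hy => (h hy).2, hW, _,
    IsFrame.restrict hs (fun y hy => (h hy).1)⟩

theorem IsVectorBundle.finrank_fibre (hM : IsVectorBundle M d) (x : X) :
    Module.finrank (kappa x) (Fibre M x) = d := by
  obtain ⟨U, hU, s, hs⟩ := hM.exists_isFrame x
  simp [Module.finrank_eq_card_basis (hs.fibreBasis hU)]

theorem IsVectorBundle.finite_fibre (hM : IsVectorBundle M d) (x : X) :
    Module.Finite (kappa x) (Fibre M x) := by
  obtain ⟨U, hU, s, hs⟩ := hM.exists_isFrame x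
  exact Module.Finite.of_basis (hs.fibreBasis hU)

/-- Sections whose values form a basis of the fibre at a point are a frame near that point. -/
theorem IsFrame.exists_isFrame_of_linearIndependent {s : Fin d → Γ(M, U)} (hs : IsFrame M s)
    {x : X} (hx : x ∈ U) (t : Fin d → Γ(M, U))
    (ht : LinearIndependent (kappa x) fun i => val M hx (t i)) :
    ∃ (V : X.Opens) (h : V ≤ U), x ∈ V ∧ IsFrame M fun i => res M h (t i) := by
  classical
  let A : Matrix (Fin d) (Fin d) Γ(X, U) := (hs.basis le_rfl).toMatrix t
  -- `A` expresses `t` in the frame `s`. At `x` its value is the change of basis between two bases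
  -- of the fibre, so the determinant is nonzero there; the basic open of the determinant is the
  -- neighbourhood sought.
  have hA : valO hx A.det ≠ 0 := by
    rw [RingHom.map_det]
    have h1 : (valO hx).mapMatrix A = (hs.fibreBasis hx).toMatrix fun i => val M hx (t i) := by
      ext i j
      simp [A, Module.Basis.toMatrix_apply, hs.fibreBasis_repr_val hx le_rfl]
    have h2 : IsUnit ((hs.fibreBasis hx).det fun i => val M hx (t i)) := by
      rw [← Module.Basis.is_basis_iff_det]
      refine ⟨ht, ?_⟩
      have := Module.Finite.of_basis (hs.fibreBasis hx)
      have := ht.span_eq_top_of_card_eq_finrank' (by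
        simp [Module.finrank_eq_card_basis (hs.fibreBasis hx)])
      exact this
    rw [h1, ← Module.Basis.det_apply]
    exact h2.ne_zero
  refine ⟨X.basicOpen A.det, X.basicOpen_le _, (valO_ne_zero_iff hx _).1 hA, fun W hW => ?_⟩
  have hWU : W ≤ U := hW.trans (X.basicOpen_le _)
  have hmat : (hs.basis hWU).toMatrix (fun i => res M hWU (t i)) = (resO hWU).mapMatrix A := by
    ext i j
    have := hs.basis_repr_res le_rfl hWU (t j) i
    simp [A, Module.Basis.toMatrix_apply, this]
  have hu : IsUnit ((hs.basis hWU).det fun i => res M hWU (t i)) := by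
    rw [Module.Basis.det_apply, hmat, ← RingHom.map_det, ← resO_resO (X.basicOpen_le A.det) hW]
    exact (X.toRingedSpace.isUnit_res_basicOpen A.det).map (resO hW)
  obtain ⟨h1, h2⟩ := ((hs.basis hWU).is_basis_iff_det).2 hu
  convert (Module.Basis.mk h1 h2.ge).equivFun.symm.bijective using 1
  ext c
  simp [Module.Basis.equivFun_symm_apply, res_res]

end Frames

/-! ### Sections on affine opens -/

section QuasiCoherence

variable {X : Scheme.{u}} {M : X.Modules} {d : ℕ} {U V : X.Opens}

theorem basicOpen_resO (h : V ≤ U) (f : Γ(X, U)) : X.basicOpen (resO h f) = V ⊓ X.basicOpen f :=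
  X.basicOpen_res f (homOfLE h).op

theorem exists_pow_mul_eq_zero (hU : IsCompact (U : Set X)) (f r : Γ(X, U))
    (h : resO (X.basicOpen_le f) r = 0) : ∃ n : ℕ, f ^ n * r = 0 :=
  exists_pow_mul_eq_zero_of_res_basicOpen_eq_zero_of_isCompact X hU r f h

theorem exists_resO_eq_pow_mul (hU : IsAffineOpen U) (f : Γ(X, U)) (r : Γ(X, X.basicOpen f)) :
    ∃ (n : ℕ) (y : Γ(X, U)),
      resO (X.basicOpen_le f) y = resO (X.basicOpen_le f) f ^ n * r :=
  exists_eq_pow_mul_of_isAffineOpen X U hU f r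

/-- The statement for functions is applied to each coordinate. It is given for all large exponents
so that finitely many charts can share one, and with `D` only propositionally a basic open so that
it applies to intersections `V ⊓ X.basicOpen f`. -/
theorem IsFrame.exists_pow_smul_eq_zero {s : Fin d → Γ(M, U)} (hs : IsFrame M s) (hVU : V ≤ U)
    (hV : IsCompact (V : Set X)) (f : Γ(X, V)) {D : X.Opens} (hD : D = X.basicOpen f) (hDV : D ≤ V)
    (m : Γ(M, V)) (h : res M hDV m = 0) : ∃ n : ℕ, ∀ N, n ≤ N → f ^ N • m = 0 := by
  subst hD
  have h1 : ∀ i, ∃ n : ℕ, f ^ n * (hs.basis hVU).repr m i = 0 := fun i => by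
    refine exists_pow_mul_eq_zero hV f _ ?_
    rw [← hs.basis_repr_res hVU (X.basicOpen_le f), h]
    simp
  choose n hn using h1
  refine ⟨Finset.univ.sup n, fun N hN => (hs.basis hVU).ext_elem fun i => ?_⟩
  obtain ⟨c, rfl⟩ := Nat.exists_eq_add_of_le ((Finset.le_sup (Finset.mem_univ i)).trans hN)
  simp only [map_smul, Finsupp.smul_apply, smul_eq_mul, map_zero, Finsupp.zero_apply]
  rw [add_comm, pow_add, mul_assoc, hn, mul_zero]

theorem IsFrame.exists_res_eq_pow_smul {s : Fin d → Γ(M, V)} (hs : IsFrame M s)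
    (hV : IsAffineOpen V) (f : Γ(X, V)) {D : X.Opens} (hD : D = X.basicOpen f) (hDV : D ≤ V)
    (t : Γ(M, D)) : ∃ n : ℕ, ∀ N, n ≤ N → ∃ m : Γ(M, V), res M hDV m = resO hDV f ^ N • t := by
  subst hD
  have h1 : ∀ i, ∃ (n : ℕ) (y : Γ(X, V)), resO hDV y =
      resO hDV f ^ n * (hs.basis hDV).repr t i := fun i => exists_resO_eq_pow_mul hV f _
  choose n y hy using h1
  refine ⟨Finset.univ.sup n, fun N hN => ⟨∑ i, (f ^ (N - n i) * y i) • s i, ?_⟩⟩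
  conv_rhs => rw [← (hs.basis hDV).sum_repr t, Finset.smul_sum]
  rw [map_sum]
  refine Finset.sum_congr rfl fun i _ => ?_
  have h2 : n i ≤ N := (Finset.le_sup (Finset.mem_univ i)).trans hN
  rw [res_smul, map_mul, hy, map_pow, ← mul_assoc, ← pow_add, Nat.sub_add_cancel h2, smul_smul,
    hs.basis_apply]

/-- A finite cover of an affine open by affine opens on which a vector bundle has a frame. -/
theorem IsVectorBundle.exists_finite_cover (hM : IsVectorBundle M d) (hU : IsAffineOpen U) :
    ∃ (ι : Type u) (_ : Finite ι) (V : ι → X.Opens) (_ : ∀ i, V i ≤ U) (_ : U ≤ iSup V)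
      (_ : ∀ i, IsAffineOpen (V i)) (s : ∀ i, Fin d → Γ(M, V i)), ∀ i, IsFrame M (s i) := by
  choose V hxV hVU hV s hs using fun x : U => hM.exists_isFrame_affine x.2
  obtain ⟨t, ht⟩ := hU.isCompact.elim_finite_subcover (fun x : U => (V x : Set X))
    (fun x => (V x).isOpen) (fun x hx => Set.mem_iUnion.2 ⟨⟨x, hx⟩, hxV ⟨x, hx⟩⟩)
  refine ⟨t, inferInstance, fun i => V i, fun i => hVU i, fun x hx => ?_, fun i => hV i,
    fun i => s i, fun i => hs i⟩
  obtain ⟨i, hi⟩ := Set.mem_iUnion.1 (ht hx)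
  obtain ⟨hi, hx⟩ := Set.mem_iUnion.1 hi
  exact Opens.mem_iSup.2 ⟨⟨i, hi⟩, hx⟩

theorem IsVectorBundle.exists_pow_smul_eq_zero (hM : IsVectorBundle M d) (hU : IsAffineOpen U)
    (f : Γ(X, U)) (m : Γ(M, U)) (h : res M (X.basicOpen_le f) m = 0) :
    ∃ n : ℕ, f ^ n • m = 0 := by
  obtain ⟨ι, _, V, hVU, hUV, hV, s, hs⟩ := hM.exists_finite_cover hU
  have h1 : ∀ i, ∃ n : ℕ, ∀ N, n ≤ N → resO (hVU i) f ^ N • res M (hVU i) m = 0 := fun i => by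
    refine (hs i).exists_pow_smul_eq_zero le_rfl (hV i).isCompact _ (basicOpen_resO (hVU i) f).symm
      inf_le_left _ ?_
    rw [res_res, ← res_res M (X.basicOpen_le f) inf_le_right, h, map_zero]
  choose n hn using h1
  have := Fintype.ofFinite ι
  refine ⟨Finset.univ.sup n, res_ext M hVU hUV fun i => ?_⟩
  rw [res_smul, map_pow, hn i _ (Finset.le_sup (Finset.mem_univ i)), map_zero]

/-- On each member of a finite affine cover with frames, `f ^ N • t` extends. Two extensions agree
where `f` is invertible, hence agree on the quasi-compact overlaps after multiplication by a further
power `f ^ P`, and then they glue. -/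
theorem IsVectorBundle.exists_res_eq_pow_smul (hM : IsVectorBundle M d) (hU : IsAffineOpen U)
    (f : Γ(X, U)) (t : Γ(M, X.basicOpen f)) :
    ∃ (n : ℕ) (m : Γ(M, U)),
      res M (X.basicOpen_le f) m = resO (X.basicOpen_le f) f ^ n • t := by
  obtain ⟨ι, _, V, hVU, hUV, hV, s, hs⟩ := hM.exists_finite_cover hU
  have := Fintype.ofFinite ι
  have h1 : ∀ i, ∃ n : ℕ, ∀ N, n ≤ N → ∃ m : Γ(M, V i),
      res M (inf_le_left : V i ⊓ X.basicOpen f ≤ V i) m =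
        resO (inf_le_left : V i ⊓ X.basicOpen f ≤ V i) (resO (hVU i) f) ^ N •
          res M (inf_le_right : V i ⊓ X.basicOpen f ≤ X.basicOpen f) t := fun i =>
    (hs i).exists_res_eq_pow_smul (hV i) _ (basicOpen_resO (hVU i) f).symm inf_le_left _
  choose n hn using h1
  choose m hm using fun i => hn i _ (Finset.le_sup (Finset.mem_univ i))
  set N := Finset.univ.sup n
  have h2 : ∀ i j, ∃ n : ℕ, ∀ N, n ≤ N →
      resO (inf_le_left.trans (hVU i) : V i ⊓ V j ≤ U) f ^ N •
        (res M (inf_le_left : V i ⊓ V j ≤ V i) (m i) -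
          res M (inf_le_right : V i ⊓ V j ≤ V j) (m j)) = 0 := fun i j => by
    refine (hs i).exists_pow_smul_eq_zero inf_le_left
      (hU.isQuasiSeparated _ _ (hVU i) (V i).isOpen (hV i).isCompact (hVU j) (V j).isOpen
        (hV j).isCompact) _ (basicOpen_resO (inf_le_left.trans (hVU i)) f).symm inf_le_left _ ?_
    rw [map_sub, res_res, res_res, sub_eq_zero]
    have hi := congrArg (res M (inf_le_inf_right _ inf_le_left :
      V i ⊓ V j ⊓ X.basicOpen f ≤ V i ⊓ X.basicOpen f)) (hm i)
    have hj := congrArg (res M (inf_le_inf_right _ inf_le_right :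
      V i ⊓ V j ⊓ X.basicOpen f ≤ V j ⊓ X.basicOpen f)) (hm j)
    simp only [res_res, res_smul, map_pow, resO_resO] at hi hj
    rw [hi, hj]
  choose p hp using h2
  set P := Finset.univ.sup fun i => Finset.univ.sup (p i)
  obtain ⟨m', hm'⟩ := res_glue M hVU hUV (fun i => resO (hVU i) f ^ P • m i) (fun i j => by
    have := hp i j P ((Finset.le_sup (f := p i) (Finset.mem_univ j)).trans
      (Finset.le_sup (f := fun i => Finset.univ.sup (p i)) (Finset.mem_univ i)))
    rw [smul_sub, sub_eq_zero] at this
    simpa only [res_smul, map_pow, resO_resO] using this)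
  refine ⟨P + N, m', res_ext M (W := fun i => V i ⊓ X.basicOpen f) (fun i => inf_le_right)
    (fun x hx => ?_) fun i => ?_⟩
  · obtain ⟨i, hi⟩ := Opens.mem_iSup.1 (hUV (X.basicOpen_le f hx))
    exact Opens.mem_iSup.2 ⟨i, hi, hx⟩
  · have h3 := congrArg (res M (inf_le_left : V i ⊓ X.basicOpen f ≤ V i)) (hm' i)
    rw [res_smul, hm i, smul_smul] at h3
    simp only [res_res, res_smul, map_pow, resO_resO] at h3 ⊢
    rw [h3, pow_add]

end QuasiCoherence

/-! ### Closed points -/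

section ClosedPoints

variable {X : Scheme.{u}} {M : X.Modules} {d : ℕ} {U V : X.Opens}

/-- In a Jacobson space a nonempty closed set, such as the complement of the union, would contain a
closed point. -/
theorem isOpenCover_of_closedPoints [JacobsonSpace X] {ι : Type*} (U : ι → X.Opens)
    (h : ∀ x : X, IsClosed ({x} : Set X) → ∃ i, x ∈ U i) (x : X) : ∃ i, x ∈ U i := by
  by_contra hx
  have hZ : ((⨆ i, U i : X.Opens) : Set X)ᶜ.Nonempty := ⟨x, fun h' => hx (Opens.mem_iSup.1 h')⟩
  obtain ⟨y, hy, hy'⟩ := nonempty_inter_closedPoints hZ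
    (⨆ i, U i : X.Opens).isOpen.isClosed_compl.isLocallyClosed
  exact hy (Opens.mem_iSup.2 (h y hy'))

/-- On a reduced scheme a nonzero function has nonempty basic open, and that open set contains a
closed point of the Jacobson space. -/
theorem eq_zero_of_valO [JacobsonSpace X] [IsReduced X] (r : Γ(X, V))
    (h : ∀ (x : X) (hx : x ∈ V), IsClosed ({x} : Set X) → valO hx r = 0) : r = 0 := by
  rw [← basicOpen_eq_bot_iff]
  by_contra hne
  obtain ⟨y, hy, hy'⟩ := nonempty_inter_closedPoints
    ((Opens.ne_bot_iff_nonempty _).1 hne) (X.basicOpen r).isOpen.isLocallyClosed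
  exact (valO_ne_zero_iff (X.basicOpen_le r hy) r).2 hy (h y _ hy')

theorem IsVectorBundle.eq_zero_of_val [JacobsonSpace X] [IsReduced X] (hM : IsVectorBundle M d)
    (m : Γ(M, V)) (h : ∀ (x : X) (hx : x ∈ V), IsClosed ({x} : Set X) → val M hx m = 0) :
    m = 0 := by
  choose U hxU hUV hU s hs using fun x : V => hM.exists_isFrame_affine x.2
  refine res_ext M hUV (fun x hx => Opens.mem_iSup.2 ⟨⟨x, hx⟩, hxU ⟨x, hx⟩⟩) fun i => ?_
  rw [map_zero]
  refine ((hs i).basis le_rfl).ext_elem fun j => ?_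
  rw [map_zero, Finsupp.zero_apply]
  refine eq_zero_of_valO _ fun x hx hxc => ?_
  rw [← (hs i).fibreBasis_repr_val hx le_rfl, val_res, h x _ hxc]
  simp

end ClosedPoints

/-! ### Morphisms defined on sections -/

section Hom

variable {X : Scheme.{u}} {M N : X.Modules} {U V : X.Opens}

theorem app_res (φ : M ⟶ N) (h : V ≤ U) (m : Γ(M, U)) :
    φ.app V (res M h m) = res N h (φ.app U m) :=
  ConcreteCategory.congr_hom (φ.mapPresheaf.naturality (homOfLE h).op) m

/-- A morphism of `𝒪_X`-modules from a compatible family of linear maps on sections. -/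
def homOfLinear (f : ∀ U : X.Opens, Γ(M, U) →ₗ[Γ(X, U)] Γ(N, U))
    (hf : ∀ (U V : X.Opens) (h : V ≤ U) (m : Γ(M, U)), f V (res M h m) = res N h (f U m)) :
    M ⟶ N :=
  ⟨PresheafOfModules.homMk
    { app := fun U => AddCommGrpCat.ofHom (f U.unop).toAddMonoidHom
      naturality := fun U V i => by
        ext m
        exact hf U.unop V.unop (leOfHom i.unop) m }
    (fun U r m => (f U.unop).map_smul r m)⟩

theorem isIso_of_bijective (φ : M ⟶ N) (h : ∀ U, Function.Bijective (φ.app U)) : IsIso φ := by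
  rw [Scheme.Modules.Hom.isIso_iff_isIso_app]
  exact fun U => (ConcreteCategory.isIso_iff_bijective _).2 (h U)

theorem bijective_app_of_isIso (φ : M ⟶ N) [IsIso φ] (U : X.Opens) :
    Function.Bijective (φ.app U) :=
  (ConcreteCategory.isIso_iff_bijective _).1 inferInstance

/-- A map of sheaves which is bijective on a basis of opens is bijective on all opens. -/
theorem bijective_of_basis {F : X.Opens → Type u} {G : X.Opens → Type u}
    (resF : ∀ {U V : X.Opens}, V ≤ U → F U → F V) (resG : ∀ {U V : X.Opens}, V ≤ U → G U → G V)
    (resG_resG : ∀ {U V W : X.Opens} (h : V ≤ U) (h' : W ≤ V) (s : G U),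
      resG h' (resG h s) = resG (h'.trans h) s)
    (extF : ∀ {ι : Type u} {V : X.Opens} {W : ι → X.Opens} (hW : ∀ i, W i ≤ V) (_ : V ≤ iSup W)
      (s t : F V), (∀ i, resF (hW i) s = resF (hW i) t) → s = t)
    (extG : ∀ {ι : Type u} {V : X.Opens} {W : ι → X.Opens} (hW : ∀ i, W i ≤ V) (_ : V ≤ iSup W)
      (s t : G V), (∀ i, resG (hW i) s = resG (hW i) t) → s = t)
    (glueF : ∀ {ι : Type u} {V : X.Opens} {W : ι → X.Opens} (hW : ∀ i, W i ≤ V) (_ : V ≤ iSup W)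
      (s : ∀ i, F (W i)), (∀ i j, resF (inf_le_left : W i ⊓ W j ≤ W i) (s i) =
        resF (inf_le_right : W i ⊓ W j ≤ W j) (s j)) → ∃ t : F V, ∀ i, resF (hW i) t = s i)
    {T : X.Opens} (f : ∀ V, V ≤ T → F V → G V)
    (hf : ∀ {U V : X.Opens} (hU : U ≤ T) (h : V ≤ U) (s : F U),
      f V (h.trans hU) (resF h s) = resG h (f U hU s))
    (P : X.Opens → Prop) (hP : ∀ (V : X.Opens) (_ : V ≤ T) (x : X), x ∈ V →
      ∃ W : X.Opens, P W ∧ W ≤ V ∧ x ∈ W)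
    (hbij : ∀ (W : X.Opens) (hW : W ≤ T), P W → Function.Bijective (f W hW))
    (V : X.Opens) (hV : V ≤ T) : Function.Bijective (f V hV) := by
  have hcov : ∀ V : X.Opens, V ≤ T → ∃ W : V → X.Opens, (∀ i, P (W i)) ∧ (∀ i, W i ≤ V) ∧
      V ≤ iSup W := fun V hV => by
    choose W hPW hWV hxW using fun x : V => hP V hV x x.2
    exact ⟨W, hPW, hWV, fun x hx => Opens.mem_iSup.2 ⟨⟨x, hx⟩, hxW ⟨x, hx⟩⟩⟩
  have hinj : ∀ (V : X.Opens) (hV : V ≤ T), Function.Injective (f V hV) := by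
    intro V hV s t hst
    obtain ⟨W, hPW, hWV, hVW⟩ := hcov V hV
    refine extF hWV hVW s t fun i => (hbij _ ((hWV i).trans hV) (hPW i)).1 ?_
    rw [hf hV, hf hV, hst]
  refine ⟨hinj V hV, fun t => ?_⟩
  obtain ⟨W, hPW, hWV, hVW⟩ := hcov V hV
  choose s hs using fun i => (hbij _ ((hWV i).trans hV) (hPW i)).2 (resG (hWV i) t)
  -- The local preimages agree on overlaps because injectivity is already known on all opens, not
  -- only on those of the basis.
  obtain ⟨s', hs'⟩ := glueF hWV hVW s fun i j => by
    refine hinj _ (inf_le_left.trans ((hWV i).trans hV)) ?_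
    rw [hf ((hWV i).trans hV), hf ((hWV j).trans hV), hs, hs, resG_resG, resG_resG]
  refine ⟨s', extG hWV hVW _ _ fun i => ?_⟩
  rw [← hf hV, hs', hs]

theorem bijective_app_of_basis (φ : M ⟶ N) (P : X.Opens → Prop)
    (hP : ∀ (V : X.Opens) (x : X), x ∈ V → ∃ W : X.Opens, P W ∧ W ≤ V ∧ x ∈ W)
    (hbij : ∀ W : X.Opens, P W → Function.Bijective (φ.app W)) (V : X.Opens) :
    Function.Bijective (φ.app V) :=
  bijective_of_basis (F := fun V => Γ(M, V)) (G := fun V => Γ(N, V)) (T := ⊤)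
    (fun h => res M h) (fun h => res N h)
    (fun h h' s => res_res N h h' s) (fun hW hV _ _ h => res_ext M hW hV h)
    (fun hW hV _ _ h => res_ext N hW hV h) (fun hW hV s h => res_glue M hW hV s h)
    (fun V _ => φ.app V) (fun _ h s => app_res φ h s) P (fun V _ => hP V)
    (fun W _ => hbij W) V le_top

theorem isIso_of_basis (φ : M ⟶ N) (P : X.Opens → Prop)
    (hP : ∀ (V : X.Opens) (x : X), x ∈ V → ∃ W : X.Opens, P W ∧ W ≤ V ∧ x ∈ W)
    (hbij : ∀ W : X.Opens, P W → Function.Bijective (φ.app W)) : IsIso φ :=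
  isIso_of_bijective φ (bijective_app_of_basis φ P hP hbij)

/-- Here the source sheaf consists of `d`-tuples of functions. This use is why `bijective_of_basis`
is phrased for families of types with restriction maps and not for sheaves of modules. -/
theorem isFrame_of_basis_opens {d : ℕ} (s : Fin d → Γ(M, U)) (P : X.Opens → Prop)
    (hP : ∀ (V : X.Opens) (_ : V ≤ U) (x : X), x ∈ V → ∃ W : X.Opens, P W ∧ W ≤ V ∧ x ∈ W)
    (hbij : ∀ (W : X.Opens) (h : W ≤ U), P W →
      Function.Bijective fun c : Fin d → Γ(X, W) => ∑ i, c i • res M h (s i)) :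
    IsFrame M s := by
  refine bijective_of_basis (F := fun V => Fin d → Γ(structureSheaf X, V)) (G := fun V => Γ(M, V))
    (T := U) (fun h c i => res _ h (c i)) (fun h => res M h)
    (fun h h' s => res_res M h h' s)
    (fun hW hV _ _ h => funext fun i => res_ext _ hW hV fun j => congrFun (h j) i)
    (fun hW hV _ _ h => res_ext M hW hV h)
    (fun hW hV s h => ?_)
    (fun V h c => ∑ i, (show Γ(X, V) from c i) • res M h (s i)) (fun hU h c => ?_) P hP hbij
  · choose t ht using fun i => res_glue (structureSheaf X) hW hV (fun j => s j i)
      fun j j' => congrFun (h j j') i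
    exact ⟨t, fun j => funext fun i => ht i j⟩
  · rw [map_sum]
    refine Finset.sum_congr rfl fun i _ => ?_
    rw [res_smul, res_res]
    rfl

end Hom

/-! ### The algebra of endomorphisms -/

section EndRing

variable {X : Scheme.{u}} {E A : X.Modules} {U V : X.Opens}

namespace EndSection

instance : One (EndSection E U) := ⟨⟨fun _ _ => 1, fun _ _ _ => rfl⟩⟩

instance : Mul (EndSection E U) :=
  ⟨fun φ ψ => ⟨fun V h => φ.app V h * ψ.app V h, fun hV hW s => by
    simp [φ.map_app hV hW, ψ.map_app hV hW]⟩⟩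

@[simp] theorem one_app (V : X.Opens) (h : V ≤ U) : (1 : EndSection E U).app V h = 1 := rfl

@[simp] theorem mul_app (φ ψ : EndSection E U) (V : X.Opens) (h : V ≤ U) :
    (φ * ψ).app V h = φ.app V h * ψ.app V h := rfl

instance : Ring (EndSection E U) where
  __ := (inferInstance : AddCommGroup (EndSection E U))
  mul_assoc a b c := ext' fun V h => by simp [mul_assoc]
  one_mul a := ext' fun V h => by simp
  mul_one a := ext' fun V h => by simp
  left_distrib a b c := ext' fun V h => by simp [mul_add]
  right_distrib a b c := ext' fun V h => by simp [add_mul]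
  zero_mul a := ext' fun V h => by simp
  mul_zero a := ext' fun V h => by simp

instance : Algebra Γ(X, U) (EndSection E U) :=
  Algebra.ofModule (fun r a b => ext' fun V h => by simp) (fun r a b => ext' fun V h => by simp)

/-- Restriction of endomorphisms as a ring homomorphism. -/
def restrictHom (h : V ≤ U) : EndSection E U →+* EndSection E V where
  __ := restrict h
  map_one' := rfl
  map_mul' _ _ := rfl

@[simp] theorem restrictHom_app (h : V ≤ U) (φ : EndSection E U) (W : X.Opens)
    (hW : W ≤ V) : (restrictHom h φ).app W hW = φ.app W (hW.trans h) := rfl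

theorem restrictHom_smul (h : V ≤ U) (r : Γ(X, U)) (φ : EndSection E U) :
    restrictHom h (r • φ) = resO h r • restrictHom h φ :=
  ext' fun W hW => by simp [resO_resO]

theorem eq_of_cover {φ ψ : EndSection E U}
    (h : ∀ x ∈ U, ∃ (V : X.Opens) (hV : V ≤ U), x ∈ V ∧ restrictHom hV φ = restrictHom hV ψ) :
    φ = ψ := by
  choose V hVU hxV hV using fun x : U => h x x.2
  refine ext' fun W hW => LinearMap.ext fun s => ?_
  refine res_ext E (W := fun i : W => W ⊓ V ⟨i, hW i.2⟩) (fun i => inf_le_left)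
    (fun x hx => Opens.mem_iSup.2 ⟨⟨x, hx⟩, hx, hxV ⟨x, hW hx⟩⟩) fun i => ?_
  rw [← φ.map_app, ← ψ.map_app]
  exact congrArg (fun θ => EndSection.app θ (W ⊓ V ⟨i, hW i.2⟩) inf_le_right _) (hV ⟨i, hW i.2⟩)

/-- The endomorphism of the fibre induced by an endomorphism. -/
def fibre {x : X} (hx : x ∈ U) (φ : EndSection E U) : Module.End (kappa x) (Fibre E x) :=
  (φ.stalk hx).baseChange (kappa x)

theorem fibre_val {x : X} (hx : x ∈ V) (h : V ≤ U) (φ : EndSection E U) (s : Γ(E, V)) :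
    φ.fibre (h hx) (val E hx s) = val E hx (φ.app V h s) := by
  rw [fibre, val_def, LinearMap.baseChange_tmul, φ.stalk_germ (h hx) hx h, val_def]

theorem fibre_mul {x : X} (hx : x ∈ U) (φ ψ : EndSection E U) :
    (φ * ψ).fibre hx = φ.fibre hx * ψ.fibre hx := by
  refine LinearMap.ext fun v => ?_
  obtain ⟨V, hV, h, s, rfl⟩ := exists_val hx v
  rw [fibre_val hV h, Module.End.mul_apply, fibre_val hV h, fibre_val hV h]
  rfl

theorem fibre_restrictHom {x : X} (hx : x ∈ V) (h : V ≤ U) (φ : EndSection E U) :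
    (restrictHom h φ).fibre hx = φ.fibre (h hx) := by
  refine LinearMap.ext fun v => ?_
  obtain ⟨W, hW, h', s, rfl⟩ := exists_val hx v
  rw [fibre_val hW h', fibre_val hW (h'.trans h)]
  rfl

theorem fibre_one {x : X} (hx : x ∈ U) : (1 : EndSection E U).fibre hx = 1 := by
  refine LinearMap.ext fun v => ?_
  obtain ⟨V, hV, h, s, rfl⟩ := exists_val hx v
  rw [fibre_val hV h]
  rfl

/-- A section of a vector bundle on a reduced Jacobson scheme is determined by its values at closed
points. Algebraic identities between endomorphisms are thereby reduced to linear algebra in closed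
fibres. -/
theorem eq_of_fibre [JacobsonSpace X] [IsReduced X] {d : ℕ} (hE : IsVectorBundle E d)
    {φ ψ : EndSection E U}
    (h : ∀ (x : X) (hx : x ∈ U), IsClosed ({x} : Set X) → φ.fibre hx = ψ.fibre hx) : φ = ψ := by
  refine ext' fun V hV => LinearMap.ext fun s => sub_eq_zero.1 <|
    hE.eq_zero_of_val _ fun x hx hxc => ?_
  rw [map_sub, ← fibre_val hx hV, ← fibre_val hx hV, h x _ hxc, sub_self]

end EndSection

/-- The endomorphism of `E|_U` given by a section of a sheaf mapping to `End(E)`. -/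
def act (ι : A ⟶ endSheaf E) (a : Γ(A, U)) : EndSection E U := toEndSection E (ι.app U a)

variable {ι : A ⟶ endSheaf E}

theorem act_add (a b : Γ(A, U)) : act ι (a + b) = act ι a + act ι b :=
  map_add (ι.app U).hom a b

theorem act_zero : act ι (0 : Γ(A, U)) = 0 :=
  map_zero (ι.app U).hom

theorem act_smul (r : Γ(X, U)) (a : Γ(A, U)) : act ι (r • a) = r • act ι a :=
  Scheme.Modules.Hom.app_smul ι r a

theorem act_res (h : V ≤ U) (a : Γ(A, U)) :
    act ι (res A h a) = EndSection.restrictHom h (act ι a) :=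
  app_res ι h a

/-- The action of the fibre of `A` on the fibre of `E`. -/
def fibreAct (ι : A ⟶ endSheaf E) (x : X) :
    Fibre A x →ₗ[kappa x] Module.End (kappa x) (Fibre E x) :=
  endFibreMap E x ∘ₗ fibreMap ι x

theorem fibreAct_val {x : X} (hx : x ∈ U) (a : Γ(A, U)) :
    fibreAct ι x (val A hx a) = (act ι a).fibre hx := by
  rw [fibreAct, LinearMap.comp_apply, fibreMap, val_def, LinearMap.baseChange_tmul, stalkMap_germ,
    endFibreMap, LinearMap.liftBaseChange_tmul, one_smul, LinearMap.comp_apply, endStalkMap_germ]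
  rfl

theorem fibreAct_val_val {x : X} (hx : x ∈ V) (h : V ≤ U) (a : Γ(A, U)) (s : Γ(E, V)) :
    fibreAct ι x (val A (h hx) a) (val E hx s) = val E hx ((act ι a).app V h s) := by
  rw [fibreAct_val, EndSection.fibre_val]

/-- Evaluation of the sections of `A` on a section of `E`. -/
def evalAt (ι : A ⟶ endSheaf E) (e : Γ(E, U)) (h : V ≤ U) :
    Γ(A, V) →ₗ[Γ(X, V)] Γ(E, V) where
  toFun a := (act ι a).app V le_rfl (res E h e)
  map_add' a b := by rw [act_add]; rfl
  map_smul' r a := by rw [act_smul]; simp [resO_self]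

theorem evalAt_apply (e : Γ(E, U)) (h : V ≤ U) (a : Γ(A, V)) :
    evalAt ι e h a = (act ι a).app V le_rfl (res E h e) := rfl

theorem evalAt_res {W : X.Opens} (e : Γ(E, U)) (h : V ≤ U) (h' : W ≤ V) (a : Γ(A, V)) :
    evalAt ι e (h'.trans h) (res A h' a) = res E h' (evalAt ι e h a) := by
  rw [evalAt_apply, evalAt_apply, act_res, EndSection.restrictHom_app, ← res_res E h h',
    (act ι a).map_app]

/-- A section of `E` on which evaluation is an isomorphism `A ≅ E`. -/
def IsGenerator (ι : A ⟶ endSheaf E) (e : Γ(E, U)) : Prop :=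
  ∀ (V : X.Opens) (h : V ≤ U), Function.Bijective (evalAt ι e h)

theorem evalAt_restrict {W : X.Opens} (e : Γ(E, U)) (h : V ≤ U) (h' : W ≤ V) :
    evalAt ι (res E h e) h' = evalAt ι e (h'.trans h) :=
  LinearMap.ext fun a => by rw [evalAt_apply, evalAt_apply, res_res]

theorem IsGenerator.restrict {e : Γ(E, U)} (he : IsGenerator ι e) (h : V ≤ U) :
    IsGenerator ι (res E h e) := fun W h' => by
  rw [evalAt_restrict]
  exact he W _

theorem isGenerator_of_isFrame {d : ℕ} {e : Γ(E, U)} {a : Fin d → Γ(A, U)} (ha : IsFrame A a)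
    (h : IsFrame E fun i => evalAt ι e le_rfl (a i)) : IsGenerator ι e := by
  intro V hV
  have h1 : evalAt ι e hV =
      ((ha.basis hV).equiv (h.basis hV) (Equiv.refl _) : Γ(A, V) →ₗ[Γ(X, V)] Γ(E, V)) := by
    refine (ha.basis hV).ext fun i => ?_
    rw [LinearEquiv.coe_coe, Module.Basis.equiv_apply, ha.basis_apply, h.basis_apply,
      Equiv.refl_apply, evalAt_res]
  rw [h1]
  exact LinearEquiv.bijective _

theorem IsGenerator.isFrame {d : ℕ} {e : Γ(E, U)} (he : IsGenerator ι e) {a : Fin d → Γ(A, U)}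
    (ha : IsFrame A a) : IsFrame E fun i => evalAt ι e le_rfl (a i) := by
  refine isFrame_of_basis (fun V h => (ha.basis h).map (LinearEquiv.ofBijective _ (he V h)))
    fun V h i => ?_
  rw [Module.Basis.map_apply, ha.basis_apply, LinearEquiv.ofBijective_apply, evalAt_res]

/-- Evaluation at `e` carries a frame of `A` to a frame of `E`, and the values of a frame are a
basis of the fibre. -/
theorem IsGenerator.fibre_bijective {d : ℕ} (hA : IsVectorBundle A d) {e : Γ(E, U)}
    (he : IsGenerator ι e) {x : X} (hx : x ∈ U) :
    Function.Bijective fun c : Fibre A x => fibreAct ι x c (val E hx e) := by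
  obtain ⟨V, hxV, hVU, -, a, ha⟩ := hA.exists_isFrame_affine hx
  have he' := (he.restrict hVU).isFrame ha
  let f : Fibre A x →ₗ[kappa x] Fibre E x := (fibreAct ι x).flip (val E hx e)
  have h1 : f = ((ha.fibreBasis hxV).equiv (he'.fibreBasis hxV) (Equiv.refl _) :
      Fibre A x →ₗ[kappa x] Fibre E x) := by
    refine (ha.fibreBasis hxV).ext fun i => ?_
    rw [LinearEquiv.coe_coe, Module.Basis.equiv_apply, ha.fibreBasis_apply, he'.fibreBasis_apply,
      Equiv.refl_apply, LinearMap.flip_apply, ← val_res hVU hxV, fibreAct_val_val hxV le_rfl,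
      evalAt_apply, res_self]
  exact (congrArg (fun g : Fibre A x →ₗ[kappa x] Fibre E x => Function.Bijective g) h1).mpr
    (LinearEquiv.bijective _)

end EndRing

/-! ### Cartan subalgebras -/

section Cartan

variable {K V : Type u} [Field K] [AddCommGroup V] [Module K V] {d : ℕ}
  {B : Submodule K (Module.End K V)}

theorem isDiag_toMatrix_iff (b : Module.Basis (Fin d) K V) (T : Module.End K V) :
    (LinearMap.toMatrix b b T).IsDiag ↔ ∃ c : Fin d → K, ∀ i, T (b i) = c i • b i := by
  constructor
  · intro h
    refine ⟨fun i => LinearMap.toMatrix b b T i i, fun i => ?_⟩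
    rw [← b.sum_repr (T (b i)), Finset.sum_eq_single i]
    · exact congrArg (· • b i) (LinearMap.toMatrix_apply b b T i i).symm
    · intro j _ hj
      rw [← LinearMap.toMatrix_apply b b T j i, show LinearMap.toMatrix b b T j i = 0 from h hj,
        zero_smul]
    · simp
  · rintro ⟨c, hc⟩ i j hij
    rw [LinearMap.toMatrix_apply, hc, map_smul, Module.Basis.repr_self, Finsupp.smul_apply,
      Finsupp.single_eq_of_ne hij, smul_zero]

/-- The endomorphism with prescribed eigenvalues on a basis. -/
def diagEnd (b : Module.Basis (Fin d) K V) : (Fin d → K) →ₗ[K] Module.End K V where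
  toFun c := b.constr K fun i => c i • b i
  map_add' c c' := b.ext fun i => by
    simp only [Module.Basis.constr_basis, LinearMap.add_apply, Pi.add_apply, add_smul]
  map_smul' r c := b.ext fun i => by
    simp only [Module.Basis.constr_basis, LinearMap.smul_apply, Pi.smul_apply, smul_eq_mul,
      mul_smul, RingHom.id_apply]

@[simp]
theorem diagEnd_apply_basis (b : Module.Basis (Fin d) K V) (c : Fin d → K) (i : Fin d) :
    diagEnd b c (b i) = c i • b i := b.constr_basis K _ i

theorem diagEnd_injective (b : Module.Basis (Fin d) K V) : Function.Injective (diagEnd b) := by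
  intro c c' h
  funext i
  have := congrArg (fun T : Module.End K V => b.repr (T (b i)) i) h
  simpa using this

theorem diagEnd_mul (b : Module.Basis (Fin d) K V) (c c' : Fin d → K) :
    diagEnd b c * diagEnd b c' = diagEnd b (c * c') :=
  b.ext fun i => by simp [smul_smul, mul_comm]

theorem diagEnd_one (b : Module.Basis (Fin d) K V) : diagEnd b 1 = 1 :=
  b.ext fun i => by simp

/-- Diagonality gives one inclusion and equality of dimensions the other. All further properties of
Cartan subalgebras are read off from `K ^ d` through this description. -/
theorem IsCartanSubalgebra.exists_eq_range (hB : IsCartanSubalgebra d B) :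
    ∃ b : Module.Basis (Fin d) K V, B = LinearMap.range (diagEnd b) := by
  obtain ⟨b, hb⟩ := hB.diagonal
  refine ⟨b, Submodule.eq_of_le_of_finrank_eq (fun T hT => ?_) ?_⟩
  · obtain ⟨c, hc⟩ := (isDiag_toMatrix_iff b T).1 (hb T hT)
    exact ⟨c, b.ext fun i => by rw [hc, diagEnd_apply_basis]⟩
  · rw [hB.finrank_eq, LinearMap.finrank_range_of_inj (diagEnd_injective b),
      Module.finrank_fin_fun]

theorem isCartanSubalgebra_range_diagEnd (b : Module.Basis (Fin d) K V) :
    IsCartanSubalgebra d (LinearMap.range (diagEnd b)) where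
  lie_mem := by
    rintro _ ⟨c, rfl⟩ _ ⟨c', rfl⟩
    rw [Ring.lie_def, diagEnd_mul, diagEnd_mul, mul_comm, sub_self]
    exact zero_mem _
  finrank_eq := by
    rw [LinearMap.finrank_range_of_inj (diagEnd_injective b), Module.finrank_fin_fun]
  diagonal := ⟨b, by
    rintro _ ⟨c, rfl⟩
    exact (isDiag_toMatrix_iff b _).2 ⟨c, fun i => diagEnd_apply_basis b c i⟩⟩

theorem IsCartanSubalgebra.mul_mem (hB : IsCartanSubalgebra d B) {S T : Module.End K V}
    (hS : S ∈ B) (hT : T ∈ B) : S * T ∈ B := by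
  obtain ⟨b, rfl⟩ := hB.exists_eq_range
  obtain ⟨c, rfl⟩ := hS
  obtain ⟨c', rfl⟩ := hT
  exact ⟨c * c', (diagEnd_mul b c c').symm⟩

theorem IsCartanSubalgebra.mul_comm (hB : IsCartanSubalgebra d B) {S T : Module.End K V}
    (hS : S ∈ B) (hT : T ∈ B) : S * T = T * S := by
  obtain ⟨b, rfl⟩ := hB.exists_eq_range
  obtain ⟨c, rfl⟩ := hS
  obtain ⟨c', rfl⟩ := hT
  rw [diagEnd_mul, diagEnd_mul, _root_.mul_comm]

theorem IsCartanSubalgebra.one_mem (hB : IsCartanSubalgebra d B) : 1 ∈ B := by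
  obtain ⟨b, rfl⟩ := hB.exists_eq_range
  exact ⟨1, diagEnd_one b⟩

/-- There is a vector on which evaluation is injective on the Cartan subalgebra. -/
theorem IsCartanSubalgebra.exists_separating (hB : IsCartanSubalgebra d B) :
    ∃ v : V, ∀ T ∈ B, T v = 0 → T = 0 := by
  obtain ⟨b, rfl⟩ := hB.exists_eq_range
  -- All coordinates of this vector are `1`, so a diagonal endomorphism sends it to the vector of
  -- its eigenvalues.
  refine ⟨∑ i, b i, ?_⟩
  rintro _ ⟨c, rfl⟩ h
  have h0 : ∑ i, c i • b i = 0 := by simpa using h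
  have : c = 0 := funext (Fintype.linearIndependent_iff.1 b.linearIndependent c h0)
  rw [this, map_zero]

end Cartan

/-! ### Local structure of a bundle of Cartan subalgebras -/

section CartanBundle

variable {X : Scheme.{u}} {E A : X.Modules} {U V : X.Opens} {ι : A ⟶ endSheaf E} {d : ℕ}

/-- Rank-nullity: the fibre of `A` and its image both have dimension `d`. -/
theorem fibreAct_injective (hA : IsVectorBundle A d) {x : X}
    (hC : IsCartanSubalgebra d (LinearMap.range (fibreAct ι x))) :
    Function.Injective (fibreAct ι x) := by
  have := hA.finite_fibre x
  have h1 := LinearMap.finrank_range_add_finrank_ker (K := kappa x) (V := Fibre A x)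
    (V₂ := Module.End (kappa x) (Fibre E x)) (fibreAct ι x)
  rw [hC.finrank_eq, hA.finrank_fibre] at h1
  have h2 : LinearMap.ker (fibreAct ι x) = ⊥ := by
    rw [← Submodule.finrank_eq_zero (R := kappa x) (M := Fibre A x)]
    omega
  refine (injective_iff_map_eq_zero (fibreAct ι x)).2 fun c hc => ?_
  have h3 : c ∈ LinearMap.ker (fibreAct ι x) := hc
  rwa [h2] at h3

/-- A separating vector in the fibre of `E` is lifted to a section `e`. Evaluation at it is
injective on the fibre of `A`, so a frame of `A` applied to `e` has `d` linearly independent values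
at `x`, and it remains a frame of `E` nearby. -/
theorem exists_isGenerator_of_isCartan (hA : IsVectorBundle A d) (hE : IsVectorBundle E d) {x : X}
    (hC : IsCartanSubalgebra d (LinearMap.range (fibreAct ι x))) :
    ∃ (U : X.Opens) (_ : x ∈ U) (e : Γ(E, U)), IsGenerator ι e := by
  obtain ⟨v, hv⟩ := hC.exists_separating
  obtain ⟨U, hU, a, ha⟩ := hA.exists_isFrame x
  obtain ⟨V, hV, hVU, -, s, hs⟩ := hE.exists_isFrame_affine hU
  obtain ⟨W, hW, hWV, e, rfl⟩ := exists_val hV v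
  have ha' := ha.restrict (hWV.trans hVU)
  let f : Fibre A x →ₗ[kappa x] Fibre E x := (fibreAct ι x).flip (val E hW e)
  have hf : Function.Injective f := by
    refine (injective_iff_map_eq_zero f).2 fun c hc => fibreAct_injective hA hC ?_
    rw [map_zero]
    exact hv _ ⟨c, rfl⟩ hc
  have hli : LinearIndependent (kappa x) fun i =>
      val E hW (evalAt ι e le_rfl (res A (hWV.trans hVU) (a i))) := by
    have h2 : (fun i => val E hW (evalAt ι e le_rfl (res A (hWV.trans hVU) (a i)))) =
        f ∘ ha'.fibreBasis hW := by
      funext i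
      rw [Function.comp_apply, ha'.fibreBasis_apply, LinearMap.flip_apply,
        fibreAct_val_val hW le_rfl, evalAt_apply, res_self]
    rw [h2]
    exact (ha'.fibreBasis hW).linearIndependent.map' f (LinearMap.ker_eq_bot.2 hf)
  obtain ⟨T, hTW, hT, hfr⟩ := (hs.restrict hWV).exists_isFrame_of_linearIndependent hW _ hli
  refine ⟨T, hT, res E hTW e, isGenerator_of_isFrame (ha'.restrict hTW) ?_⟩
  convert hfr using 2 with i
  rw [evalAt_restrict, evalAt_res e le_rfl hTW]

/-- The sections of `A` form a sheaf of commutative algebras of endomorphisms of `E`, and `E` is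
locally free of rank one over it. -/
structure IsAlgebraBundle (ι : A ⟶ endSheaf E) : Prop where
  injective : ∀ U : X.Opens, Function.Injective (act ι (U := U))
  exists_one : ∀ U : X.Opens, ∃ a : Γ(A, U), act ι a = 1
  exists_mul : ∀ (U : X.Opens) (a b : Γ(A, U)), ∃ c : Γ(A, U), act ι c = act ι a * act ι b
  mul_comm : ∀ (U : X.Opens) (a b : Γ(A, U)), act ι a * act ι b = act ι b * act ι a
  exists_generator : ∀ x : X, ∃ (U : X.Opens) (_ : x ∈ U) (e : Γ(E, U)), IsGenerator ι e

theorem act_injective_of_isGenerator {e : Γ(E, U)} (he : IsGenerator ι e) (h : V ≤ U) :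
    Function.Injective (act ι (U := V)) := fun a b hab => (he V h).1 (by
  rw [evalAt_apply, evalAt_apply, hab])

theorem act_injective_of_cover
    (h : ∀ x : X, ∃ (U : X.Opens) (_ : x ∈ U) (e : Γ(E, U)), IsGenerator ι e) (V : X.Opens) :
    Function.Injective (act ι (U := V)) := fun a b hab => by
  choose U hxU e he using h
  refine res_ext A (W := fun x : V => V ⊓ U x) (fun x => inf_le_left)
    (fun x hx => Opens.mem_iSup.2 ⟨⟨x, hx⟩, hx, hxU x⟩) fun x => ?_
  refine act_injective_of_isGenerator (he x) inf_le_right ?_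
  rw [act_res, act_res, hab]

/-- Injectivity of the action makes local preimages of `φ` unique, hence compatible on overlaps. -/
theorem exists_act_eq_of_cover
    (hinj : ∀ U : X.Opens, Function.Injective (act ι (U := U))) (φ : EndSection E U)
    (h : ∀ x ∈ U, ∃ (V : X.Opens) (hV : V ≤ U) (_ : x ∈ V) (a : Γ(A, V)),
      act ι a = EndSection.restrictHom hV φ) : ∃ a : Γ(A, U), act ι a = φ := by
  choose V hVU hxV a ha using fun x : U => h x x.2
  have hcov : U ≤ iSup V := fun x hx => Opens.mem_iSup.2 ⟨⟨x, hx⟩, hxV ⟨x, hx⟩⟩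
  obtain ⟨b, hb⟩ := res_glue A hVU hcov a fun i j => hinj _ (by
    rw [act_res, act_res, ha, ha]
    rfl)
  refine ⟨b, EndSection.eq_of_cover fun x hx => ⟨V ⟨x, hx⟩, hVU _, hxV ⟨x, hx⟩, ?_⟩⟩
  rw [← act_res, hb, ha]

variable [JacobsonSpace X] [IsReduced X]

/-- The only candidate is the section `a` with `a e = φ e`. At a closed point `φ` acts as some
element `c` of the fibre of `A`. Then `c` and the value of `a` agree on the value of `e`, and
evaluation there is injective on the fibre of `A`, so they coincide. -/
theorem exists_act_eq_of_fibre (hA : IsVectorBundle A d) (hE : IsVectorBundle E d)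
    {e : Γ(E, U)} (he : IsGenerator ι e) (hVU : V ≤ U) (φ : EndSection E V)
    (h : ∀ (x : X) (hx : x ∈ V), IsClosed ({x} : Set X) →
      φ.fibre hx ∈ LinearMap.range (fibreAct ι x)) : ∃ a : Γ(A, V), act ι a = φ := by
  obtain ⟨a, ha⟩ := (he V hVU).2 (φ.app V le_rfl (res E hVU e))
  refine ⟨a, EndSection.eq_of_fibre hE fun x hx hxc => ?_⟩
  obtain ⟨c, hc⟩ := h x hx hxc
  rw [← fibreAct_val, ← hc]
  congr 1
  refine ((he.restrict hVU).fibre_bijective hA hx).1 ?_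
  dsimp only
  rw [hc, fibreAct_val_val hx le_rfl, EndSection.fibre_val hx le_rfl, ← ha, evalAt_apply]

/-- Generators exist near closed points, and open sets containing all closed points cover `X`. The
unit, products and commutativity are then verified in closed fibres, where `A` is an algebra of
diagonal matrices. -/
theorem isAlgebraBundle_of_isCartan (hA : IsVectorBundle A d) (hE : IsVectorBundle E d)
    (hC : ∀ x : X, IsClosed ({x} : Set X) →
      IsCartanSubalgebra d (LinearMap.range (fibreAct ι x))) : IsAlgebraBundle ι := by
  have hgen : ∀ x : X, ∃ (U : X.Opens) (_ : x ∈ U) (e : Γ(E, U)), IsGenerator ι e := by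
    choose! U hxU e he using fun x (hx : IsClosed ({x} : Set X)) =>
      exists_isGenerator_of_isCartan hA hE (hC x hx)
    intro x
    obtain ⟨i, hi⟩ := isOpenCover_of_closedPoints
      (fun y : {y : X // IsClosed ({y} : Set X)} => U y)
      (fun y hy => ⟨⟨y, hy⟩, hxU y hy⟩) x
    exact ⟨U i, hi, e i, he i i.2⟩
  have hinj := act_injective_of_cover hgen
  have key : ∀ (U : X.Opens) (φ : EndSection E U), (∀ (x : X) (hx : x ∈ U),
      IsClosed ({x} : Set X) → φ.fibre hx ∈ LinearMap.range (fibreAct ι x)) →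
      ∃ a : Γ(A, U), act ι a = φ := fun U φ hφ => by
    refine exists_act_eq_of_cover hinj φ fun x hx => ?_
    obtain ⟨V, hxV, e, he⟩ := hgen x
    obtain ⟨a, ha⟩ := exists_act_eq_of_fibre hA hE he (inf_le_right : U ⊓ V ≤ V)
      (EndSection.restrictHom inf_le_left φ) fun y hy hyc => by
        rw [EndSection.fibre_restrictHom]
        exact hφ y hy.1 hyc
    exact ⟨U ⊓ V, inf_le_left, ⟨hx, hxV⟩, a, ha⟩
  refine ⟨hinj, fun U => key U 1 fun x hx hxc => ?_, fun U a b => key U _ fun x hx hxc => ?_,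
    fun U a b => EndSection.eq_of_fibre hE fun x hx hxc => ?_, hgen⟩
  · rw [EndSection.fibre_one]
    exact (hC x hxc).one_mem
  · rw [EndSection.fibre_mul, ← fibreAct_val, ← fibreAct_val]
    exact (hC x hxc).mul_mem ⟨_, rfl⟩ ⟨_, rfl⟩
  · rw [EndSection.fibre_mul, EndSection.fibre_mul, ← fibreAct_val, ← fibreAct_val]
    exact (hC x hxc).mul_comm ⟨_, rfl⟩ ⟨_, rfl⟩

end CartanBundle

/-! ### Unramifiedness from the closed fibres -/

section Unramified

/-- If the Kähler differentials were nonzero, their annihilator would lie in a maximal ideal `m`.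
Modulo `m` the algebra is spanned by the idempotents `ε i`, and derivations vanish on idempotents,
so `Ω = m Ω`, which contradicts Nakayama's lemma. -/
theorem formallyUnramified_of_forall_isMaximal {R B : Type u} [CommRing R] [CommRing B]
    [Algebra R B] [Module.Finite R B] {d : ℕ}
    (h : ∀ m : Ideal R, m.IsMaximal → ∃ ε : Fin d → B,
      (∀ i, ε i * ε i - ε i ∈ m • (⊤ : Submodule R B)) ∧
      ∀ b : B, ∃ c : Fin d → R, b - ∑ i, c i • ε i ∈ m • (⊤ : Submodule R B)) :
    Algebra.FormallyUnramified R B := by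
  rw [Algebra.formallyUnramified_iff]
  have : Module.Finite R Ω[B⁄R] := Module.Finite.trans B _
  by_contra hne
  have hann : Module.annihilator R Ω[B⁄R] ≠ ⊤ := by
    rwa [Ne, Module.annihilator_eq_top_iff]
  obtain ⟨m, hm, hle⟩ := Ideal.exists_le_maximal _ hann
  obtain ⟨ε, hε, hc⟩ := h m hm
  let D := KaehlerDifferential.D R B
  have hD : ∀ b ∈ m • (⊤ : Submodule R B), D b ∈ m • (⊤ : Submodule R Ω[B⁄R]) := fun b hb => by
    have h1 : D b ∈ (m • (⊤ : Submodule R B)).map (D : B →ₗ[R] Ω[B⁄R]) := ⟨b, hb, rfl⟩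
    rw [Submodule.map_smul''] at h1
    exact Submodule.smul_mono le_rfl le_top h1
  have hmul : ∀ (b : B) (w : Ω[B⁄R]), w ∈ m • (⊤ : Submodule R Ω[B⁄R]) →
      b • w ∈ m • (⊤ : Submodule R Ω[B⁄R]) := fun b w hw => by
    refine Submodule.smul_induction_on hw (fun r hr n _ => ?_) fun x y hx hy => ?_
    · rw [smul_comm]
      exact Submodule.smul_mem_smul hr trivial
    · rw [smul_add]
      exact add_mem hx hy
  have hmul' : ∀ (b : B) (w : Ω[B⁄R]), b ∈ m • (⊤ : Submodule R B) →
      b • w ∈ m • (⊤ : Submodule R Ω[B⁄R]) := fun b w hb => by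
    refine Submodule.smul_induction_on hb (fun r hr n _ => ?_) fun x y hx hy => ?_
    · rw [smul_assoc]
      exact Submodule.smul_mem_smul hr trivial
    · rw [add_smul]
      exact add_mem hx hy
  have hεD : ∀ i, D (ε i) ∈ m • (⊤ : Submodule R Ω[B⁄R]) := fun i => by
    have h1 : (ε i + ε i) • D (ε i) - D (ε i) ∈ m • (⊤ : Submodule R Ω[B⁄R]) := by
      have := hD _ (hε i)
      rwa [map_sub, Derivation.leibniz, ← add_smul] at this
    have h2 := hmul (ε i + ε i - 1) _ h1
    have h3 := hmul' _ (D (ε i)) ((m • (⊤ : Submodule R B)).smul_mem (4 : R) (hε i))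
    -- This is the identity `(2ε - 1)² = 1 + 4 (ε² - ε)`, so that `2ε - 1` is its own inverse modulo
    -- `m`; `h1` says that `(2ε - 1) dε` vanishes modulo `m`.
    have h4 : D (ε i) = (ε i + ε i - 1) • ((ε i + ε i) • D (ε i) - D (ε i)) -
        ((4 : R) • (ε i * ε i - ε i)) • D (ε i) := by
      rw [Algebra.smul_def, map_ofNat]
      module
    rw [h4]
    exact sub_mem h2 h3
  have hall : ∀ b, D b ∈ m • (⊤ : Submodule R Ω[B⁄R]) := fun b => by
    obtain ⟨c, hc⟩ := hc b
    have h1 : D b = D (b - ∑ i, c i • ε i) + ∑ i, c i • D (ε i) := by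
      simp only [map_sub, map_sum, Derivation.map_smul, sub_add_cancel]
    rw [h1]
    exact add_mem (hD _ hc) (sum_mem fun i _ => Submodule.smul_mem _ _ (hεD i))
  have htop : (⊤ : Submodule R Ω[B⁄R]) ≤ m • (⊤ : Submodule R Ω[B⁄R]) := fun w _ => by
    have hw : w ∈ Submodule.span B (Set.range D) := by
      rw [KaehlerDifferential.span_range_derivation]
      trivial
    induction hw using Submodule.span_induction with
    | mem x hx => obtain ⟨b, rfl⟩ := hx; exact hall b
    | zero => exact zero_mem _
    | add x y _ _ hx hy => exact add_mem (hx trivial) (hy trivial)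
    | smul b x _ hx => exact hmul b x (hx trivial)
  -- Nakayama's lemma gives `r ≡ 1` modulo `m` annihilating the differentials; but the annihilator
  -- lies in `m`, so `1 ∈ m`.
  obtain ⟨r, hr1, hr⟩ := Submodule.exists_sub_one_mem_and_smul_eq_zero_of_fg_of_le_smul m
    (⊤ : Submodule R Ω[B⁄R]) Module.Finite.fg_top htop
  have hrm : r ∈ m := hle (Module.mem_annihilator.2 fun w => hr w trivial)
  exact hm.ne_top ((Ideal.eq_top_iff_one _).2 (by simpa using sub_mem hrm hr1))

end Unramified

/-! ### The relative spectrum of a bundle of algebras of endomorphisms -/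

section RelativeSpec

variable {X : Scheme.{u}} {E A : X.Modules} {U V : X.Opens} {ι : A ⟶ endSheaf E} {d : ℕ}

namespace IsAlgebraBundle

variable (hR : IsAlgebraBundle ι)

/-- The algebra of endomorphisms of `E|_U` which come from sections of `A`. -/
def algebra (U : X.Opens) : Subalgebra Γ(X, U) (EndSection E U) where
  carrier := Set.range (act ι)
  mul_mem' := by
    rintro _ _ ⟨a, rfl⟩ ⟨b, rfl⟩
    exact hR.exists_mul U a b
  add_mem' := by
    rintro _ _ ⟨a, rfl⟩ ⟨b, rfl⟩
    exact ⟨a + b, act_add a b⟩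
  algebraMap_mem' r := by
    obtain ⟨a, ha⟩ := hR.exists_one U
    exact ⟨r • a, by rw [act_smul, ha, Algebra.algebraMap_eq_smul_one]⟩

instance (U : X.Opens) : CommRing (hR.algebra U) where
  __ := (inferInstance : Ring (hR.algebra U))
  mul_comm := by
    rintro ⟨_, a, rfl⟩ ⟨_, b, rfl⟩
    exact Subtype.ext (hR.mul_comm U a b)

/-- The sections of `A` are the elements of the algebra. -/
def equiv (U : X.Opens) : Γ(A, U) ≃ₗ[Γ(X, U)] hR.algebra U :=
  LinearEquiv.ofBijective
    { toFun := fun a => ⟨act ι a, a, rfl⟩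
      map_add' := fun a b => Subtype.ext (act_add a b)
      map_smul' := fun r a => Subtype.ext (act_smul r a) }
    ⟨fun a b h => hR.injective U (congrArg Subtype.val h), by
      rintro ⟨_, a, rfl⟩
      exact ⟨a, rfl⟩⟩

/-- Restriction in the presheaf of algebras. -/
def resAlg (h : V ≤ U) : hR.algebra U →+* hR.algebra V :=
  ((EndSection.restrictHom h).comp (hR.algebra U).toSubring.subtype).codRestrict
    (hR.algebra V).toSubring (by
      rintro ⟨_, a, rfl⟩
      exact ⟨res A h a, act_res h a⟩)

theorem resAlg_equiv (h : V ≤ U) (a : Γ(A, U)) :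
    hR.resAlg h (hR.equiv U a) = hR.equiv V (res A h a) :=
  Subtype.ext (act_res h a).symm

theorem resAlg_algebraMap (h : V ≤ U) (r : Γ(X, U)) :
    hR.resAlg h (algebraMap _ _ r) = algebraMap _ _ (resO h r) :=
  Subtype.ext (by
    change EndSection.restrictHom h (algebraMap _ _ r) = algebraMap _ _ (resO h r)
    rw [Algebra.algebraMap_eq_smul_one, Algebra.algebraMap_eq_smul_one,
      EndSection.restrictHom_smul, map_one])

/-- The presheaf of algebras. -/
def presheaf : X.Opensᵒᵖ ⥤ CommRingCat.{u} where
  obj U := .of (hR.algebra U.unop)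
  map i := CommRingCat.ofHom (hR.resAlg (leOfHom i.unop))

/-- The structure map of the presheaf of algebras. -/
def structureMap : X.presheaf ⟶ hR.presheaf where
  app U := CommRingCat.ofHom (algebraMap Γ(X, U.unop) (hR.algebra U.unop))
  naturality U V i := by
    ext r
    exact (hR.resAlg_algebraMap (leOfHom i.unop) r).symm

/-- Besides the invertibility of `f` on its basic open, this is quasi-coherence of `A`: sections
over the basic open extend after multiplication by a power of `f`, and sections vanishing there are
killed by such a power. -/
theorem isLocalizationAway (hA : IsVectorBundle A d) (hU : IsAffineOpen U) (f : Γ(X, U)) :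
    letI := (hR.resAlg (X.basicOpen_le f)).toAlgebra
    IsLocalization.Away (algebraMap Γ(X, U) (hR.algebra U) f) (hR.algebra (X.basicOpen f)) := by
  let := (hR.resAlg (X.basicOpen_le f)).toAlgebra
  have hmap : ∀ a, algebraMap (hR.algebra U) (hR.algebra (X.basicOpen f)) a =
    hR.resAlg (X.basicOpen_le f) a := fun _ => rfl
  refine ⟨?_, ?_, ?_⟩
  · rintro ⟨_, n, rfl⟩
    rw [hmap, map_pow, resAlg_algebraMap]
    exact ((X.toRingedSpace.isUnit_res_basicOpen f).map
      (algebraMap Γ(X, X.basicOpen f) (hR.algebra (X.basicOpen f)))).pow n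
  · intro z
    obtain ⟨t, rfl⟩ := (hR.equiv _).surjective z
    obtain ⟨n, m, hm⟩ := hA.exists_res_eq_pow_smul hU f t
    refine ⟨(hR.equiv U m, ⟨_, n, rfl⟩), ?_⟩
    dsimp only
    rw [hmap, hmap, map_pow, resAlg_algebraMap, resAlg_equiv, hm, map_smul, _root_.mul_comm,
      Algebra.smul_def, map_pow]
  · intro a b hab
    obtain ⟨a, rfl⟩ := (hR.equiv _).surjective a
    obtain ⟨b, rfl⟩ := (hR.equiv _).surjective b
    rw [hmap, hmap, resAlg_equiv, resAlg_equiv] at hab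
    have hab := (hR.equiv _).injective hab
    obtain ⟨n, hn⟩ := hA.exists_pow_smul_eq_zero hU f (a - b) (by rw [map_sub, hab, sub_self])
    refine ⟨⟨_, n, rfl⟩, ?_⟩
    dsimp only
    rw [smul_sub, sub_eq_zero] at hn
    rw [← map_pow, ← Algebra.smul_def, ← Algebra.smul_def, ← map_smul, ← map_smul, hn]

-- The localization property at basic opens is the condition under which the spectra of the algebras
-- over affine opens glue to a scheme over `X`.
open Scheme.AffineZariskiSite in
theorem coequifibered (hA : IsVectorBundle A d) :
    ((toOpensFunctor X).op.whiskerLeft hR.structureMap).Coequifibered :=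
  coequifibered_iff_forall_isLocalizationAway.mpr fun U f => hR.isLocalizationAway hA U.2 f

/-- The gluing data of the relative spectrum. -/
def gluingData (hA : IsVectorBundle A d) :=
  Scheme.AffineZariskiSite.relativeGluingData (hR.coequifibered hA)

instance (hA : IsVectorBundle A d) :
    ((hR.gluingData hA).functor ⋙ Scheme.forget).IsLocallyDirected :=
  Scheme.Cover.RelativeGluingData.instIsLocallyDirectedI₀CompFunctorForgetOfIsThin ..

/-- The relative spectrum of the sheaf of algebras. -/
def spec (hA : IsVectorBundle A d) : Scheme.{u} := (hR.gluingData hA).glued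

/-- The projection of the relative spectrum. -/
def specMap (hA : IsVectorBundle A d) : hR.spec hA ⟶ X := (hR.gluingData hA).toBase

/-- The cover of the relative spectrum by the spectra of the sections over affine opens. -/
def openCover (hA : IsVectorBundle A d) : (hR.spec hA).OpenCover := (hR.gluingData hA).cover

/-- The open immersion of the spectrum of the sections over an affine open. -/
def chart (hA : IsVectorBundle A d) (U : X.affineOpens) :
    Spec (.of (hR.algebra U.1)) ⟶ hR.spec hA :=
  (hR.openCover hA).f U

instance (hA : IsVectorBundle A d) (U : X.affineOpens) : IsOpenImmersion (hR.chart hA U) :=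
  (hR.openCover hA).map_prop U

theorem chart_specMap (hA : IsVectorBundle A d) (U : X.affineOpens) :
    hR.chart hA U ≫ hR.specMap hA =
      Spec.map (CommRingCat.ofHom (algebraMap Γ(X, U.1) (hR.algebra U.1))) ≫ U.2.fromSpec :=
  Limits.colimit.ι_desc _ _

theorem specMap_preimage (hA : IsVectorBundle A d) (U : X.affineOpens) :
    hR.specMap hA ⁻¹ᵁ U.1 = (hR.chart hA U).opensRange := by
  have := (hR.gluingData hA).toBase_preimage_eq_opensRange_ι U
  have h : ((Scheme.AffineZariskiSite.directedCover X).f U).opensRange = U.1 :=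
    Scheme.Opens.opensRange_ι U.1
  exact (congrArg (hR.specMap hA ⁻¹ᵁ ·) h).symm.trans this

theorem specMap_chart (hA : IsVectorBundle A d) (U : X.affineOpens) (f : Γ(X, U.1)) :
    Spec.map (CommRingCat.ofHom (hR.resAlg (X.basicOpen_le f))) ≫ hR.chart hA U =
      hR.chart hA ⟨X.basicOpen f, U.2.basicOpen f⟩ := by
  let U' : X.AffineZariskiSite := U
  have := Limits.colimit.w (hR.gluingData hA).functor (homOfLE (U'.basicOpen_le f))
  exact this

end IsAlgebraBundle

end RelativeSpec

/-! ### Values of functions at closed points of affine opens -/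

section AffinePoints

variable {X : Scheme.{u}} {M : X.Modules} {U V : X.Opens} {d : ℕ}

/-- A closed point of the affine open `U` is locally closed in `X`, and in a Jacobson space a
locally closed point is closed. -/
theorem exists_point_of_isMaximal [JacobsonSpace X] (hU : IsAffineOpen U) (m : Ideal Γ(X, U))
    (hm : m.IsMaximal) :
    ∃ (x : X) (hx : x ∈ U), IsClosed ({x} : Set X) ∧ RingHom.ker (valO hx) = m := by
  let y : Spec Γ(X, U) := ⟨m, hm.isPrime⟩
  have hx : hU.fromSpec y ∈ U := by
    have : hU.fromSpec y ∈ Set.range hU.fromSpec := ⟨y, rfl⟩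
    rwa [hU.range_fromSpec] at this
  refine ⟨hU.fromSpec y, hx, ?_, ?_⟩
  · refine isClosed_singleton_of_isLocallyClosed_singleton ?_
    have h1 : IsClosed ({y} : Set (Spec Γ(X, U))) :=
      (PrimeSpectrum.isClosed_singleton_iff_isMaximal y).2 hm
    have h2 := h1.isLocallyClosed.image hU.fromSpec.isOpenEmbedding.isInducing
      hU.fromSpec.isOpenEmbedding.isOpen_range.isLocallyClosed
    rwa [Set.image_singleton] at h2
  · ext r
    rw [RingHom.mem_ker, ← not_iff_not, ← Ne, valO_ne_zero_iff]
    have h1 : hU.fromSpec y ∈ X.basicOpen r ↔ y ∈ hU.fromSpec ⁻¹ᵁ X.basicOpen r := Iff.rfl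
    rw [h1, hU.fromSpec_preimage_basicOpen]
    rfl

/-- A class in the residue field comes from a function on some basic open of `f`; its product with
`f ^ n` extends to `y` on `U`. As the kernel is maximal, `f` has an inverse `t` modulo it, and `y *
t ^ n` has the required value. -/
theorem valO_surjective (hU : IsAffineOpen U) {x : X} (hx : x ∈ U)
    (hm : (RingHom.ker (valO hx)).IsMaximal) : Function.Surjective (valO hx) := by
  intro c
  obtain ⟨V, hV, hVU, r, rfl⟩ := exists_valO hx c
  obtain ⟨f, hfV, hxf⟩ := hU.exists_basicOpen_le ⟨x, hV⟩ hx
  obtain ⟨n, y, hy⟩ := exists_resO_eq_pow_mul hU f (resO hfV r)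
  have hf : f ∉ RingHom.ker (valO hx) := (valO_ne_zero_iff hx f).2 hxf
  obtain ⟨t, i, hi, ht⟩ := hm.exists_inv hf
  have h1 : valO hx t * valO hx f = 1 := by
    have := congrArg (valO hx) ht
    rwa [map_add, map_mul, map_one, (RingHom.mem_ker).1 hi, add_zero] at this
  refine ⟨y * t ^ n, ?_⟩
  have h2 := congrArg (valO hxf) hy
  rw [map_mul, map_pow, valO_resO, valO_resO, valO_resO] at h2
  rw [map_mul, map_pow, h2, mul_assoc, mul_comm (valO _ r), ← mul_assoc, ← mul_pow, mul_comm _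
    (valO hx t), h1, one_pow, one_mul]

theorem IsFrame.val_surjective {s : Fin d → Γ(M, U)} (hs : IsFrame M s) {x : X} (hx : x ∈ U)
    (h : Function.Surjective (valO hx)) : Function.Surjective (val M hx) := by
  intro c
  choose r hr using fun i => h ((hs.fibreBasis hx).repr c i)
  refine ⟨∑ i, r i • s i, ?_⟩
  rw [map_sum]
  conv_rhs => rw [← (hs.fibreBasis hx).sum_repr c]
  exact Finset.sum_congr rfl fun i _ => by rw [val_smul, hr, hs.fibreBasis_apply]

theorem IsFrame.mem_smul_top_of_val_eq_zero {s : Fin d → Γ(M, U)} (hs : IsFrame M s) {x : X}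
    (hx : x ∈ U) (m : Γ(M, U)) (h : val M hx m = 0) :
    m ∈ RingHom.ker (valO hx) • (⊤ : Submodule Γ(X, U) Γ(M, U)) := by
  rw [← (hs.basis le_rfl).sum_repr m]
  refine sum_mem fun i _ => Submodule.smul_mem_smul ?_ trivial
  rw [RingHom.mem_ker, ← hs.fibreBasis_repr_val hx le_rfl, h]
  simp

end AffinePoints

/-! ### Extending morphisms from affine opens -/

section ExtendHom

variable {X : Scheme.{u}} {M N : X.Modules}

/-- Compatibility is demanded only for a basic open inside an affine open, which is what the charts
of the relative spectrum provide. It suffices because the intersection of two affine opens is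
covered by opens that are basic in both. -/
theorem exists_hom_of_affineOpens
    (g : ∀ U : X.affineOpens, Γ(M, U.1) →ₗ[Γ(X, U.1)] Γ(N, U.1))
    (hg : ∀ (U W : X.affineOpens) (h : W.1 ≤ U.1) (_ : ∃ f : Γ(X, U.1), W.1 = X.basicOpen f)
      (m : Γ(M, U.1)), g W (res M h m) = res N h (g U m)) :
    ∃ φ : M ⟶ N, ∀ (U : X.affineOpens) (m : Γ(M, U.1)), φ.app U.1 m = g U m := by
  have key : ∀ (U V V' : X.affineOpens) (T W : X.Opens) (hV : V.1 ≤ T) (hV' : V'.1 ≤ T)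
      (hW : W ≤ V.1) (hW' : W ≤ V'.1) (m : Γ(M, T)),
      res N hW (g V (res M hV m)) = res N hW' (g V' (res M hV' m)) := by
    intro U V V' T W hV hV' hW hW' m
    choose f f' hff' hxf using fun x : W =>
      exists_basicOpen_le_affine_inter V.2 V'.2 x ⟨hW x.2, hW' x.2⟩
    refine res_ext N (W := fun x : W => W ⊓ X.basicOpen (f x)) (fun x => inf_le_left)
      (fun x hx => Opens.mem_iSup.2 ⟨⟨x, hx⟩, hx, hxf ⟨x, hx⟩⟩) fun x => ?_
    have h1 := hg V ⟨X.basicOpen (f x), V.2.basicOpen _⟩ (X.basicOpen_le _) ⟨_, rfl⟩ (res M hV m)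
    have h2 := hg V' ⟨X.basicOpen (f x), V.2.basicOpen _⟩
      ((hff' x).trans_le (X.basicOpen_le _)) ⟨_, hff' x⟩ (res M hV' m)
    rw [res_res] at h1 h2
    rw [res_res, res_res, ← res_res N (X.basicOpen_le (f x)) inf_le_right, ← h1,
      ← res_res N ((hff' x).trans_le (X.basicOpen_le (f' x)) : X.basicOpen (f x) ≤ V'.1)
        inf_le_right, ← h2]
  have hcov : ∀ U : X.Opens, U ≤ ⨆ V : {V : X.affineOpens // V.1 ≤ U}, V.1.1 := fun U x hx => by
    obtain ⟨_, ⟨W, hW, rfl⟩, hxW, h⟩ :=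
      X.isBasis_affineOpens.exists_subset_of_mem_open (show x ∈ (U : Set X) from hx) U.isOpen
    exact Opens.mem_iSup.2 ⟨⟨⟨W, hW⟩, h⟩, hxW⟩
  choose F hF using fun (U : X.Opens) (m : Γ(M, U)) =>
    res_glue N (W := fun V : {V : X.affineOpens // V.1 ≤ U} => V.1.1) (fun V => V.2) (hcov U)
      (fun V => g V.1 (res M V.2 m))
      (fun V V' => key V.1 V.1 V'.1 U _ V.2 V'.2 inf_le_left inf_le_right m)
  have hF' : ∀ (U : X.Opens) (m : Γ(M, U)) (V : X.affineOpens) (h : V.1 ≤ U),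
      res N h (F U m) = g V (res M h m) := fun U m V h => hF U m ⟨V, h⟩
  refine ⟨homOfLinear (fun U => { toFun := F U, map_add' := ?_, map_smul' := ?_ }) ?_, ?_⟩
  · refine fun m m' => res_ext N (fun V => V.2) (hcov U) fun V => ?_
    rw [map_add, hF' _ _ V.1 V.2, hF' _ _ V.1 V.2, hF' _ _ V.1 V.2, map_add, map_add]
  · refine fun r m => res_ext N (fun V => V.2) (hcov U) fun V => ?_
    rw [RingHom.id_apply, res_smul, hF' _ _ V.1 V.2, hF' _ _ V.1 V.2, res_smul, map_smul]
  · refine fun U V h m => res_ext N (fun W => W.2) (hcov V) fun W => ?_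
    change res N W.2 (F V _) = res N W.2 (res N h (F U m))
    rw [hF' _ _ W.1 W.2, res_res M, res_res N, hF' _ _ W.1 (W.2.trans h)]
  · intro U m
    have := hF' U.1 m U le_rfl
    rw [res_self, res_self] at this
    exact this

end ExtendHom

/-! ### Geometry of the relative spectrum -/

section RelativeSpec

variable {X : Scheme.{u}} {E A : X.Modules} {U V : X.Opens} {ι : A ⟶ endSheaf E} {d : ℕ}

namespace IsAlgebraBundle

variable (hR : IsAlgebraBundle ι) (hA : IsVectorBundle A d)

theorem isPullback_chart (hU : IsAffineOpen U) :
    IsPullback (Spec.map (CommRingCat.ofHom (algebraMap Γ(X, U) (hR.algebra U))))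
      (hR.chart hA ⟨U, hU⟩) hU.fromSpec (hR.specMap hA) :=
  IsOpenImmersion.isPullback _ _ _ _ (hR.chart_specMap hA ⟨U, hU⟩)
    (by rw [hU.opensRange_fromSpec]; exact hR.specMap_preimage hA ⟨U, hU⟩)

theorem finite_algebra (U : X.Opens) (s : Fin d → Γ(A, U)) (hs : IsFrame A s) :
    Module.Finite Γ(X, U) (hR.algebra U) :=
  .of_basis ((hs.basis le_rfl).map (hR.equiv U))

theorem free_algebra (U : X.Opens) (s : Fin d → Γ(A, U)) (hs : IsFrame A s) :
    Module.Free Γ(X, U) (hR.algebra U) :=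
  .of_basis ((hs.basis le_rfl).map (hR.equiv U))

/-- A maximal ideal of `Γ(X, U)` is the kernel of evaluation at a closed point `x`. Modulo it the
algebra becomes the fibre of `A` at `x`, an algebra of diagonal matrices spanned by its coordinate
idempotents. -/
theorem formallyUnramified_algebra [JacobsonSpace X] (hA : IsVectorBundle A d) (hU : IsAffineOpen U)
    (s : Fin d → Γ(A, U)) (hs : IsFrame A s)
    (hC : ∀ x : X, IsClosed ({x} : Set X) →
      IsCartanSubalgebra d (LinearMap.range (fibreAct ι x))) :
    Algebra.FormallyUnramified Γ(X, U) (hR.algebra U) := by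
  have := hR.finite_algebra U s hs
  refine formallyUnramified_of_forall_isMaximal (d := d) fun m hm => ?_
  obtain ⟨x, hx, hxc, rfl⟩ := exists_point_of_isMaximal hU m hm
  have hsurj := hs.val_surjective hx (valO_surjective hU hx hm)
  have hinj := fibreAct_injective hA (hC x hxc)
  obtain ⟨b, hb⟩ := (hC x hxc).exists_eq_range
  have hlift : ∀ c, ∃ a : Γ(A, U), (act ι a).fibre hx = diagEnd b c := fun c => by
    have : diagEnd b c ∈ LinearMap.range (fibreAct ι x) := hb ▸ ⟨c, rfl⟩
    obtain ⟨v, hv⟩ := this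
    obtain ⟨a, rfl⟩ := hsurj v
    exact ⟨a, by rw [← hv, fibreAct_val]⟩
  have hker : ∀ a : Γ(A, U), (act ι a).fibre hx = 0 → hR.equiv U a ∈
      RingHom.ker (valO hx) • (⊤ : Submodule Γ(X, U) (hR.algebra U)) := fun a ha => by
    have h1 := hs.mem_smul_top_of_val_eq_zero hx a (hinj (by rw [fibreAct_val, ha, map_zero]))
    have h2 := Submodule.mem_map_of_mem (f := (hR.equiv U).toLinearMap) h1
    rw [Submodule.map_smul''] at h2
    exact Submodule.smul_mono le_rfl le_top h2
  -- Lifts of the coordinate idempotents; they are idempotent only modulo the maximal ideal.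
  choose ε hε using fun i => hlift (Pi.single i 1)
  refine ⟨fun i => hR.equiv U (ε i), fun i => ?_, fun z => ?_⟩
  · obtain ⟨c, hc⟩ := hR.exists_mul U (ε i) (ε i)
    have h1 : hR.equiv U (ε i) * hR.equiv U (ε i) - hR.equiv U (ε i) = hR.equiv U (c - ε i) := by
      rw [map_sub]
      congr 1
      exact Subtype.ext hc.symm
    rw [h1]
    refine hker _ ?_
    rw [← fibreAct_val, map_sub, map_sub, fibreAct_val, fibreAct_val, hc, EndSection.fibre_mul, hε,
      diagEnd_mul, ← Pi.single_mul, one_mul, sub_self]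
  · obtain ⟨a, rfl⟩ := (hR.equiv U).surjective z
    have : (act ι a).fibre hx ∈ LinearMap.range (diagEnd b) := by
      rw [← hb, ← fibreAct_val]
      exact ⟨_, rfl⟩
    obtain ⟨c, hc⟩ := this
    choose r hr using fun i => valO_surjective hU hx hm (c i)
    refine ⟨r, ?_⟩
    simp_rw [← map_smul]
    rw [← map_sum, ← map_sub]
    refine hker _ ?_
    rw [← fibreAct_val, map_sub, map_sub, fibreAct_val, ← hc, map_sum, map_sum]
    simp_rw [val_smul, map_smul, fibreAct_val, hε, hr, ← map_smul]
    rw [← map_sum, ← map_sub]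
    have : c = ∑ i, c i • Pi.single i (1 : kappa x) := by
      rw [← pi_eq_sum_univ' c]
    rw [← this, sub_self, map_zero]

/-- A property local on the target need only be checked for the ring maps over affine opens on which
`A` has a frame, where the algebra is finite and free. -/
theorem of_affineOpens_specMap (P : MorphismProperty Scheme.{u})
    (hP : IsZariskiLocalAtTarget P)
    (h : ∀ (U : X.Opens) (_ : IsAffineOpen U) (s : Fin d → Γ(A, U)), IsFrame A s →
      P (Spec.map (CommRingCat.ofHom (algebraMap Γ(X, U) (hR.algebra U))))) :
    P (hR.specMap hA) := by
  choose U hxU _ hU s hs using fun x : X => hA.exists_isFrame_affine (U := ⊤) (x := x) trivial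
  refine IsZariskiLocalAtTarget.of_iSup_eq_top U
    (top_le_iff.1 fun x _ => Opens.mem_iSup.2 ⟨x, hxU x⟩) fun x => ?_
  have h1 := hR.isPullback_chart hA (hU x)
  have h3 : IsPullback (hR.specMap hA ∣_ U x ≫ (hU x).isoSpec.hom) (hR.specMap hA ⁻¹ᵁ U x).ι
      (hU x).fromSpec (hR.specMap hA) := by
    refine (isPullback_morphismRestrict (hR.specMap hA) (U x)).of_iso (Iso.refl _)
      (hU x).isoSpec (Iso.refl _) (Iso.refl _) ?_ ?_ ?_ ?_
    · simp
    · simp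
    · rw [IsAffineOpen.isoSpec_hom, Iso.refl_hom, Category.comp_id, (hU x).toSpecΓ_fromSpec]
    · simp
  have h4 := IsPullback.isoIsPullback_hom_fst _ _ h3 h1
  have h5 := h _ (hU x) (s x) (hs x)
  have hP' : P.RespectsIso := inferInstance
  have h6 := (P.cancel_left_of_respectsIso (IsPullback.isoIsPullback _ _ h3 h1).hom _).2 h5
  exact (P.cancel_right_of_respectsIso _ (hU x).isoSpec.hom).1 (h4 ▸ h6)

theorem isFinite_specMap : IsFinite (hR.specMap hA) :=
  hR.of_affineOpens_specMap hA @IsFinite (@HasAffineProperty.instIsZariskiLocalAtTarget _ _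
    IsFinite.instHasAffinePropertyAndIsAffineFiniteCarrierObjOppositeOpensCarrierCarrierCommRingCatPresheafOpOpensTopHomAppTop)
    fun U hU s hs => by
      rw [IsFinite.SpecMap_iff]
      have := hR.finite_algebra U s hs
      exact RingHom.finite_algebraMap.2 this

/-- Over a noetherian ring a finite algebra is finitely presented; being also free and formally
unramified, it is étale. -/
theorem etale_specMap [JacobsonSpace X] (hC : ∀ x : X, IsClosed ({x} : Set X) →
      IsCartanSubalgebra d (LinearMap.range (fibreAct ι x)))
    (hN : ∀ U : X.affineOpens, IsNoetherianRing Γ(X, U.1)) : Etale (hR.specMap hA) :=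
  hR.of_affineOpens_specMap hA @Etale (@HasRingHomProperty.instIsZariskiLocalAtTarget _ _
    Etale.instHasRingHomPropertyEtale) fun U hU s hs => by
    refine (@HasRingHomProperty.Spec_iff @Etale _ Etale.instHasRingHomPropertyEtale _ _ _).2 ?_
    have := hR.finite_algebra U s hs
    have := hR.free_algebra U s hs
    have := hR.formallyUnramified_algebra hA hU s hs hC
    have := hN ⟨U, hU⟩
    have : Algebra.FinitePresentation Γ(X, U) (hR.algebra U) :=
      Algebra.FinitePresentation.of_finiteType.1 inferInstance
    have := Algebra.Etale.of_formallyUnramified_of_flat (R := Γ(X, U)) (S := hR.algebra U)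
    exact (RingHom.etale_algebraMap).2 this

theorem flat_specMap : Flat (hR.specMap hA) :=
  hR.of_affineOpens_specMap hA @Flat (@HasRingHomProperty.instIsZariskiLocalAtTarget _ _
    Flat.instHasRingHomPropertyFlat) fun U hU s hs => by
    have := hR.free_algebra U s hs
    rw [Flat.SpecMap_iff]
    exact RingHom.flat_algebraMap_iff.2 inferInstance

theorem finrank_specMap (x : X) : (hR.specMap hA).finrank x = d := by
  obtain ⟨U, hxU, -, hU, s, hs⟩ := hA.exists_isFrame_affine (U := ⊤) (x := x) trivial
  have := hR.finite_algebra U s hs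
  have := hR.free_algebra U s hs
  have := hR.isFinite_specMap hA
  have := hR.flat_specMap hA
  obtain ⟨y, rfl⟩ : x ∈ Set.range hU.fromSpec := by rwa [hU.range_fromSpec]
  -- Over the zero ring the rank of a free module is not determined; the point `y` excludes this
  -- case.
  have : Nontrivial Γ(X, U) := y.nontrivial
  rw [← Scheme.Hom.finrank_of_isPullback _ _ _ _ (hR.isPullback_chart hA hU).flip]
  refine (Scheme.Hom.finrank_SpecMap_algebraMap Γ(X, U) (hR.algebra U) y).trans ?_
  rw [Module.rankAtStalk_eq_finrank_of_free,
    Module.finrank_eq_card_basis ((hs.basis le_rfl).map (hR.equiv U)), Fintype.card_fin]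
  rfl

end IsAlgebraBundle

end RelativeSpec

/-! ### Pulling functions back to affine schemes -/

section PullSection

variable {X Y : Scheme.{u}} {R S : CommRingCat.{u}}

/-- The pullback of functions along a morphism from an affine scheme. -/
def pullSection (g : Spec R ⟶ Y) {V : Y.Opens} (h : ⊤ ≤ g ⁻¹ᵁ V) : Γ(Y, V) →+* R :=
  (g.appLE V ⊤ h ≫ (Scheme.ΓSpecIso R).hom).hom

theorem pullSection_resO (g : Spec R ⟶ Y) {V W : Y.Opens} (h : ⊤ ≤ g ⁻¹ᵁ W) (hWV : W ≤ V)
    (a : Γ(Y, V)) :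
    pullSection g h (resO hWV a) = pullSection g (h.trans (g.preimage_mono hWV)) a := by
  have := g.map_appLE h (homOfLE hWV).op
  exact congrArg (Scheme.ΓSpecIso R).hom (ConcreteCategory.congr_hom this a)

theorem pullSection_comp (g : Spec R ⟶ Y) (f : Y ⟶ X) {V : X.Opens} (h : ⊤ ≤ (g ≫ f) ⁻¹ᵁ V)
    (a : Γ(X, V)) :
    pullSection (g ≫ f) h a = pullSection g (V := f ⁻¹ᵁ V) h (f.app V a) := by
  have := g.comp_appLE f V ⊤ h
  exact congrArg (Scheme.ΓSpecIso R).hom (ConcreteCategory.congr_hom this a)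

theorem pullSection_SpecMap (φ : R ⟶ S) (g : Spec R ⟶ Y) {V : Y.Opens} (h : ⊤ ≤ g ⁻¹ᵁ V)
    (h' : ⊤ ≤ (Spec.map φ ≫ g) ⁻¹ᵁ V) (a : Γ(Y, V)) :
    pullSection (Spec.map φ ≫ g) h' a = φ (pullSection g h a) := by
  have h1 := (Spec.map φ).appLE_comp_appLE g V ⊤ ⊤ h le_rfl
  have h2 : (Spec.map φ).appLE ⊤ ⊤ le_rfl = (Spec.map φ).appTop :=
    (Spec.map φ).appLE_eq_app
  have h3 : (Spec.map φ ≫ g).appLE V ⊤ h' ≫ (Scheme.ΓSpecIso S).hom =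
      (g.appLE V ⊤ h ≫ (Scheme.ΓSpecIso R).hom) ≫ φ := by
    rw [← h1, h2, Category.assoc, Category.assoc, Scheme.ΓSpecIso_naturality]
  exact ConcreteCategory.congr_hom h3 a

theorem pullSection_fromSpec {U : X.Opens} (hU : IsAffineOpen U) (h : ⊤ ≤ hU.fromSpec ⁻¹ᵁ U)
    (a : Γ(X, U)) : pullSection hU.fromSpec h a = a := by
  have h1 : hU.fromSpec.appLE U ⊤ h ≫ (Scheme.ΓSpecIso Γ(X, U)).hom = 𝟙 _ := by
    rw [Scheme.Hom.appLE, hU.fromSpec_app_self, Category.assoc, Category.assoc,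
      ← Functor.map_comp_assoc]
    rw [show ∀ i : op (⊤ : (Spec Γ(X, U)).Opens) ⟶ op ⊤,
      (Spec Γ(X, U)).presheaf.map i = 𝟙 _ from fun i =>
        (congrArg _ (Subsingleton.elim i (𝟙 _))).trans (CategoryTheory.Functor.map_id _ _),
      Category.id_comp, Iso.inv_hom_id]
  exact ConcreteCategory.congr_hom h1 a

theorem pullSection_bijective (g : Spec R ⟶ Y) [IsOpenImmersion g] {V : Y.Opens}
    (hV : V = g.opensRange) (h : ⊤ ≤ g ⁻¹ᵁ V) : Function.Bijective (pullSection g h) := by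
  have : IsIso (g.app V) := g.isIso_app V hV.le
  have h1 : g ⁻¹ᵁ V = ⊤ := top_le_iff.1 h
  have : IsIso (g.appLE V ⊤ h ≫ (Scheme.ΓSpecIso R).hom) := by
    have : IsIso (g.appLE V ⊤ h) := by
      rw [Scheme.Hom.appLE, show (homOfLE h) = eqToHom h1.symm from rfl]
      infer_instance
    infer_instance
  exact ConcreteCategory.bijective_of_isIso (g.appLE V ⊤ h ≫ (Scheme.ΓSpecIso R).hom)

end PullSection

/-! ### Actions of the functions of a morphism -/

section DirectImageAction

variable {X Y : Scheme.{u}}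

theorem hom_inv_app {M N : X.Modules} (θ : M ≅ N) {U : X.Opens} (n : Γ(N, U)) :
    θ.hom.app U (θ.inv.app U n) = n := by
  rw [← AddCommGrpCat.comp_apply, ← Scheme.Modules.Hom.comp_app, θ.inv_hom_id]
  rfl

theorem inv_hom_app {M N : X.Modules} (θ : M ≅ N) {U : X.Opens} (m : Γ(M, U)) :
    θ.inv.app U (θ.hom.app U m) = m :=
  hom_inv_app θ.symm m

/-- A section over a preimage, as a section of the direct image. -/
def toDirectImage (f : Y ⟶ X) {M : Y.Modules} {U : X.Opens} (m : Γ(M, f ⁻¹ᵁ U)) :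
    Γ(directImage f M, U) := m

theorem res_toDirectImage (f : Y ⟶ X) {M : Y.Modules} {U V : X.Opens} (h : V ≤ U)
    (m : Γ(M, f ⁻¹ᵁ U)) :
    res (directImage f M) h (toDirectImage f m) = toDirectImage f (res M (f.preimage_mono h) m) :=
  rfl

theorem resO_app (f : Y ⟶ X) {U V : X.Opens} (h : V ≤ U) (r : Γ(X, U)) :
    resO (f.preimage_mono h) (f.app U r) = f.app V (resO h r) :=
  (ConcreteCategory.congr_hom (f.naturality (homOfLE h).op) r).symm

/-- An action of the algebra `f_* 𝒪_Y` on `E`. -/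
structure DirectImageAction (f : Y ⟶ X) (E : X.Modules) where
  /-- The action of a function. -/
  toEnd (U : X.Opens) : Γ(Y, f ⁻¹ᵁ U) →+* EndSection E U
  toEnd_resO {U V : X.Opens} (h : V ≤ U) (a : Γ(Y, f ⁻¹ᵁ U)) :
    toEnd V (resO (f.preimage_mono h) a) = EndSection.restrictHom h (toEnd U a)
  toEnd_app (U : X.Opens) (r : Γ(X, U)) : toEnd U (f.app U r) = algebraMap _ _ r

end DirectImageAction

/-! ### Functions on the relative spectrum -/

section RelativeSpec

variable {X : Scheme.{u}} {E A : X.Modules} {U V : X.Opens} {ι : A ⟶ endSheaf E} {d : ℕ}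

namespace IsAlgebraBundle

variable (hR : IsAlgebraBundle ι) (hA : IsVectorBundle A d)

theorem top_le_preimage_chart (hU : IsAffineOpen U) :
    ⊤ ≤ hR.chart hA ⟨U, hU⟩ ⁻¹ᵁ hR.specMap hA ⁻¹ᵁ U := by
  have := hR.specMap_preimage hA ⟨U, hU⟩
  dsimp only at this
  rw [this, Scheme.Hom.preimage_opensRange]

/-- Functions on the relative spectrum over an affine open are elements of the algebra. -/
def sectionsEquiv (hU : IsAffineOpen U) :
    Γ(hR.spec hA, hR.specMap hA ⁻¹ᵁ U) ≃+* hR.algebra U :=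
  RingEquiv.ofBijective (pullSection (hR.chart hA ⟨U, hU⟩) (hR.top_le_preimage_chart hA hU))
    (pullSection_bijective _ (hR.specMap_preimage hA ⟨U, hU⟩) _)

theorem sectionsEquiv_app (hU : IsAffineOpen U) (r : Γ(X, U)) :
    hR.sectionsEquiv hA hU ((hR.specMap hA).app U r) = algebraMap _ _ r := by
  have h1 := pullSection_comp (hR.chart hA ⟨U, hU⟩) (hR.specMap hA)
    (hR.top_le_preimage_chart hA hU) r
  refine h1.symm.trans ?_
  have h2 : ⊤ ≤ hU.fromSpec ⁻¹ᵁ U := by rw [hU.fromSpec_preimage_self]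
  have h2' : ⊤ ≤ (Spec.map (CommRingCat.ofHom (algebraMap Γ(X, U) (hR.algebra U))) ≫
      hU.fromSpec) ⁻¹ᵁ U := by
    rw [Scheme.Hom.comp_preimage, hU.fromSpec_preimage_self]
    rfl
  have h3 := pullSection_SpecMap (CommRingCat.ofHom (algebraMap Γ(X, U) (hR.algebra U)))
    hU.fromSpec h2 h2' r
  rw [pullSection_fromSpec] at h3
  have h4 := hR.chart_specMap hA ⟨U, hU⟩
  -- The inclusion of opens in `pullSection` depends on the morphism, so equal morphisms are
  -- substituted in a general statement instead of rewriting.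
  have h5 : ∀ (g g' : Spec (.of (hR.algebra U)) ⟶ X) (_ : g = g') (h : ⊤ ≤ g ⁻¹ᵁ U)
      (h' : ⊤ ≤ g' ⁻¹ᵁ U), pullSection g h r = pullSection g' h' r := by
    rintro g _ rfl _ _
    rfl
  exact (h5 _ _ h4 _ h2').trans h3

theorem sectionsEquiv_resO (hU : IsAffineOpen U) (f : Γ(X, U))
    (a : Γ(hR.spec hA, hR.specMap hA ⁻¹ᵁ U)) :
    hR.sectionsEquiv hA (hU.basicOpen f)
      (resO ((hR.specMap hA).preimage_mono (X.basicOpen_le f)) a) =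
    hR.resAlg (X.basicOpen_le f) (hR.sectionsEquiv hA hU a) := by
  refine (pullSection_resO _ _ _ _).trans ?_
  have h1 := hR.specMap_chart hA ⟨U, hU⟩ f
  have h2 : ⊤ ≤ (Spec.map (CommRingCat.ofHom (hR.resAlg (X.basicOpen_le f))) ≫
      hR.chart hA ⟨U, hU⟩) ⁻¹ᵁ hR.specMap hA ⁻¹ᵁ U := by
    rw [Scheme.Hom.comp_preimage, top_le_iff.1 (hR.top_le_preimage_chart hA hU)]
    rfl
  have h3 := pullSection_SpecMap (CommRingCat.ofHom (hR.resAlg (X.basicOpen_le f)))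
    (hR.chart hA ⟨U, hU⟩) (hR.top_le_preimage_chart hA hU) h2 a
  have h5 : ∀ (g g' : Spec (.of (hR.algebra (X.basicOpen f))) ⟶ hR.spec hA) (_ : g = g')
      (h : ⊤ ≤ g ⁻¹ᵁ hR.specMap hA ⁻¹ᵁ U) (h' : ⊤ ≤ g' ⁻¹ᵁ hR.specMap hA ⁻¹ᵁ U),
      pullSection g h a = pullSection g' h' a := by
    rintro g _ rfl _ _
    rfl
  exact (h5 _ _ h1.symm _ h2).trans h3

/-- The identification of functions with algebra elements exists over affine opens and commutes with
passage to basic opens. This is enough to define a morphism of sheaves, which is bijective on the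
basis of affine opens. -/
theorem exists_iso_directImage :
    ∃ θ : A ≅ directImage (hR.specMap hA) (structureSheaf (hR.spec hA)),
      ∀ (U : X.Opens) (hU : IsAffineOpen U) (m : Γ(A, U)),
        hR.sectionsEquiv hA hU (θ.hom.app U m) = hR.equiv U m := by
  obtain ⟨φ, hφ⟩ := exists_hom_of_affineOpens (M := A)
    (N := directImage (hR.specMap hA) (structureSheaf (hR.spec hA)))
    (fun U =>
      { toFun := fun m => toSection ((hR.sectionsEquiv hA U.2).symm (hR.equiv U.1 m))
        map_add' := fun m m' => by rw [map_add, map_add]; rfl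
        map_smul' := fun r m => by
          rw [map_smul, Algebra.smul_def, map_mul, ← hR.sectionsEquiv_app hA U.2,
            RingEquiv.symm_apply_apply]
          rfl })
    (fun ⟨U, hU⟩ ⟨W, hW⟩ h ⟨f, hf⟩ m => by
      subst hf
      apply (hR.sectionsEquiv hA hW).injective
      refine (RingEquiv.apply_symm_apply _ _).trans ?_
      have h1 := hR.sectionsEquiv_resO hA hU f ((hR.sectionsEquiv hA hU).symm (hR.equiv U m))
      rw [RingEquiv.apply_symm_apply, resAlg_equiv] at h1
      exact h1.symm)
  have : IsIso φ := by
    refine isIso_of_basis φ (fun U => IsAffineOpen U) ?_ ?_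
    · intro V x hx
      obtain ⟨_, ⟨W, hW, rfl⟩, hxW, h⟩ :=
        X.isBasis_affineOpens.exists_subset_of_mem_open (show x ∈ (V : Set X) from hx) V.isOpen
      exact ⟨W, hW, h, hxW⟩
    · intro W hW
      have h1 : ⇑(φ.app W) = fun m => (hR.sectionsEquiv hA hW).symm (hR.equiv W m) :=
        funext fun m => hφ ⟨W, hW⟩ m
      rw [h1]
      exact (hR.sectionsEquiv hA hW).symm.bijective.comp (hR.equiv W).bijective
  refine ⟨asIso φ, fun U hU m => ?_⟩
  rw [asIso_hom, hφ ⟨U, hU⟩]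
  exact RingEquiv.apply_symm_apply _ _

/-- Over an affine open the action is a ring isomorphism onto the algebra followed by its inclusion
in `End(E)`. Over a general open, the unit, products and scalars are checked after restriction to
affine opens. -/
theorem exists_directImageAction :
    ∃ (ψ : directImage (hR.specMap hA) (structureSheaf (hR.spec hA)) ≅ A)
      (T : DirectImageAction (hR.specMap hA) E),
      ∀ (U : X.Opens) (a : Γ(hR.spec hA, hR.specMap hA ⁻¹ᵁ U)),
        act ι (ψ.hom.app U (toDirectImage _ (toSection a))) = T.toEnd U a := by
  obtain ⟨θ, hθ⟩ := hR.exists_iso_directImage hA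
  let τ (U : X.Opens) (a : Γ(hR.spec hA, hR.specMap hA ⁻¹ᵁ U)) : EndSection E U :=
    act ι (θ.inv.app U (toDirectImage _ (toSection a)))
  have hτ : ∀ (U : X.Opens) (hU : IsAffineOpen U) (a : Γ(hR.spec hA, hR.specMap hA ⁻¹ᵁ U)),
      τ U a = hR.sectionsEquiv hA hU a := fun U hU a => by
    rw [show τ U a = hR.equiv U (θ.inv.app U (toDirectImage _ (toSection a))) from rfl, ← hθ]
    exact congrArg (fun b => (hR.sectionsEquiv hA hU b : EndSection E U)) (hom_inv_app θ _)
  have hres : ∀ {U V : X.Opens} (h : V ≤ U) (a : Γ(hR.spec hA, hR.specMap hA ⁻¹ᵁ U)),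
      τ V (resO ((hR.specMap hA).preimage_mono h) a) = EndSection.restrictHom h (τ U a) :=
    fun {U V} h a => by
      rw [← act_res, ← app_res, res_toDirectImage]
      rfl
  have hloc : ∀ (U : X.Opens) (φ φ' : EndSection E U),
      (∀ (V : X.Opens) (h : V ≤ U), IsAffineOpen V →
        EndSection.restrictHom h φ = EndSection.restrictHom h φ') → φ = φ' := by
    intro U φ φ' h
    refine EndSection.eq_of_cover fun x hx => ?_
    obtain ⟨W, hW, hxW, hWU⟩ := exists_isAffineOpen_mem_and_subset hx
    exact ⟨W, hWU, hxW, h W hWU hW⟩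
  refine ⟨θ.symm, ⟨fun U => ⟨⟨⟨τ U, ?_⟩, ?_⟩, ?_, ?_⟩, fun h a => hres h a, fun U r => ?_⟩,
    fun U a => rfl⟩
  · refine hloc U _ _ fun V h hV => ?_
    rw [← hres h, hτ _ hV, map_one, map_one, map_one]
    rfl
  · refine fun a b => hloc U _ _ fun V h hV => ?_
    dsimp only
    rw [← hres h, hτ _ hV, map_mul, map_mul, map_mul, ← hres h, ← hres h, hτ _ hV, hτ _ hV]
    rfl
  · exact (congrArg (act ι) (map_zero (θ.inv.app U).hom)).trans act_zero
  · exact fun a b => (congrArg (act ι) (map_add (θ.inv.app U).hom _ _)).trans (act_add _ _)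
  · refine hloc U _ _ fun V h hV => ?_
    change EndSection.restrictHom h (τ U _) = _
    rw [← hres h, resO_app, hτ _ hV, sectionsEquiv_app, ← hR.resAlg_algebraMap h]
    · rfl
    · exact h

end IsAlgebraBundle

end RelativeSpec

/-! ### The line bundle of a cocycle -/

section Cocycle

variable {Y : Scheme.{u}} {I : Type u} {W : I → Y.Opens}

/-- A Čech cocycle of functions on an open cover. -/
structure Cocycle (W : I → Y.Opens) where
  fn (i j : I) : Γ(Y, W i ⊓ W j)
  fn_self (i : I) : fn i i = 1
  fn_mul {i j k : I} {T : Y.Opens} (hi : T ≤ W i) (hj : T ≤ W j) (hk : T ≤ W k) :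
    resO (le_inf hi hj) (fn i j) * resO (le_inf hj hk) (fn j k) = resO (le_inf hi hk) (fn i k)

/-- A section of the line bundle of a cocycle. -/
@[ext]
structure CocycleSection (g : Cocycle W) (V : Y.Opens) where
  val (i : I) : Γ(Y, V ⊓ W i)
  compat {i j : I} {T : Y.Opens} (hT : T ≤ V) (hi : T ≤ W i) (hj : T ≤ W j) :
    resO (le_inf hT hj) (val j) = resO (le_inf hT hi) (val i) * resO (le_inf hi hj) (g.fn i j)

namespace CocycleSection

variable {g : Cocycle W} {V : Y.Opens}

instance : Zero (CocycleSection g V) := ⟨⟨fun _ => 0, by simp⟩⟩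
instance : Add (CocycleSection g V) :=
  ⟨fun s t => ⟨fun i => s.val i + t.val i, fun hT hi hj => by
    rw [map_add, map_add, s.compat hT hi hj, t.compat hT hi hj, add_mul]⟩⟩
instance : Neg (CocycleSection g V) :=
  ⟨fun s => ⟨fun i => - s.val i, fun hT hi hj => by
    rw [map_neg, map_neg, s.compat hT hi hj, neg_mul]⟩⟩
instance : SMul Γ(Y, V) (CocycleSection g V) :=
  ⟨fun r s => ⟨fun i => resO inf_le_left r * s.val i, fun hT hi hj => by
    rw [map_mul, map_mul, s.compat hT hi hj, resO_resO, resO_resO, mul_assoc]⟩⟩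

@[simp] theorem val_zero (i : I) : (0 : CocycleSection g V).val i = 0 := rfl
@[simp] theorem val_add (s t : CocycleSection g V) (i : I) : (s + t).val i = s.val i + t.val i :=
  rfl
@[simp] theorem val_neg (s : CocycleSection g V) (i : I) : (-s).val i = - s.val i := rfl
@[simp] theorem val_smul (r : Γ(Y, V)) (s : CocycleSection g V) (i : I) :
    (r • s).val i = resO inf_le_left r * s.val i := rfl

theorem ext' {s t : CocycleSection g V} (h : ∀ i, s.val i = t.val i) : s = t := by
  ext1; exact funext h

instance : AddCommGroup (CocycleSection g V) where
  add_assoc a b c := ext' fun i => by simp [add_assoc]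
  zero_add a := ext' fun i => by simp
  add_zero a := ext' fun i => by simp
  neg_add_cancel a := ext' fun i => by simp
  add_comm a b := ext' fun i => by simp [add_comm]
  nsmul := nsmulRec
  zsmul := zsmulRec

instance : Module Γ(Y, V) (CocycleSection g V) where
  one_smul a := ext' fun i => by simp
  mul_smul r s a := ext' fun i => by simp [mul_assoc]
  smul_zero r := ext' fun i => by simp
  smul_add r a b := ext' fun i => by simp [mul_add]
  add_smul r s a := ext' fun i => by simp [add_mul]
  zero_smul a := ext' fun i => by simp

/-- Restriction to a smaller open. -/
def restrict {V' : Y.Opens} (h : V' ≤ V) : CocycleSection g V →+ CocycleSection g V' where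
  toFun s := ⟨fun i => resO (inf_le_inf_right _ h) (s.val i), fun hT hi hj => by
    rw [resO_resO, resO_resO, s.compat (hT.trans h) hi hj]⟩
  map_zero' := ext' fun i => map_zero _
  map_add' s t := ext' fun i => map_add _ _ _

end CocycleSection

variable (g : Cocycle W)

/-- The presheaf of abelian groups underlying the line bundle of a cocycle. -/
def cocycleAbPresheaf : Y.Opensᵒᵖ ⥤ Ab.{u} where
  obj V := AddCommGrpCat.of (CocycleSection g V.unop)
  map i := AddCommGrpCat.ofHom (CocycleSection.restrict (leOfHom i.unop))
  map_id V := by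
    ext (s : CocycleSection g V.unop) i
    exact resO_self _ (s.val i)
  map_comp {V _ V'} i j := by
    ext (s : CocycleSection g V.unop) k
    exact (resO_resO
      (inf_le_inf_right _ (leOfHom i.unop)) (inf_le_inf_right _ (leOfHom j.unop)) (s.val k)).symm

instance (V : Y.Opensᵒᵖ) : Module (Y.ringCatSheaf.obj.obj V) ((cocycleAbPresheaf g).obj V) :=
  inferInstanceAs (Module Γ(Y, V.unop) (CocycleSection g V.unop))

/-- The presheaf of modules underlying the line bundle of a cocycle. -/
def cocyclePresheaf : Y.PresheafOfModules :=
  PresheafOfModules.ofPresheaf (R := Y.ringCatSheaf.obj) (cocycleAbPresheaf g) (by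
    intro U V i r s
    refine CocycleSection.ext' (g := g) (V := V.unop) fun k => ?_
    refine (map_mul (resO (inf_le_inf_right (W k) (leOfHom i.unop)))
      (resO inf_le_left (show Γ(Y, U.unop) from r)) _).trans ?_
    refine congrArg (· * _) ?_
    exact (resO_resO _ _ _).trans (resO_resO (leOfHom i.unop) inf_le_left
      (show Γ(Y, U.unop) from r)).symm)

theorem resO_ext {ι : Type u} {V : Y.Opens} {T : ι → Y.Opens} (hT : ∀ i, T i ≤ V)
    (hV : V ≤ iSup T) {s t : Γ(Y, V)} (h : ∀ i, resO (hT i) s = resO (hT i) t) : s = t :=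
  res_ext (structureSheaf Y) hT hV h

theorem resO_glue {ι : Type u} {V : Y.Opens} {T : ι → Y.Opens} (hT : ∀ i, T i ≤ V)
    (hV : V ≤ iSup T) (s : ∀ i, Γ(Y, T i))
    (h : ∀ i j, resO (inf_le_left : T i ⊓ T j ≤ T i) (s i) =
      resO (inf_le_right : T i ⊓ T j ≤ T j) (s j)) :
    ∃ t : Γ(Y, V), ∀ i, resO (hT i) t = s i :=
  res_glue (structureSheaf Y) hT hV s h

/-- Each component is glued separately as a function; the relation with the transition functions is
then a local identity between functions. -/
theorem cocycleAbPresheaf_isSheaf :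
    TopCat.Presheaf.IsSheaf (X := Y.toTopCat) (cocycleAbPresheaf g) := by
  rw [TopCat.Presheaf.isSheaf_iff_isSheafUniqueGluing]
  intro ι U φ hφ
  change ∀ i, CocycleSection g (U i) at φ
  have hφ' : ∀ (i j : ι) (k : I) (T : Y.Opens) (hi : T ≤ U i ⊓ W k) (hj : T ≤ U j ⊓ W k),
      resO hi ((φ i).val k) = resO hj ((φ j).val k) := fun i j k T hi hj => by
    have h1 := congrArg (fun s : CocycleSection g (U i ⊓ U j) =>
      resO (le_inf (le_inf (hi.trans inf_le_left) (hj.trans inf_le_left))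
        (hi.trans inf_le_right)) (s.val k)) (hφ i j)
    exact (resO_resO _ _ _).symm.trans (h1.trans (resO_resO _ _ _))
  have hle : ∀ (k : I) (i : ι), U i ⊓ W k ≤ iSup U ⊓ W k := fun k i =>
    inf_le_inf_right _ (le_iSup U i)
  have hcov : ∀ k, iSup U ⊓ W k ≤ ⨆ i, U i ⊓ W k := fun k => by rw [iSup_inf_eq]
  choose t ht using fun k : I => resO_glue (hle k) (hcov k) (fun i => (φ i).val k)
    fun i j => hφ' i j k _ _ _
  refine ⟨⟨t, fun {i j T} hT hi hj => ?_⟩, fun i => CocycleSection.ext' (g := g) fun k => ht k i,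
    fun s hs => CocycleSection.ext' (g := g) fun k => resO_ext (hle k) (hcov k) fun i => ?_⟩
  · refine resO_ext (T := fun k => T ⊓ U k) (fun k => inf_le_left)
      (by rw [← inf_iSup_eq]; exact le_inf le_rfl hT) fun k => ?_
    have h1 : ∀ l (hl : T ⊓ U k ≤ W l), resO (le_inf (inf_le_left.trans hT) hl) (t l) =
        resO (le_inf inf_le_right hl) ((φ k).val l) := fun l hl => by
      rw [← ht l k, resO_resO]
    rw [map_mul, resO_resO, resO_resO, resO_resO, h1 j (inf_le_left.trans hj),
      h1 i (inf_le_left.trans hi), (φ k).compat inf_le_right (inf_le_left.trans hi)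
      (inf_le_left.trans hj)]
  · have := congrArg (fun s : CocycleSection g (U i) => s.val k) (hs i)
    exact this.trans (ht k i).symm

/-- The line bundle of a cocycle. -/
def cocycleBundle : Y.Modules := ⟨cocyclePresheaf g, cocycleAbPresheaf_isSheaf g⟩

/-- A section of the line bundle of a cocycle. -/
def CocycleSection.toSection {g : Cocycle W} {V : Y.Opens} (s : CocycleSection g V) :
    Γ(cocycleBundle g, V) := s

/-- The frame of the line bundle of a cocycle on a set of the cover. -/
def cocycleFrame (i : I) : CocycleSection g (W i) :=
  ⟨fun j => g.fn i j, fun hi hj hk => (g.fn_mul hi hj hk).symm⟩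

/-- Over `W i` the `i`-th component determines all others through the transition functions and may
be any function; the frame has `i`-th component `g.fn i i = 1`. -/
theorem isVectorBundle_cocycleBundle (hW : ∀ y : Y, ∃ i, y ∈ W i) :
    IsVectorBundle (cocycleBundle g) 1 := by
  intro y
  obtain ⟨i, hi⟩ := hW y
  refine ⟨W i, hi, fun _ => (cocycleFrame g i).toSection, fun V hV => ?_⟩
  have h1 : (fun c : Fin 1 → Γ(Y, V) => ∑ k, c k •
      res (cocycleBundle g) hV ((cocycleFrame g i).toSection)) =
      (fun r : Γ(Y, V) => (r • (cocycleFrame g i).restrict hV).toSection) ∘ fun c => c 0 := by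
    funext c
    rw [Fin.sum_univ_one]
    rfl
  rw [h1]
  refine Function.Bijective.comp ⟨fun r r' h => ?_, fun s => ?_⟩
    (Equiv.funUnique (Fin 1) Γ(Y, V)).bijective
  · have h2 := congrArg (fun s : CocycleSection g V => resO (le_inf le_rfl hV) (s.val i)) h
    have h3 : ∀ r : Γ(Y, V), resO (le_inf le_rfl hV)
        ((r • (cocycleFrame g i).restrict hV).val i) = r := fun r => by
      refine Eq.trans (b := resO (le_inf le_rfl hV) (resO inf_le_left r *
        resO (inf_le_inf_right _ hV) (g.fn i i))) rfl ?_
      rw [g.fn_self, map_one, mul_one, resO_resO, resO_self]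
    exact (h3 r).symm.trans (h2.trans (h3 r'))
  · change CocycleSection g V at s
    refine ⟨resO (le_inf le_rfl hV) (s.val i), CocycleSection.ext' (g := g) fun j => ?_⟩
    refine Eq.trans (b := resO inf_le_left (resO (le_inf le_rfl hV) (s.val i)) *
      resO (inf_le_inf_right _ hV) (g.fn i j)) rfl ?_
    have := s.compat (i := i) (j := j) (T := V ⊓ W j) inf_le_left (inf_le_left.trans hV)
      inf_le_right
    rw [resO_self] at this
    rw [this, resO_resO]

end Cocycle

/-! ### Modules over the direct image of the structure sheaf -/

namespace DirectImageAction

variable {X Y : Scheme.{u}} {f : Y ⟶ X} {E : X.Modules} (T : DirectImageAction f E)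
  {U V W : X.Opens}

/-- The action of a function on a section. -/
def smul (a : Γ(Y, f ⁻¹ᵁ V)) (s : Γ(E, V)) : Γ(E, V) := (T.toEnd V a).app V le_rfl s

theorem add_smul (a b : Γ(Y, f ⁻¹ᵁ V)) (s : Γ(E, V)) :
    T.smul (a + b) s = T.smul a s + T.smul b s := by
  rw [smul, map_add]
  rfl

theorem mul_smul (a b : Γ(Y, f ⁻¹ᵁ V)) (s : Γ(E, V)) :
    T.smul (a * b) s = T.smul a (T.smul b s) := by
  rw [smul, map_mul]
  rfl

theorem one_smul (s : Γ(E, V)) : T.smul 1 s = s := by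
  rw [smul, map_one]
  rfl

theorem app_smul (r : Γ(X, V)) (s : Γ(E, V)) : T.smul (f.app V r) s = r • s := by
  rw [smul, T.toEnd_app, Algebra.algebraMap_eq_smul_one, EndSection.smul_app, resO_self]
  rfl

theorem res_smul (h : W ≤ V) (a : Γ(Y, f ⁻¹ᵁ V)) (s : Γ(E, V)) :
    res E h (T.smul a s) = T.smul (resO (f.preimage_mono h) a) (res E h s) := by
  rw [smul, smul, T.toEnd_resO, EndSection.restrictHom_app, EndSection.map_app]
  exact h

/-- The section `e` generates `E` over `U` as a module over `f_* 𝒪_Y`. -/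
def IsGenerator (e : Γ(E, U)) : Prop :=
  ∀ (V : X.Opens) (h : V ≤ U),
    Function.Bijective fun a : Γ(Y, f ⁻¹ᵁ V) => T.smul a (res E h e)

variable {T} in
/-- The coordinate of a section with respect to a generator. -/
def IsGenerator.coord {e : Γ(E, U)} (he : T.IsGenerator e) (h : V ≤ U) (s : Γ(E, V)) :
    Γ(Y, f ⁻¹ᵁ V) := ((he V h).2 s).choose

variable {T} in
theorem IsGenerator.coord_smul {e : Γ(E, U)} (he : T.IsGenerator e) (h : V ≤ U) (s : Γ(E, V)) :
    T.smul (he.coord h s) (res E h e) = s := ((he V h).2 s).choose_spec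

variable {T} in
theorem IsGenerator.eq_coord {e : Γ(E, U)} (he : T.IsGenerator e) (h : V ≤ U) {s : Γ(E, V)}
    {a : Γ(Y, f ⁻¹ᵁ V)} (ha : T.smul a (res E h e) = s) : a = he.coord h s :=
  (he V h).1 (ha.trans (he.coord_smul h s).symm)

variable {T} in
theorem IsGenerator.resO_coord {e : Γ(E, U)} (he : T.IsGenerator e) (h : V ≤ U) (h' : W ≤ V)
    (s : Γ(E, V)) :
    resO (f.preimage_mono h') (he.coord h s) = he.coord (h'.trans h) (res E h' s) := by
  refine he.eq_coord _ ?_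
  rw [← res_res E h h', ← T.res_smul, he.coord_smul]

end DirectImageAction

/-! ### Line bundles from invertible modules over the direct image of the structure sheaf -/

namespace DirectImageAction

variable {X Y : Scheme.{u}} {f : Y ⟶ X} {E : X.Modules} {T : DirectImageAction f E}

section Generators

variable {I : Type u} {U : I → X.Opens} {e : ∀ i, Γ(E, U i)} (he : ∀ i, T.IsGenerator (e i))

include he in
theorem coord_self {V : X.Opens} {i : I} (hi : V ≤ U i) :
    (he i).coord hi (res E hi (e i)) = 1 :=
  ((he i).eq_coord hi (T.one_smul _)).symm

/-- Uniqueness of coordinates gives this change-of-generator formula. Applied to a generator it is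
the cocycle condition, and applied to a general section it is the compatibility of the coordinates.
-/
theorem coord_mul_coord {V : X.Opens} {i j : I} (hi : V ≤ U i) (hj : V ≤ U j) (s : Γ(E, V)) :
    (he i).coord hi s * (he j).coord hj (res E hi (e i)) = (he j).coord hj s :=
  (he j).eq_coord hj (by rw [T.mul_smul, (he j).coord_smul, (he i).coord_smul])

/-- The transition functions between generators. -/
def transition : Cocycle fun i => f ⁻¹ᵁ U i where
  fn i j := (he j).coord (V := U i ⊓ U j) inf_le_right (res E inf_le_left (e i))
  fn_self i := coord_self he _
  fn_mul {i j k S} hi hj hk := by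
    have key := coord_mul_coord he (i := j) (j := k) (V := U i ⊓ U j ⊓ U k)
      (inf_le_left.trans inf_le_right) inf_le_right
      (res E (inf_le_left.trans inf_le_left) (e i))
    have hS : S ≤ f ⁻¹ᵁ (U i ⊓ U j ⊓ U k) := le_inf (le_inf hi hj) hk
    have h1 := congrArg (resO hS) key
    rw [map_mul] at h1
    -- Coordinates taken over the triple intersection are restrictions of those over pairwise
    -- intersections, where the transition functions live.
    have h2 : ∀ {a b : I} (ha : U i ⊓ U j ⊓ U k ≤ U a) (hb : U i ⊓ U j ⊓ U k ≤ U b)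
        (hab : S ≤ f ⁻¹ᵁ (U a ⊓ U b)),
        resO hS ((he b).coord hb (res E ha (e a))) =
          resO hab ((he b).coord inf_le_right (res E inf_le_left (e a))) := by
      intro a b ha hb hab
      rw [← resO_resO (f.preimage_mono (le_inf ha hb)) hS, (he b).resO_coord, res_res]
      exact le_inf ha hb
    rw [h2, h2, h2] at h1
    exact h1

/-- The coordinates of a section, as a section of the line bundle of the transition functions. -/
def coords {V : X.Opens} (s : Γ(E, V)) : CocycleSection (transition he) (f ⁻¹ᵁ V) where
  val i := (he i).coord (V := V ⊓ U i) inf_le_right (res E inf_le_left s)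
  compat {i j S} hS hi hj := by
    have key := coord_mul_coord he (i := i) (j := j) (V := V ⊓ U i ⊓ U j)
      (inf_le_left.trans inf_le_right) inf_le_right (res E (inf_le_left.trans inf_le_left) s)
    have hS' : S ≤ f ⁻¹ᵁ (V ⊓ U i ⊓ U j) := le_inf (le_inf hS hi) hj
    have h1 := congrArg (resO hS') key
    rw [map_mul] at h1
    have h2 : ∀ {V' : X.Opens} {b : I} (t : Γ(E, V')) (ha : V ⊓ U i ⊓ U j ≤ V')
        (hb : V ⊓ U i ⊓ U j ≤ U b) (hab : S ≤ f ⁻¹ᵁ (V' ⊓ U b)),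
        resO hS' ((he b).coord hb (res E ha t)) =
          resO hab ((he b).coord inf_le_right (res E inf_le_left t)) := by
      intro V' b t ha hb hab
      rw [← resO_resO (f.preimage_mono (le_inf ha hb)) hS', (he b).resO_coord, res_res]
      exact le_inf ha hb
    rw [h2, h2, h2] at h1
    exact h1.symm

theorem coords_smul {V : X.Opens} (a : Γ(Y, f ⁻¹ᵁ V)) (s : Γ(E, V)) :
    coords he (T.smul a s) = a • coords he s :=
  CocycleSection.ext' fun i => ((he i).eq_coord _ (by
    rw [T.res_smul]
    exact (T.mul_smul (V := V ⊓ U i) (resO _ a) _ _).trans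
      (congrArg _ ((he i).coord_smul inf_le_right (res E inf_le_left s))))).symm

theorem coords_res {V V' : X.Opens} (h : V' ≤ V) (s : Γ(E, V)) :
    coords he (res E h s) = (coords he s).restrict (f.preimage_mono h) :=
  CocycleSection.ext' fun i => by
    refine Eq.trans ?_ ((he i).resO_coord inf_le_right (inf_le_inf_right _ h) _).symm
    change (he i).coord _ _ = _
    rw [res_res, res_res]

theorem coords_add {V : X.Opens} (s t : Γ(E, V)) :
    coords he (s + t) = coords he s + coords he t :=
  CocycleSection.ext' fun i => ((he i).eq_coord _ (by
    rw [map_add]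
    exact (T.add_smul _ _ _).trans (congrArg₂ _
      ((he i).coord_smul inf_le_right (res E inf_le_left s))
      ((he i).coord_smul inf_le_right (res E inf_le_left t))))).symm

/-- A section is recovered on `U i` as its `i`-th coordinate times the generator `e i`; the cocycle
relations say that these products agree on overlaps. -/
theorem coords_bijective (hU : ∀ x : X, ∃ i, x ∈ U i) (V : X.Opens) :
    Function.Bijective (coords he (V := V)) := by
  have hcov : V ≤ ⨆ i, V ⊓ U i := fun x hx => by
    obtain ⟨i, hi⟩ := hU x
    exact Opens.mem_iSup.2 ⟨i, hx, hi⟩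
  constructor
  · intro s t h
    refine res_ext E (fun i => inf_le_left) hcov fun i => ?_
    have h1 : (he i).coord (V := V ⊓ U i) inf_le_right (res E inf_le_left s) =
        (he i).coord inf_le_right (res E inf_le_left t) :=
      congrArg (fun c : CocycleSection (transition he) (f ⁻¹ᵁ V) => c.val i) h
    rw [← (he i).coord_smul inf_le_right (res E inf_le_left s), h1, (he i).coord_smul]
  · intro c
    -- The components live on `f ⁻¹ V ⊓ f ⁻¹ U i`, which is by definition `f ⁻¹ (V ⊓ U i)`; naming
    -- them again gives them the latter type.
    obtain ⟨c', hc'⟩ : ∃ c' : ∀ i, Γ(Y, f ⁻¹ᵁ (V ⊓ U i)), ∀ i, c' i = c.val i :=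
      ⟨c.val, fun _ => rfl⟩
    have hc : ∀ {i j} {S : X.Opens} (hi : S ≤ V ⊓ U i) (hj : S ≤ V ⊓ U j),
        resO (f.preimage_mono hj) (c' j) = resO (f.preimage_mono hi) (c' i) *
          (he j).coord (hj.trans inf_le_right) (res E (hi.trans inf_le_right) (e i)) := by
      intro i j S hi hj
      have hij : S ≤ U i ⊓ U j := le_inf (hi.trans inf_le_right) (hj.trans inf_le_right)
      have h1 := c.compat (i := i) (j := j) (T := f ⁻¹ᵁ S)
        (f.preimage_mono (hi.trans inf_le_left)) (f.preimage_mono (hi.trans inf_le_right))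
        (f.preimage_mono (hj.trans inf_le_right))
      have h2 : resO (f.preimage_mono hij) ((transition he).fn i j) =
          (he j).coord (hj.trans inf_le_right) (res E (hi.trans inf_le_right) (e i)) := by
        refine ((he j).resO_coord inf_le_right hij _).trans ?_
        rw [res_res]
      rw [hc', hc', ← h2]
      exact h1
    obtain ⟨s, hs⟩ := res_glue E (fun i => inf_le_left) hcov
      (fun i => T.smul (c' i) (res E inf_le_right (e i))) fun i j => by
        rw [T.res_smul, T.res_smul, res_res, res_res, hc inf_le_left inf_le_right, T.mul_smul,
          (he j).coord_smul]
    refine ⟨s, CocycleSection.ext' fun i => ?_⟩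
    rw [← hc']
    exact ((he i).eq_coord inf_le_right (hs i).symm).symm

end Generators

/-- A module over `f_* 𝒪_Y` which is locally generated by one element with zero annihilator is the
direct image of a line bundle. -/
theorem exists_lineBundle
    (hgen : ∀ x : X, ∃ (U : X.Opens) (_ : x ∈ U) (e : Γ(E, U)), T.IsGenerator e) :
    ∃ (L : Y.Modules) (η : directImage f L ≅ E), IsVectorBundle L 1 ∧
      ∀ (U : X.Opens) (a : Γ(Y, f ⁻¹ᵁ U)) (l : Γ(L, f ⁻¹ᵁ U)),
        (T.toEnd U a).app U le_rfl (η.hom.app U (toDirectImage f l)) =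
          η.hom.app U (toDirectImage f (a • l)) := by
  choose U hxU e he using hgen
  let φ : E ⟶ directImage f (cocycleBundle (transition he)) := homOfLinear
    (fun V =>
      { toFun := fun s => toDirectImage f (coords he s).toSection
        map_add' := fun s t => congrArg CocycleSection.toSection (coords_add he s t)
        map_smul' := fun r s => by
          rw [← T.app_smul, coords_smul]
          rfl })
    fun V V' h s => congrArg CocycleSection.toSection (coords_res he h s)
  have hφ : ∀ {V : X.Opens} (s : Γ(E, V)),
      φ.app V s = toDirectImage f (coords he s).toSection := fun s => rfl
  have : IsIso φ := isIso_of_bijective φ fun V => coords_bijective he (fun x => ⟨x, hxU x⟩) V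
  refine ⟨_, (asIso φ).symm, isVectorBundle_cocycleBundle _ fun y => ⟨f y, hxU (f y)⟩,
    fun V a l => ?_⟩
  apply (bijective_app_of_isIso φ V).1
  have h1 : ∀ t, φ.app V ((asIso φ).symm.hom.app V t) = t := fun t => hom_inv_app (asIso φ) t
  rw [h1, hφ]
  refine (congrArg (fun c => toDirectImage f (CocycleSection.toSection c))
    (coords_smul he a _)).trans ?_
  have h2 := h1 (toDirectImage f l)
  rw [hφ] at h2
  exact congrArg (fun l : Γ(cocycleBundle (transition he), f ⁻¹ᵁ V) => toDirectImage f (a • l)) h2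

end DirectImageAction

/-! ### From Cartan subbundles to étale coverings -/

section CartanToCovering

variable {X : Scheme.{u}} {E A : X.Modules} {ι : A ⟶ endSheaf E} {d : ℕ}

/-- The action of `f_* 𝒪_Y` is the action of `A` through the isomorphism `ψ`, so a generator for one
is a generator for the other. -/
theorem IsAlgebraBundle.exists_lineBundle (hR : IsAlgebraBundle ι) (hA : IsVectorBundle A d) :
    ∃ (L : (hR.spec hA).Modules) (η : directImage (hR.specMap hA) L ≅ E), IsVectorBundle L 1 ∧
      IsDirectImageOfStructureSheaf (hR.specMap hA) η ι := by
  obtain ⟨ψ, T, hT⟩ := hR.exists_directImageAction hA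
  obtain ⟨L, η, hL, hη⟩ := T.exists_lineBundle fun x => by
    obtain ⟨U, hx, e, he⟩ := hR.exists_generator x
    refine ⟨U, hx, e, fun V h => ?_⟩
    have h1 : (fun a : Γ(hR.spec hA, hR.specMap hA ⁻¹ᵁ V) => T.smul a (res E h e)) =
        evalAt ι e h ∘ fun a : Γ(hR.spec hA, hR.specMap hA ⁻¹ᵁ V) =>
          ψ.hom.app V (toDirectImage _ (toSection a)) := by
      funext a
      rw [Function.comp_apply, evalAt_apply, hT]
      rfl
    rw [h1]
    exact (he V h).comp (bijective_app_of_isIso ψ.hom V)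
  refine ⟨L, η, hL, ψ, fun U a l => ?_⟩
  have h1 := hη U a l
  rw [← hT] at h1
  exact h1

theorem IsCartanSubbundle.exists_etaleCovering [JacobsonSpace X] [IsReduced X]
    (hN : ∀ U : X.affineOpens, IsNoetherianRing Γ(X, U.1)) (hE : IsVectorBundle E d)
    (hι : IsCartanSubbundle ι d) :
    ∃ (Y : Scheme.{u}) (f : Y ⟶ X) (L : Y.Modules) (η : directImage f L ≅ E),
      IsEtaleCovering f d ∧ IsVectorBundle L 1 ∧ IsDirectImageOfStructureSheaf f η ι := by
  have hA := hι.isSubbundle.isVectorBundle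
  have hR : IsAlgebraBundle ι := isAlgebraBundle_of_isCartan hA hE hι.isCartan
  obtain ⟨L, η, hL, hη⟩ := hR.exists_lineBundle hA
  exact ⟨_, _, L, η, ⟨hR.isFinite_specMap hA, hR.etale_specMap hA hι.isCartan hN,
    hR.finrank_specMap hA⟩, hL, hη⟩

end CartanToCovering

/-! ### Morphisms to the projective spectrum of a graded ring -/

section AwayLift

open HomogeneousLocalization

variable {S : Type u} {σ : Type*} [CommRing S] [SetLike σ S] [AddSubgroupClass σ S] (𝒜 : ℕ → σ)
  [GradedRing 𝒜] {R R' : Type u} [CommRing R] [CommRing R']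

/-- The ring homomorphism out of the degree zero part of a localization. -/
def awayLift (φ : S →+* R) (f : S) (hu : IsUnit (φ f)) : Away 𝒜 f →+* R :=
  (IsLocalization.Away.lift (S := Localization.Away f) f hu).comp
    (algebraMap (Away 𝒜 f) (Localization.Away f))

variable {𝒜}

/-- With the denominator cleared, no inverse of `φ f` has to be named. The formula characterizes the
map (`eq_awayLift`), and compatibilities of `awayLift` are proved by verifying it. -/
theorem awayLift_mk (φ : S →+* R) {f : S} (hu : IsUnit (φ f)) {m : ℕ} (hf : f ∈ 𝒜 m) (n : ℕ)
    (a : S) (ha : a ∈ 𝒜 (n • m)) : awayLift 𝒜 φ f hu (Away.mk 𝒜 hf n a ha) * φ f ^ n = φ a := by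
  have h1 : ∀ b : S, IsLocalization.Away.lift (S := Localization.Away f) f hu
      (algebraMap S (Localization.Away f) b) = φ b := fun b => IsLocalization.Away.lift_eq f hu b
  rw [← h1 a, ← h1 f, ← map_pow, ← map_pow]
  change _ * _ = _
  rw [awayLift, RingHom.comp_apply, ← map_mul, HomogeneousLocalization.algebraMap_apply, Away.val_mk]
  congr 1
  rw [Localization.mk_eq_mk', map_pow, ← map_pow]
  exact IsLocalization.mk'_spec _ _ _

theorem eq_awayLift {φ : S →+* R} {f : S} (hu : IsUnit (φ f)) {m : ℕ} (hf : f ∈ 𝒜 m)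
    (ψ : Away 𝒜 f →+* R)
    (h : ∀ (n : ℕ) (a : S) (ha : a ∈ 𝒜 (n • m)), ψ (Away.mk 𝒜 hf n a ha) * φ f ^ n = φ a) :
    ψ = awayLift 𝒜 φ f hu := by
  ext z
  obtain ⟨n, a, ha, rfl⟩ := Away.mk_surjective 𝒜 hf z
  refine (hu.pow n).mul_left_injective ?_
  dsimp only
  rw [h, awayLift_mk]

theorem comp_awayLift (ρ : R →+* R') (φ : S →+* R) {f : S} (hu : IsUnit (φ f)) {m : ℕ}
    (hf : f ∈ 𝒜 m) :
    ρ.comp (awayLift 𝒜 φ f hu) = awayLift 𝒜 (ρ.comp φ) f (hu.map ρ) :=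
  eq_awayLift _ hf _ fun n a ha => by
    rw [RingHom.comp_apply, RingHom.comp_apply, RingHom.comp_apply, ← map_pow, ← map_mul,
      awayLift_mk]

theorem awayLift_comp_awayMap (φ : S →+* R) {f g x : S} {m n : ℕ} (hf : f ∈ 𝒜 m) (hg : g ∈ 𝒜 n)
    (hx : x = f * g) (hu : IsUnit (φ x)) (hu' : IsUnit (φ f)) :
    (awayLift 𝒜 φ x hu).comp (awayMap 𝒜 hg hx) = awayLift 𝒜 φ f hu' :=
  eq_awayLift _ hf _ fun k a ha => by
    have h1 := awayMap_mk 𝒜 hg hx k hf a ha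
    rw [RingHom.comp_apply, h1]
    have hg' : IsUnit (φ g) := by
      rw [hx, map_mul] at hu
      exact isUnit_of_mul_isUnit_right hu
    refine (hg'.pow k).mul_left_injective ?_
    dsimp only
    have h2 : φ f * φ g = φ x := by rw [hx, map_mul]
    rw [mul_assoc, ← mul_pow, h2, awayLift_mk, map_mul, map_pow]

/-- Homogeneous coordinates that differ by a common factor define the same point: in a fraction of
degree zero the powers of `c` cancel. -/
theorem awayLift_eq_of_scaling {φ φ' : S →+* R} {f : S} {m : ℕ} (hf : f ∈ 𝒜 m)
    (hu : IsUnit (φ f)) (hu' : IsUnit (φ' f)) (c : R)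
    (h : ∀ (n : ℕ) (a : S), a ∈ 𝒜 n → φ' a = c ^ n * φ a) :
    awayLift 𝒜 φ' f hu' = awayLift 𝒜 φ f hu :=
  (eq_awayLift _ hf _ fun n a ha => by
    rw [h _ a ha, h _ f hf, mul_pow, ← pow_mul, smul_eq_mul, mul_comm n m, mul_left_comm,
      awayLift_mk]).symm

/-- The morphism to `Proj` given by a ring homomorphism. -/
def projLift (φ : S →+* R) {f : S} {m : ℕ} (hf : f ∈ 𝒜 m) (hm : 0 < m) (hu : IsUnit (φ f)) :
    Spec (.of R) ⟶ Proj 𝒜 :=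
  Spec.map (CommRingCat.ofHom (awayLift 𝒜 φ f hu)) ≫ Proj.awayι 𝒜 f hf hm

/-- Both morphisms are compared with the one defined through the chart of the product `f * g`. -/
theorem projLift_eq (φ : S →+* R) {f g : S} {m n : ℕ} (hf : f ∈ 𝒜 m) (hm : 0 < m)
    (hu : IsUnit (φ f)) (hg : g ∈ 𝒜 n) (hn : 0 < n) (hu' : IsUnit (φ g)) :
    projLift φ hf hm hu = projLift φ hg hn hu' := by
  have key : ∀ {f g x : S} {m n l : ℕ} (hf : f ∈ 𝒜 m) (hm : 0 < m) (hu : IsUnit (φ f))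
      (hg : g ∈ 𝒜 n) (hx : x = f * g) (hx' : x ∈ 𝒜 l) (_ : l = m + n) (hl : 0 < l)
      (hu' : IsUnit (φ x)), projLift φ hf hm hu = projLift φ hx' hl hu' := by
    rintro f g x m n _ hf hm hu hg hx hx' rfl hmn hu'
    rw [projLift, projLift, ← Proj.SpecMap_awayMap_awayι 𝒜 hf hm hg hx, ← Spec.map_comp_assoc,
      ← CommRingCat.ofHom_comp, awayLift_comp_awayMap φ hf hg hx hu' hu]
  have hfg : IsUnit (φ (f * g)) := by
    rw [map_mul]
    exact hu.mul hu'
  rw [key hf hm hu hg rfl (SetLike.mul_mem_graded hf hg) rfl (by omega) hfg,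
    key hg hn hu' hf (mul_comm f g) (SetLike.mul_mem_graded hf hg) (add_comm _ _) (by omega) hfg]

theorem SpecMap_projLift (ρ : R →+* R') (φ : S →+* R) {f : S} {m : ℕ} (hf : f ∈ 𝒜 m) (hm : 0 < m)
    (hu : IsUnit (φ f)) :
    Spec.map (CommRingCat.ofHom ρ) ≫ projLift φ hf hm hu =
      projLift (ρ.comp φ) hf hm (hu.map ρ) := by
  rw [projLift, projLift, ← comp_awayLift ρ φ hu hf, CommRingCat.ofHom_comp, Spec.map_comp,
    Category.assoc]

theorem projLift_eq_of_scaling {φ φ' : S →+* R} {f g : S} {m n : ℕ} (hf : f ∈ 𝒜 m) (hm : 0 < m)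
    (hu : IsUnit (φ f)) (hg : g ∈ 𝒜 n) (hn : 0 < n) (hu' : IsUnit (φ' g)) (c : R)
    (h : ∀ (n : ℕ) (a : S), a ∈ 𝒜 n → φ' a = c ^ n * φ a) :
    projLift φ hf hm hu = projLift φ' hg hn hu' := by
  have h1 : IsUnit (φ g) := by
    rw [h _ g hg] at hu'
    exact isUnit_of_mul_isUnit_right hu'
  rw [projLift_eq φ hf hm hu hg hn h1, projLift, projLift, awayLift_eq_of_scaling hg h1 hu' c h]

/-- In the chart of `f` the open set of `g` is cut out by `g ^ m / f ^ n`, which the lift sends to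
`φ (g ^ m)` up to a unit. -/
theorem projLift_preimage (φ : S →+* R) {f : S} {m : ℕ} (hf : f ∈ 𝒜 m) (hm : 0 < m)
    (hu : IsUnit (φ f)) {g : S} {n : ℕ} (hg : g ∈ 𝒜 n) (hn : 0 < n) :
    projLift φ hf hm hu ⁻¹ᵁ Proj.basicOpen 𝒜 g = PrimeSpectrum.basicOpen (φ g) := by
  rw [projLift, Scheme.Hom.comp_preimage, Proj.awayι_preimage_basicOpen 𝒜 hf hm hg hn]
  ext x
  change awayLift 𝒜 φ f hu (Away.isLocalizationElem hf hg) ∉ x.asIdeal ↔ φ g ∉ x.asIdeal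
  have h1 := awayLift_mk φ hu hf n (g ^ m) (by
    convert! SetLike.pow_mem_graded m hg using 2; exact mul_comm _ _)
  have h2 : awayLift 𝒜 φ f hu (Away.isLocalizationElem hf hg) ∈ x.asIdeal ↔
      φ (g ^ m) ∈ x.asIdeal := by
    rw [← h1, x.asIdeal.mul_unit_mem_iff_mem (hu.pow n)]
  rw [h2, map_pow, x.isPrime.pow_mem_iff_mem _ hm]

/-- The morphism from an open subscheme to `Proj` given by a homomorphism to the functions. -/
def projMap {Y : Scheme.{u}} {U : Y.Opens} (φ : S →+* Γ(Y, U)) {f : S} {m : ℕ} (hf : f ∈ 𝒜 m)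
    (hm : 0 < m) (hu : IsUnit (φ f)) : (U : Scheme.{u}) ⟶ Proj 𝒜 :=
  U.toSpecΓ ≫ projLift φ hf hm hu

theorem homOfLE_projMap {Y : Scheme.{u}} {U V : Y.Opens} (h : V ≤ U) (φ : S →+* Γ(Y, U)) {f : S}
    {m : ℕ} (hf : f ∈ 𝒜 m) (hm : 0 < m) (hu : IsUnit (φ f)) :
    Y.homOfLE h ≫ projMap φ hf hm hu =
      projMap ((resO h).comp φ) hf hm (hu.map (resO h)) := by
  rw [projMap, projMap, ← Scheme.Opens.toSpecΓ_SpecMap_presheaf_map_assoc V U h,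
    ← SpecMap_projLift (resO h)]
  rfl

/-- On overlaps the homogeneous coordinates differ by a scaling, so the local morphisms agree and
glue. -/
theorem exists_projMap {Y : Scheme.{u}} {I : Type u} {U : I → Y.Opens} (hU : iSup U = ⊤)
    (φ : ∀ i, S →+* Γ(Y, U i)) {f : I → S} {m : I → ℕ} (hf : ∀ i, f i ∈ 𝒜 (m i))
    (hm : ∀ i, 0 < m i) (hu : ∀ i, IsUnit (φ i (f i)))
    (hc : ∀ i j, ∃ c : Γ(Y, U i ⊓ U j), ∀ (n : ℕ) (a : S), a ∈ 𝒜 n →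
      resO inf_le_right (φ j a) = c ^ n * resO inf_le_left (φ i a)) :
    ∃ h : Y ⟶ Proj 𝒜, ∀ i, (U i).ι ≫ h = projMap (φ i) (hf i) (hm i) (hu i) := by
  have key : ∀ i j, Y.homOfLE (inf_le_left : U i ⊓ U j ≤ U i) ≫
      projMap (φ i) (hf i) (hm i) (hu i) =
      Y.homOfLE (inf_le_right : U i ⊓ U j ≤ U j) ≫ projMap (φ j) (hf j) (hm j) (hu j) := by
    intro i j
    obtain ⟨c, hc⟩ := hc i j
    rw [homOfLE_projMap, homOfLE_projMap, projMap, projMap]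
    congr 1
    exact projLift_eq_of_scaling _ _ _ _ _ _ c hc
  refine ⟨(Y.openCoverOfIsOpenCover U (by exact hU)).glueMorphisms
    (fun i => projMap (φ i) (hf i) (hm i) (hu i)) fun i j => ?_, fun i => ?_⟩
  · have h1 := isPullback_opens_inf (U i) (U j)
    change Limits.pullback.fst (U i).ι (U j).ι ≫ _ = Limits.pullback.snd (U i).ι (U j).ι ≫ _
    rw [← cancel_epi h1.isoPullback.hom, ← Category.assoc, ← Category.assoc,
      h1.isoPullback_hom_fst, h1.isoPullback_hom_snd]
    exact key i j
  · exact (Y.openCoverOfIsOpenCover U (by exact hU)).ι_glueMorphisms _ _ i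

theorem projMap_mem_basicOpen {Y : Scheme.{u}} {U : Y.Opens} (hU : IsAffineOpen U)
    (φ : S →+* Γ(Y, U)) {f : S} {m : ℕ} (hf : f ∈ 𝒜 m) (hm : 0 < m) (hu : IsUnit (φ f)) {g : S}
    {n : ℕ} (hg : g ∈ 𝒜 n) (hn : 0 < n) (x : (U : Scheme.{u})) :
    projMap φ hf hm hu x ∈ Proj.basicOpen 𝒜 g ↔ U.ι x ∈ Y.basicOpen (φ g) := by
  have h1 : projMap φ hf hm hu x ∈ Proj.basicOpen 𝒜 g ↔
      U.toSpecΓ x ∈ projLift φ hf hm hu ⁻¹ᵁ Proj.basicOpen 𝒜 g := by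
    rw [projMap, Scheme.Hom.comp_apply]
    rfl
  have h2 : U.ι x = hU.fromSpec (U.toSpecΓ x) := by
    rw [← Scheme.Hom.comp_apply, hU.toSpecΓ_fromSpec]
  have h3 : hU.fromSpec (U.toSpecΓ x) ∈ Y.basicOpen (φ g) ↔
      U.toSpecΓ x ∈ hU.fromSpec ⁻¹ᵁ Y.basicOpen (φ g) := Iff.rfl
  rw [h1, h2, h3, projLift_preimage φ hf hm hu hg hn, hU.fromSpec_preimage_basicOpen]

end AwayLift

/-! ### Coordinates on open subsets -/

section Coordinates

/-- Affine opens `D i` with functions `t i j` on `D i` which behave like the standard opens and the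
quotients `x j / x i` of the coordinates of a projective space. -/
structure CoordinateCover (Y : Scheme.{u}) (I : Type) where
  D : I → Y.Opens
  t (i j : I) : Γ(Y, D i)
  isAffineOpen (i : I) : IsAffineOpen (D i)
  iSup_eq_top : iSup D = ⊤
  basicOpen_t (i j : I) : Y.basicOpen (t i j) = D i ⊓ D j
  t_self (i : I) : t i i = 1
  t_mul (i j l : I) : resO (inf_le_left : D i ⊓ D j ≤ D i) (t i j) *
    resO inf_le_right (t j l) = resO inf_le_left (t i l)

/-- The preimage of a coordinate cover under an affine morphism. -/
def CoordinateCover.preimage {X Y : Scheme.{u}} {I : Type} (C : CoordinateCover X I) (q : Y ⟶ X)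
    [IsAffineHom q] : CoordinateCover Y I where
  D i := q ⁻¹ᵁ C.D i
  t i j := q.app _ (C.t i j)
  isAffineOpen i := (C.isAffineOpen i).preimage q
  iSup_eq_top := by
    rw [← Scheme.Hom.preimage_iSup, C.iSup_eq_top]
    rfl
  basicOpen_t i j := by
    rw [← Scheme.preimage_basicOpen, C.basicOpen_t]
    rfl
  t_self i := by rw [C.t_self, map_one]
  t_mul i j l := by
    have h1 := congrArg (q.app _) (C.t_mul i j l)
    rw [map_mul, ← resO_app, ← resO_app, ← resO_app] at h1
    exact h1

end Coordinates

/-! ### The standard charts of projective space -/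

section ProjectiveSpace

open HomogeneousLocalization

attribute [local instance] MvPolynomial.gradedAlgebra

variable (k : Type u) [Field k] (n : ℕ)

local notation "𝒮" => MvPolynomial.homogeneousSubmodule (Fin (n + 1)) k

theorem X_mem (i : Fin (n + 1)) : (MvPolynomial.X i : MvPolynomial (Fin (n + 1)) k) ∈ 𝒮 1 :=
  MvPolynomial.isHomogeneous_X k i

/-- The open subset of projective space where a homogeneous polynomial does not vanish. -/
def stdOpen (f : MvPolynomial (Fin (n + 1)) k) : (ProjectiveSpace k n).Opens := Proj.basicOpen 𝒮 f

theorem opens_eq_of_preimage_eq {Y Z : Scheme.{u}} (g : Z ⟶ Y) [IsOpenImmersion g] {V W : Y.Opens}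
    (hV : V ≤ g.opensRange) (hW : W ≤ g.opensRange) (h : g ⁻¹ᵁ V = g ⁻¹ᵁ W) : V = W := by
  have h2 := congrArg (fun T => g ''ᵁ T) h
  rwa [Scheme.Hom.image_preimage_eq_opensRange_inf, Scheme.Hom.image_preimage_eq_opensRange_inf,
    inf_eq_right.2 hV, inf_eq_right.2 hW] at h2

/-- Functions on the standard affine opens of projective space. -/
def awayEquiv {f : MvPolynomial (Fin (n + 1)) k} {m : ℕ} (hf : f ∈ 𝒮 m) (hm : 0 < m) :
    Γ(ProjectiveSpace k n, stdOpen k n f) ≃+* Away 𝒮 f :=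
  RingEquiv.ofBijective (pullSection (R := .of (Away 𝒮 f)) (Proj.awayι 𝒮 f hf hm) (by
      rw [← Proj.opensRange_awayι 𝒮 f hf hm, Scheme.Hom.preimage_opensRange]))
    (pullSection_bijective (R := .of (Away 𝒮 f)) (Proj.awayι 𝒮 f hf hm)
      (Proj.opensRange_awayι 𝒮 f hf hm).symm _)

theorem awayEquiv_resO {f g x : MvPolynomial (Fin (n + 1)) k} {m m' l : ℕ} (hf : f ∈ 𝒮 m)
    (hm : 0 < m) (hg : g ∈ 𝒮 m') (hx : x = f * g) (hx' : x ∈ 𝒮 l) (hl : 0 < l) (hl' : l = m + m')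
    (h : stdOpen k n x ≤ stdOpen k n f)
    (a : Γ(ProjectiveSpace k n, stdOpen k n f)) :
    awayEquiv k n hx' hl (resO h a) = awayMap 𝒮 hg hx (awayEquiv k n hf hm a) := by
  subst hl'
  refine (pullSection_resO (Y := ProjectiveSpace k n) _ _ _ _).trans ?_
  have h1 := Proj.SpecMap_awayMap_awayι 𝒮 hf hm hg hx
  have h5 : ∀ (g g' : Spec (.of (Away 𝒮 x)) ⟶ ProjectiveSpace k n) (_ : g = g')
      (h : ⊤ ≤ g ⁻¹ᵁ Proj.basicOpen 𝒮 f) (h' : ⊤ ≤ g' ⁻¹ᵁ Proj.basicOpen 𝒮 f),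
      pullSection g h a = pullSection g' h' a := by
    rintro g _ rfl _ _
    rfl
  have h4 : ⊤ ≤ Proj.awayι 𝒮 f hf hm ⁻¹ᵁ Proj.basicOpen 𝒮 f := by
    rw [← Proj.opensRange_awayι 𝒮 f hf hm, Scheme.Hom.preimage_opensRange]
  have h2 : ⊤ ≤ (Spec.map (CommRingCat.ofHom (awayMap 𝒮 hg hx)) ≫ Proj.awayι 𝒮 f hf hm) ⁻¹ᵁ
      Proj.basicOpen 𝒮 f := by
    rw [Scheme.Hom.comp_preimage, top_le_iff.1 h4]
    rfl
  have h3 := pullSection_SpecMap (Y := ProjectiveSpace k n)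
    (CommRingCat.ofHom (awayMap 𝒮 hg hx)) (Proj.awayι 𝒮 f hf hm) h4 h2 a
  exact (h5 _ _ h1.symm _ h2).trans h3

/-- The quotient `x j / x i`. -/
def coordQuot (i j : Fin (n + 1)) : Away 𝒮 (MvPolynomial.X i) :=
  Away.mk 𝒮 (X_mem k n i) 1 (MvPolynomial.X j) (X_mem k n j)

theorem adjoin_range_X :
    Algebra.adjoin (𝒮 0) (Set.range (MvPolynomial.X : Fin (n + 1) → MvPolynomial (Fin (n + 1)) k)) =
      ⊤ := by
  refine top_le_iff.1 fun p _ => ?_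
  induction p using MvPolynomial.induction_on with
  | C a =>
    exact Subalgebra.algebraMap_mem _ (⟨MvPolynomial.C a, MvPolynomial.isHomogeneous_C _ _⟩ : 𝒮 0)
  | add p q hp hq => exact add_mem (hp trivial) (hq trivial)
  | mul_X p i hp => exact mul_mem (hp trivial) (Algebra.subset_adjoin ⟨i, rfl⟩)

theorem preimage_basicOpen_pullSection {R : CommRingCat.{u}} {Y : Scheme.{u}} (g : Spec R ⟶ Y)
    {V : Y.Opens} (h : ⊤ ≤ g ⁻¹ᵁ V) (a : Γ(Y, V)) :
    g ⁻¹ᵁ Y.basicOpen a = PrimeSpectrum.basicOpen (pullSection g h a) := by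
  have h1 : (Spec R).basicOpen (g.appLE V ⊤ h a) =
      PrimeSpectrum.basicOpen ((Scheme.ΓSpecIso R).hom (g.appLE V ⊤ h a)) :=
    basicOpen_eq_of_affine' _
  refine Eq.trans ?_ h1
  rw [Scheme.basicOpen_appLE, top_inf_eq]

/-- Both sides lie in the chart of `x_i` and are compared after pulling back to it, where each
becomes the basic open of `x_j / x_i`. -/
theorem basicOpen_coordQuot (i j : Fin (n + 1)) :
    (ProjectiveSpace k n).basicOpen ((awayEquiv k n (X_mem k n i) one_pos).symm
      (coordQuot k n i j)) = stdOpen k n (MvPolynomial.X i) ⊓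
        stdOpen k n (MvPolynomial.X j) := by
  have h0 := Proj.opensRange_awayι 𝒮 _ (X_mem k n i) one_pos
  have h3 : IsOpenImmersion (Proj.awayι 𝒮 _ (X_mem k n i) one_pos) := inferInstance
  refine @opens_eq_of_preimage_eq (ProjectiveSpace k n) _ (Proj.awayι 𝒮 _ (X_mem k n i) one_pos)
    h3 _ _ ((Scheme.basicOpen_le _ _).trans h0.ge) (inf_le_left.trans h0.ge) ?_
  have h4 : ⊤ ≤ Proj.awayι 𝒮 _ (X_mem k n i) one_pos ⁻¹ᵁ
      Proj.basicOpen 𝒮 (MvPolynomial.X i) := by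
    rw [← h0, Scheme.Hom.preimage_opensRange]
  refine (preimage_basicOpen_pullSection (Y := ProjectiveSpace k n) _ h4 _).trans ?_
  have h5 : pullSection (Y := ProjectiveSpace k n) (R := .of _) _ h4
      ((awayEquiv k n (X_mem k n i) one_pos).symm (coordQuot k n i j)) = coordQuot k n i j :=
    (awayEquiv k n (X_mem k n i) one_pos).apply_symm_apply _
  rw [h5]
  have h6 := Proj.awayι_preimage_basicOpen 𝒮 (X_mem k n i) one_pos (X_mem k n j) one_pos
  have h7 : Away.isLocalizationElem (X_mem k n i) (X_mem k n j) = coordQuot k n i j := by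
    ext
    refine (Away.val_mk ..).trans ((Away.val_mk ..).trans ?_).symm
    congr 1
    exact (pow_one _).symm
  rw [h7] at h6
  refine h6.symm.trans ?_
  refine Eq.trans ?_ (Scheme.Hom.preimage_inf _).symm
  exact ((congrArg (· ⊓ _) (top_le_iff.1 h4)).trans (top_inf_eq _)).symm

/-- The opens of `x_i x_j` and `D i ⊓ D j` are equal but not by definition; this moves an identity
of functions from one to the other. -/
theorem mul_resO_eq_of_le {Y : Scheme.{u}} {U V T W : Y.Opens} (h : W ≤ T) (h' : T ≤ W)
    (hU : T ≤ U) (hV : T ≤ V) {a c : Γ(Y, U)} {b : Γ(Y, V)}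
    (H : resO (h.trans hU) a * resO (h.trans hV) b = resO (h.trans hU) c) :
    resO hU a * resO hV b = resO hU c := by
  have h1 := congrArg (resO h') H
  rwa [map_mul, resO_resO, resO_resO, resO_resO] at h1

/-- The standard cover of projective space. -/
def standardCover : CoordinateCover (ProjectiveSpace k n) (Fin (n + 1)) where
  D i := stdOpen k n (MvPolynomial.X i)
  t i j := (awayEquiv k n (X_mem k n i) one_pos).symm (coordQuot k n i j)
  isAffineOpen i := Proj.isAffineOpen_basicOpen 𝒮 _ (X_mem k n i) one_pos
  iSup_eq_top := Proj.iSup_basicOpen_eq_top' 𝒮 _ (fun i => ⟨1, X_mem k n i⟩) (adjoin_range_X k n)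
  basicOpen_t := basicOpen_coordQuot k n
  t_self i := by
    rw [RingEquiv.symm_apply_eq, map_one]
    ext
    rw [coordQuot, Away.val_mk, HomogeneousLocalization.val_one, ← Localization.mk_self
      (⟨MvPolynomial.X i ^ 1, ⟨1, rfl⟩⟩ : Submonoid.powers (MvPolynomial.X i))]
    congr 1
    exact (pow_one _).symm
  t_mul i j l := by
    have hij : (MvPolynomial.X i * MvPolynomial.X j : MvPolynomial (Fin (n + 1)) k) ∈ 𝒮 2 :=
      SetLike.mul_mem_graded (X_mem k n i) (X_mem k n j)
    have hji : (MvPolynomial.X i * MvPolynomial.X j : MvPolynomial (Fin (n + 1)) k) =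
      MvPolynomial.X j * MvPolynomial.X i := mul_comm _ _
    have hD : stdOpen k n (MvPolynomial.X i * MvPolynomial.X j) =
        stdOpen k n (MvPolynomial.X i) ⊓ stdOpen k n (MvPolynomial.X j) := Proj.basicOpen_mul 𝒮 _ _
    refine mul_resO_eq_of_le hD.le hD.ge _ _ ((awayEquiv k n hij two_pos).injective ?_)
    rw [map_mul, awayEquiv_resO k n (X_mem k n i) one_pos (X_mem k n j) rfl hij two_pos rfl,
      awayEquiv_resO k n (X_mem k n j) one_pos (X_mem k n i) hji hij two_pos rfl,
      awayEquiv_resO k n (X_mem k n i) one_pos (X_mem k n j) rfl hij two_pos rfl,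
      RingEquiv.apply_symm_apply, RingEquiv.apply_symm_apply, RingEquiv.apply_symm_apply,
      coordQuot, coordQuot, coordQuot, awayMap_mk, awayMap_mk, awayMap_mk]
    ext
    rw [HomogeneousLocalization.val_mul, Away.val_mk, Away.val_mk, Away.val_mk,
      Localization.mk_mul, Localization.mk_eq_mk_iff, Localization.r_iff_exists]
    refine ⟨1, ?_⟩
    simp only [OneMemClass.coe_one, one_mul, Submonoid.coe_mul, pow_one]
    ring

end ProjectiveSpace

/-! ### Embeddings into projective space -/

section Scalars

variable {k : Type u} [Field k] {Y : Scheme.{u}} (p : Y ⟶ Spec (.of k))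

/-- The scalars among the functions on an open subset of a `k`-scheme. -/
def scalars (U : Y.Opens) : k →+* Γ(Y, U) :=
  ((Scheme.ΓSpecIso (.of k)).inv ≫ p.appLE ⊤ U le_top).hom

theorem resO_scalars {U V : Y.Opens} (h : V ≤ U) (a : k) :
    resO h (scalars p U a) = scalars p V a :=
  ConcreteCategory.congr_hom (p.appLE_map (U := ⊤) le_top (homOfLE h).op)
    ((Scheme.ΓSpecIso (.of k)).inv a)

theorem toSpecΓ_SpecMap_scalars (U : Y.Opens) :
    U.toSpecΓ ≫ Spec.map (CommRingCat.ofHom (scalars p U)) = U.ι ≫ p := by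
  have h1 : Spec.map (CommRingCat.ofHom (scalars p U)) =
      Spec.map (p.appLE ⊤ U le_top) ≫ Spec.map (Scheme.ΓSpecIso (.of k)).inv :=
    Spec.map_comp _ _
  have h2 : U ≤ p ⁻¹ᵁ ⊤ := le_top
  have h3 : U.toSpecΓ ≫ Spec.map (p.appLE ⊤ U h2) = U.ι ≫ p ≫ (Spec (.of k)).toSpecΓ := by
    rw [Scheme.Opens.toSpecΓ_SpecMap_appLE, Scheme.Opens.toSpecΓ_top, ← Category.assoc,
      Scheme.Hom.resLE_comp_ι, Category.assoc]
  rw [h1, ← Category.assoc]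
  refine (congrArg (· ≫ _) h3).trans ?_
  simp only [Category.assoc]
  rw [toSpecΓ_SpecMap_ΓSpecIso_inv, Category.comp_id]

end Scalars

/-! ### Extending functions to sections of twisting powers -/

section Extension

namespace CoordinateCover

variable {Y : Scheme.{u}} {I : Type} (C : CoordinateCover Y I)

/-- A section of the `m`-th power of the twisting sheaf, as a family of functions. -/
def IsSection (m : ℕ) (σ : ∀ j, Γ(Y, C.D j)) : Prop :=
  ∀ j l, resO (inf_le_right : C.D j ⊓ C.D l ≤ C.D l) (σ l) =
    resO inf_le_right (C.t l j) ^ m * resO inf_le_left (σ j)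

theorem res_t_mul (i j l : I) {W : Y.Opens} (hi : W ≤ C.D i) (hj : W ≤ C.D j) :
    resO hi (C.t i j) * resO hj (C.t j l) = resO hi (C.t i l) := by
  have h1 := congrArg (resO (le_inf hi hj)) (C.t_mul i j l)
  rwa [map_mul, resO_resO, resO_resO, resO_resO] at h1

variable {C}

theorem isSection_one : C.IsSection 0 fun _ => 1 := fun j l => by
  rw [map_one, map_one, pow_zero, one_mul]

/-- The functions `t j i ^ n` are the local expressions of `x_i ^ n`, a section of the `n`-th
twisting power. -/
theorem IsSection.t_pow_mul {m : ℕ} {σ : ∀ j, Γ(Y, C.D j)} (hσ : C.IsSection m σ) (i : I) (n : ℕ) :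
    C.IsSection (m + n) fun j => C.t j i ^ n * σ j := fun j l => by
  have h1 := C.res_t_mul l j i (inf_le_right : C.D j ⊓ C.D l ≤ C.D l) inf_le_left
  rw [map_mul, map_mul, hσ j l, map_pow, map_pow, ← h1, mul_pow, pow_add]
  ring

theorem isCompact_inf (C : CoordinateCover Y I) (j l : I) :
    IsCompact ((C.D j ⊓ C.D l : Y.Opens) : Set Y) := by
  rw [← C.basicOpen_t]
  exact ((C.isAffineOpen j).basicOpen _).isCompact

theorem eq_of_res_mul {U : Y.Opens} {V : Y.Opens} (hV : V ≤ U) (f : Γ(Y, U))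
    (hVc : IsCompact (V : Set Y)) {W : Y.Opens} (hWV : W ≤ V) (hW : V ⊓ Y.basicOpen f ≤ W)
    (a b : Γ(Y, V)) (h : resO hWV a = resO hWV b) :
    ∃ n : ℕ, resO hV f ^ n * a = resO hV f ^ n * b := by
  obtain ⟨n, hn⟩ := exists_pow_mul_eq_zero hVc (resO hV f) (a - b) (by
    have h1 : Y.basicOpen (resO hV f) ≤ W := (basicOpen_resO hV f).le.trans hW
    have h2 := congrArg (resO h1) h
    rw [resO_resO, resO_resO] at h2
    rw [map_sub, h2, sub_self])
  exact ⟨n, sub_eq_zero.1 (by rw [← mul_sub, hn])⟩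

/-- For large `m` the product `x_i ^ m b` extends to a global section of the `m`-th twisting power.
The exponent `N` clears denominators on every `D j`. The extensions then satisfy the gluing
relations on `D i`, hence everywhere after multiplication by a further `M`-th power. The freedom in
`n` lets finitely many functions share one exponent. -/
theorem exists_isSection [Finite I] (C : CoordinateCover Y I) (i : I) (b : Γ(Y, C.D i)) :
    ∃ m₀ : ℕ, ∀ n : ℕ, ∃ σ : ∀ j, Γ(Y, C.D j), C.IsSection (m₀ + n) σ ∧ σ i = b := by
  have := Fintype.ofFinite I
  have h1 : ∀ j, ∃ (n : ℕ) (y : Γ(Y, C.D j)), resO (inf_le_left : C.D j ⊓ C.D i ≤ C.D j) y =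
      resO inf_le_left (C.t j i) ^ n * resO inf_le_right b := by
    intro j
    have h2 : Y.basicOpen (C.t j i) ≤ C.D i := (C.basicOpen_t j i).le.trans inf_le_right
    obtain ⟨n, y, hy⟩ := exists_resO_eq_pow_mul (C.isAffineOpen j) (C.t j i) (resO h2 b)
    refine ⟨n, y, ?_⟩
    have h3 := congrArg (resO (C.basicOpen_t j i).ge) hy
    rw [map_mul, map_pow, resO_resO, resO_resO, resO_resO] at h3
    exact h3
  choose n₁ y₁ hy₁ using h1
  obtain ⟨N, hN⟩ : ∃ N, ∀ j, n₁ j ≤ N :=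
    ⟨Finset.univ.sup n₁, fun j => Finset.le_sup (Finset.mem_univ j)⟩
  have h1 : ∀ j, ∃ y : Γ(Y, C.D j), ∀ (W : Y.Opens) (hj : W ≤ C.D j) (hi : W ≤ C.D i),
      resO hj y = resO hj (C.t j i) ^ N * resO hi b := by
    refine fun j => ⟨C.t j i ^ (N - n₁ j) * y₁ j, fun W hj hi => ?_⟩
    have h3 := congrArg (resO (le_inf hj hi)) (hy₁ j)
    rw [map_mul, map_pow, resO_resO, resO_resO, resO_resO] at h3
    rw [map_mul, map_pow, h3, ← mul_assoc, ← pow_add, Nat.sub_add_cancel (hN j)]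
  choose y hy using h1
  have h2 : ∀ j l, ∃ M : ℕ,
      resO (inf_le_left : C.D j ⊓ C.D l ≤ C.D j) (C.t j i) ^ M * resO inf_le_right (y l) =
        resO (inf_le_left : C.D j ⊓ C.D l ≤ C.D j) (C.t j i) ^ M *
          (resO inf_le_right (C.t l j) ^ N * resO inf_le_left (y j)) := by
    intro j l
    refine eq_of_res_mul inf_le_left (C.t j i) (C.isCompact_inf j l)
      (W := (C.D j ⊓ C.D l) ⊓ C.D i) inf_le_left ?_ _ _ ?_
    · rw [C.basicOpen_t]
      exact inf_le_inf_left _ inf_le_right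
    · have hj : (C.D j ⊓ C.D l) ⊓ C.D i ≤ C.D j := inf_le_left.trans inf_le_left
      have hl : (C.D j ⊓ C.D l) ⊓ C.D i ≤ C.D l := inf_le_left.trans inf_le_right
      rw [map_mul, map_pow, resO_resO, resO_resO, resO_resO, hy l _ hl inf_le_right,
        hy j _ hj inf_le_right, ← mul_assoc, ← mul_pow, C.res_t_mul l j i hl hj]
  choose M₁ hM₁ using h2
  obtain ⟨M, hM⟩ : ∃ M, ∀ j l, M₁ j l ≤ M :=
    ⟨Finset.univ.sup fun j => Finset.univ.sup (M₁ j), fun j l =>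
      (Finset.le_sup (f := M₁ j) (Finset.mem_univ l)).trans
        (Finset.le_sup (f := fun j => Finset.univ.sup (M₁ j)) (Finset.mem_univ j))⟩
  have h3 : C.IsSection (N + M) fun j => C.t j i ^ M * y j := by
    intro j l
    have h4 := congrArg (resO (inf_le_left : C.D j ⊓ C.D l ≤ C.D j) (C.t j i) ^ (M - M₁ j l) * ·)
      (hM₁ j l)
    rw [← mul_assoc, ← mul_assoc, ← pow_add, Nat.sub_add_cancel (hM j l)] at h4
    rw [map_mul, map_mul, map_pow, map_pow,
      ← C.res_t_mul l j i (inf_le_right : C.D j ⊓ C.D l ≤ C.D l) inf_le_left, mul_pow, pow_add,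
      mul_assoc, h4]
    ring
  have h4 : y i = b := by
    have h5 := hy i (C.D i) le_rfl le_rfl
    rwa [resO_self, resO_self, resO_self, C.t_self, one_pow, one_mul] at h5
  refine ⟨N + M, fun n => ⟨_, h3.t_pow_mul i n, ?_⟩⟩
  rw [C.t_self, one_pow, one_mul, one_pow, one_mul, h4]

end CoordinateCover

end Extension

/-! ### Surjectivity of the lift to a chart -/

section Surjective

open HomogeneousLocalization

variable {S : Type u} {σ : Type*} [CommRing S] [SetLike σ S] [AddSubgroupClass σ S] {𝒜 : ℕ → σ}
  [GradedRing 𝒜] {R : Type u} [CommRing R]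

/-- Since `φ f = 1`, a homogeneous `a` of degree `n` and the fraction `a / f ^ n` have the same
image; an arbitrary element is the sum of its homogeneous components. -/
theorem awayLift_surjective {φ : S →+* R} (hφ : Function.Surjective φ) {f : S} (hf : f ∈ 𝒜 1)
    (h1 : φ f = 1) (hu : IsUnit (φ f)) : Function.Surjective (awayLift 𝒜 φ f hu) := by
  intro r
  obtain ⟨a, rfl⟩ := hφ r
  change φ a ∈ (awayLift 𝒜 φ f hu).range
  classical
  rw [← DirectSum.sum_support_decompose 𝒜 a, map_sum]
  refine sum_mem fun n _ => ⟨Away.mk 𝒜 hf n (DirectSum.decompose 𝒜 a n)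
    (by rw [smul_eq_mul, mul_one]; exact SetLike.coe_mem _), ?_⟩
  have h2 := awayLift_mk φ hu hf n (DirectSum.decompose 𝒜 a n)
    (by rw [smul_eq_mul, mul_one]; exact SetLike.coe_mem _)
  rwa [h1, one_pow, mul_one] at h2

end Surjective

/-! ### The closed immersion given by a coordinate cover -/

section Embedding

attribute [local instance] MvPolynomial.gradedAlgebra

theorem eval₂_of_scaling {k R : Type*} [CommRing k] [CommRing R] {τ : Type*} (f : k →+* R)
    (g g' : τ → R) (c : R) (h : ∀ i, g' i = c * g i) {n : ℕ} {a : MvPolynomial τ k}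
    (ha : a ∈ MvPolynomial.homogeneousSubmodule τ k n) :
    MvPolynomial.eval₂ f g' a = c ^ n * MvPolynomial.eval₂ f g a := by
  rw [MvPolynomial.eval₂_eq, MvPolynomial.eval₂_eq, Finset.mul_sum]
  refine Finset.sum_congr rfl fun s hs => ?_
  have h1 : s.degree = n := by
    rw [← ha (MvPolynomial.mem_support_iff.1 hs), Finsupp.degree_eq_weight_one]
    rfl
  have h2 : ∏ i ∈ s.support, c ^ s i = c ^ n := by
    rw [Finset.prod_pow_eq_pow_sum, ← h1]
    rfl
  rw [← h2, mul_left_comm, ← Finset.prod_mul_distrib]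
  simp only [h, mul_pow]

variable {k : Type u} [Field k] {n : ℕ}

local notation "𝒮" => MvPolynomial.homogeneousSubmodule (Fin (n + 1)) k

theorem bijective_algebraMap_homogeneous :
    Function.Bijective (algebraMap k (MvPolynomial.homogeneousSubmodule (Fin (n + 1)) k 0)) := by
  refine ⟨fun a b h => MvPolynomial.C_injective (Fin (n + 1)) k (congrArg Subtype.val h),
    fun a => ?_⟩
  obtain ⟨a, ha⟩ := a
  obtain ⟨b, hb⟩ : ∃ b, a = MvPolynomial.C b :=
    ⟨_, MvPolynomial.totalDegree_eq_zero_iff_eq_C.1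
      ((MvPolynomial.totalDegree_zero_iff_isHomogeneous _).2 ha)⟩
  exact ⟨b, Subtype.ext hb.symm⟩

/-- `Proj` of a finitely generated algebra is proper over its degree zero part, which here is `k`.
-/
theorem isProper_toSpec : IsProper (ProjectiveSpace.toSpec k n) := by
  classical
  have h1 : Algebra.FiniteType (𝒮 0) (MvPolynomial (Fin (n + 1)) k) :=
    ⟨⟨Finset.univ.image MvPolynomial.X, by
      rw [Finset.coe_image, Finset.coe_univ, Set.image_univ]
      exact adjoin_range_X k n⟩⟩
  have h2 : IsIso (CommRingCat.ofHom (algebraMap k (𝒮 0))) :=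
    (ConcreteCategory.isIso_iff_bijective _).2 bijective_algebraMap_homogeneous
  have h3 : IsProper (Proj.toSpecZero 𝒮) := inferInstance
  have h4 : IsProper (Spec.map (CommRingCat.ofHom (algebraMap k (𝒮 0)))) := inferInstance
  exact MorphismProperty.comp_mem _ _ _ h3 h4

theorem IsProjective.isProper {X : Scheme.{u}} {π : X ⟶ Spec (.of k)} (h : IsProjective π) :
    IsProper π := by
  obtain ⟨n, i, hi, rfl⟩ := h
  have h1 : IsProper i := inferInstance
  exact MorphismProperty.comp_mem _ _ _ h1 isProper_toSpec

theorem projMap_toSpec {Y : Scheme.{u}} (p : Y ⟶ Spec (.of k)) {U : Y.Opens}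
    (g : Fin (n + 1) → Γ(Y, U)) {f : MvPolynomial (Fin (n + 1)) k} {m : ℕ} (hf : f ∈ 𝒮 m)
    (hm : 0 < m) (hu : IsUnit (MvPolynomial.eval₂Hom (scalars p U) g f)) :
    projMap (𝒜 := 𝒮) (MvPolynomial.eval₂Hom (scalars p U) g) hf hm hu ≫
      ProjectiveSpace.toSpec k n = U.ι ≫ p := by
  rw [← toSpecΓ_SpecMap_scalars]
  refine (Category.assoc _ _ _).trans (congrArg (U.toSpecΓ ≫ ·) ?_)
  refine (Category.assoc _ _ _).trans ?_
  refine (congrArg (Spec.map _ ≫ ·) (Proj.awayι_toSpecZero_assoc 𝒮 f hf hm _)).trans ?_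
  rw [← Spec.map_comp, ← Spec.map_comp]
  congr 1
  ext a
  have h1 := awayLift_mk (𝒜 := 𝒮) (MvPolynomial.eval₂Hom (scalars p U) g) hu hf 0
    (MvPolynomial.C a) (by rw [zero_smul]; exact MvPolynomial.isHomogeneous_C _ _)
  rw [pow_zero, mul_one, MvPolynomial.eval₂Hom_C] at h1
  refine Eq.trans ?_ h1
  have h2 : HomogeneousLocalization.fromZeroRingHom 𝒮 (Submonoid.powers f) (algebraMap k (𝒮 0) a) =
      HomogeneousLocalization.Away.mk 𝒮 hf 0 (MvPolynomial.C a)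
        (by rw [zero_smul]; exact MvPolynomial.isHomogeneous_C _ _) := by
    ext
    refine Eq.symm ?_
    rw [HomogeneousLocalization.Away.val_mk]
    rfl
  exact congrArg (awayLift 𝒮 (MvPolynomial.eval₂Hom (scalars p U) g) f hu) h2

/-- Being a monomorphism is local on the target. The opens `W i` cover the image only; the
complement of the closed image completes the cover, and over it the source is empty. -/
theorem mono_of_isClosed_range {Y P : Scheme.{u}} (h : Y ⟶ P) (hc : IsClosed (Set.range h))
    {I : Type*} (W : I → P.Opens) (hW : ⨆ i, h ⁻¹ᵁ W i = ⊤) (hm : ∀ i, Mono ((h ⁻¹ᵁ W i).ι ≫ h)) : Mono h := by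
  let V : Option I → P.Opens := fun o => o.elim ⟨(Set.range h)ᶜ, hc.isOpen_compl⟩ W
  have hV : iSup V = ⊤ := by
    refine top_le_iff.1 fun x _ => ?_
    by_cases hx : x ∈ Set.range h
    · obtain ⟨y, rfl⟩ := hx
      have h1 : y ∈ ⨆ i, h ⁻¹ᵁ W i := hW ▸ trivial
      obtain ⟨i, hi⟩ := Opens.mem_iSup.1 h1
      exact Opens.mem_iSup.2 ⟨some i, hi⟩
    · exact Opens.mem_iSup.2 ⟨none, hx⟩
  refine (@IsZariskiLocalAtTarget.iff_of_iSup_eq_top (MorphismProperty.monomorphisms Scheme.{u})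
    instIsZariskiLocalAtTargetMonomorphismsScheme _ _ _ _ V hV).2 fun o => ?_
  change Mono (h ∣_ V o)
  have h2 : ∀ U, Mono ((h ⁻¹ᵁ U).ι ≫ h) → Mono (h ∣_ U) := fun U hU => by
    rw [← morphismRestrict_ι] at hU
    exact mono_of_mono _ U.ι
  cases o with
  | some i => exact h2 _ (hm i)
  | none =>
    have h3 : IsEmpty (h ⁻¹ᵁ V none : Y.Opens).toScheme := ⟨fun x => x.2 ⟨x.1, rfl⟩⟩
    have h4 : IsClosedImmersion (h ∣_ V none) := inferInstance
    infer_instance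

theorem hom_ext_of_iSup {Y Z : Scheme.{u}} {I : Type*} (U : I → Y.Opens) (hU : iSup U = ⊤)
    {f g : Y ⟶ Z} (h : ∀ i, (U i).ι ≫ f = (U i).ι ≫ g) : f = g :=
  Scheme.Cover.hom_ext (Y.openCoverOfIsOpenCover U hU) _ _ h

/-- The homogeneous coordinates are the `x_i ^ m` and extensions of algebra generators of the
functions on every `D i`. Over the chart where `x_i ^ m` is invertible these generators are in the
image of the coordinate ring, so `D i` is closed in that chart. Thus the morphism is a monomorphism;
it is proper because `Y` is, hence a closed immersion. -/
theorem CoordinateCover.isProjective {Y : Scheme.{u}} {I : Type} [Fintype I] [Nonempty I]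
    (C : CoordinateCover Y I) (p : Y ⟶ Spec (.of k)) [IsProper p] : IsProjective p := by
  classical
  have hft : LocallyOfFiniteType p := inferInstance
  have h1 : ∀ i, ∃ (r : ℕ) (b : Fin r → Γ(Y, C.D i)),
      Function.Surjective (MvPolynomial.eval₂Hom (scalars p (C.D i)) b) := by
    intro i
    let := (scalars p (C.D i)).toAlgebra
    have h2 : Algebra.FiniteType k Γ(Y, C.D i) := by
      have h3 : (p.appLE ⊤ (C.D i) le_top).hom.FiniteType :=
        @HasRingHomProperty.appLE @LocallyOfFiniteType _
          instHasRingHomPropertyLocallyOfFiniteTypeFiniteType _ _ p hft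
          ⟨⊤, isAffineOpen_top _⟩ ⟨C.D i, C.isAffineOpen i⟩ le_top
      exact h3.comp (RingHom.FiniteType.of_surjective _
        (Scheme.ΓSpecIso (.of k)).symm.commRingCatIsoToRingEquiv.surjective)
    obtain ⟨r, ψ, hψ⟩ := Algebra.FiniteType.iff_quotient_mvPolynomial''.1 h2
    refine ⟨r, fun j => ψ (MvPolynomial.X j), fun y => ?_⟩
    obtain ⟨q, rfl⟩ := hψ y
    exact ⟨q, (DFunLike.congr_fun (MvPolynomial.aeval_unique ψ) q).symm⟩
  choose r b hb using h1
  have h1 : ∀ i (l : Fin (r i)), ∃ m₀ : ℕ, ∀ n : ℕ, ∃ σ : ∀ j, Γ(Y, C.D j),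
    C.IsSection (m₀ + n) σ ∧ σ i = b i l := fun i l => C.exists_isSection i (b i l)
  choose m₀ hm₀ using h1
  -- The summand `1` makes `m` positive, so that `t j i ^ m` has the same basic open as `t j i`.
  obtain ⟨m, hm, hm'⟩ : ∃ m, 0 < m ∧ ∀ i l, m₀ i l ≤ m :=
    ⟨(Finset.univ.sup fun i => Finset.univ.sup (m₀ i)) + 1, Nat.succ_pos _, fun i l =>
      ((Finset.le_sup (f := m₀ i) (Finset.mem_univ l)).trans (Finset.le_sup
        (f := fun i => Finset.univ.sup (m₀ i)) (Finset.mem_univ i))).trans (Nat.le_succ _)⟩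
  have h1 : ∀ i l, ∃ σ : ∀ j, Γ(Y, C.D j), C.IsSection m σ ∧ σ i = b i l := fun i l => by
    obtain ⟨σ, h2, h3⟩ := hm₀ i l (m - m₀ i l)
    rw [Nat.add_sub_cancel' (hm' i l)] at h2
    exact ⟨σ, h2, h3⟩
  choose τ hτ hτ' using h1
  let K := I ⊕ Σ i, Fin (r i)
  have hK : Nonempty K := ⟨.inl (Classical.arbitrary I)⟩
  obtain ⟨n, hn⟩ : ∃ n, Fintype.card K = n + 1 :=
    ⟨Fintype.card K - 1, (Nat.succ_pred_eq_of_pos Fintype.card_pos).symm⟩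
  let e : Fin (n + 1) ≃ K := (Fintype.equivFinOfCardEq hn).symm
  let σ : K → ∀ j, Γ(Y, C.D j) := Sum.elim (fun i j => C.t j i ^ m) fun il => τ il.1 il.2
  have hσ : ∀ a, C.IsSection m (σ a) := by
    rintro (i | ⟨i, l⟩)
    · have h2 := isSection_one.t_pow_mul (C := C) i m
      simp only [mul_one, zero_add] at h2
      exact h2
    · exact hτ i l
  let φ : ∀ j, MvPolynomial (Fin (n + 1)) k →+* Γ(Y, C.D j) := fun j =>
    MvPolynomial.eval₂Hom (scalars p (C.D j)) fun a => σ (e a) j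
  let f : I → Fin (n + 1) := fun i => e.symm (.inl i)
  have hφf : ∀ i j, φ j (MvPolynomial.X (f i)) = C.t j i ^ m := fun i j => by
    simp [φ, f, σ]
  have hφ1 : ∀ i, φ i (MvPolynomial.X (f i)) = 1 := fun i => by rw [hφf, C.t_self, one_pow]
  have hu : ∀ i, IsUnit (φ i (MvPolynomial.X (f i))) := fun i => by
    rw [hφ1]
    exact isUnit_one
  have hs : ∀ i, Function.Surjective (φ i) := by
    intro i y
    obtain ⟨q, rfl⟩ := hb i y
    refine ⟨MvPolynomial.rename (fun l => e.symm (.inr ⟨i, l⟩)) q, ?_⟩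
    change MvPolynomial.eval₂ _ _ _ = MvPolynomial.eval₂ _ _ _
    rw [MvPolynomial.eval₂_rename]
    congr 1
    funext l
    simp [σ, hτ']
  obtain ⟨h, hh⟩ := exists_projMap (𝒜 := (MvPolynomial.homogeneousSubmodule (Fin (n + 1)) k)) (I := ULift.{u} I) (U := fun i => C.D i.down)
    (by rw [← C.iSup_eq_top]; exact (Equiv.ulift (α := I)).iSup_comp (g := C.D))
    (fun i => φ i.down) (f := fun i => MvPolynomial.X (f i.down)) (m := fun _ => 1)
    (fun i => X_mem k n _) (fun _ => one_pos) (fun i => hu i.down) (fun i j => by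
      refine ⟨resO inf_le_right (C.t j.down i.down) ^ m, fun n a ha => ?_⟩
      change (resO _) (MvPolynomial.eval₂ _ _ _) = _ * (resO _) (MvPolynomial.eval₂ _ _ _)
      rw [MvPolynomial.hom_eval₂, MvPolynomial.hom_eval₂]
      have h3 : ∀ (U V : Y.Opens) (h : V ≤ U),
          (resO h).comp (scalars p U) = scalars p V := fun U V h =>
        RingHom.ext fun a => resO_scalars p h a
      rw [h3, h3]
      exact eval₂_of_scaling _ _ _ _ (fun a => hσ (e a) i.down j.down) ha)
  have hp : h ≫ ProjectiveSpace.toSpec k n = p := by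
    refine hom_ext_of_iSup C.D C.iSup_eq_top fun i => ?_
    refine (Category.assoc _ _ _).symm.trans ?_
    rw [hh ⟨i⟩]
    exact projMap_toSpec p _ _ _ _
  -- The preimage of the chart of `x_i ^ m` is exactly `D i`, so that over this chart the morphism
  -- is the explicit one on `D i`.
  have h2 : ∀ i, h ⁻¹ᵁ Proj.basicOpen (MvPolynomial.homogeneousSubmodule (Fin (n + 1)) k) (MvPolynomial.X (f i)) = C.D i := by
    intro i
    ext x
    have h3 : x ∈ iSup C.D := by
      rw [C.iSup_eq_top]
      trivial
    obtain ⟨j, hj⟩ := Opens.mem_iSup.1 h3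
    have h4 := projMap_mem_basicOpen (C.isAffineOpen j) (φ j) (X_mem k n _) one_pos (hu j)
      (X_mem k n (f i)) one_pos (⟨x, hj⟩ : (C.D j : Scheme.{u}))
    have h5 : Y.basicOpen (C.t j i ^ m) = C.D j ⊓ C.D i :=
      (Y.basicOpen_pow _ hm).trans (C.basicOpen_t j i)
    rw [← hh ⟨j⟩, hφf, h5] at h4
    exact h4.trans ⟨fun h => h.2, fun h => ⟨hj, h⟩⟩
  have h3 : IsProper h := by
    have h5 : IsProper (ProjectiveSpace.toSpec k n) := isProper_toSpec
    have h6 : IsProper (h ≫ ProjectiveSpace.toSpec k n) := by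
      rw [hp]
      infer_instance
    exact @IsProper.of_comp _ _ _ h (ProjectiveSpace.toSpec k n) h6 h5.toIsSeparated
  have h4 : Mono h := by
    refine mono_of_isClosed_range h h.isClosedMap.isClosed_range
      (fun i => Proj.basicOpen (MvPolynomial.homogeneousSubmodule (Fin (n + 1)) k) (MvPolynomial.X (f i))) ?_ fun i => ?_
    · simp only [h2, C.iSup_eq_top]
    · rw [h2, hh ⟨i⟩]
      have h5 : IsIso (C.D i).toSpecΓ := inferInstanceAs (IsIso (C.isAffineOpen i).isoSpec.hom)
      have h6 : IsClosedImmersion (Spec.map (CommRingCat.ofHom (awayLift (MvPolynomial.homogeneousSubmodule (Fin (n + 1)) k) (φ i) _ (hu i)))) :=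
        IsClosedImmersion.spec_of_surjective _
          (awayLift_surjective (hs i) (X_mem k n _) (hφ1 i) (hu i))
      have h7 : Mono (Proj.awayι (MvPolynomial.homogeneousSubmodule (Fin (n + 1)) k)
        (MvPolynomial.X (f i)) (X_mem k n _) one_pos) := inferInstance
      have h8 : Mono (projLift (φ i) (X_mem k n (f i)) one_pos (hu i)) := mono_comp _ _
      exact mono_comp _ _
  exact ⟨n, h, (IsClosedImmersion.iff_isProper_and_mono h).2 ⟨h3, h4⟩, hp⟩

/-- The composite `Y ⟶ X ⟶ ℙⁿ` is affine, so the standard cover pulls back to a coordinate cover of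
`Y`, and `Y` is proper over `k`. -/
theorem IsProjective.of_isFinite {X Y : Scheme.{u}} {π : X ⟶ Spec (.of k)} (hπ : IsProjective π)
    (f : Y ⟶ X) [IsFinite f] : IsProjective (f ≫ π) := by
  have h1 := hπ.isProper
  obtain ⟨n, i, hi, -⟩ := hπ
  have h2 : IsProper f := inferInstance
  have h3 : IsProper (f ≫ π) := MorphismProperty.comp_mem _ _ _ h2 h1
  have h4 : IsAffineHom (f ≫ i) := inferInstance
  exact ((standardCover k n).preimage (f ≫ i)).isProjective (f ≫ π)

end Embedding

/-! ### From étale coverings to Cartan subbundles -/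

section Generator

variable {X Y : Scheme.{u}}

theorem IsFrame.val_ne_zero {M : X.Modules} {U : X.Opens} {s : Fin 1 → Γ(M, U)} (hs : IsFrame M s)
    {x : X} (hx : x ∈ U) : val M hx (s 0) ≠ 0 := by
  rw [← hs.fibreBasis_apply hx]
  exact (hs.fibreBasis hx).ne_zero 0

theorem IsVectorBundle.exists_isFrame_of_val_ne_zero {M : X.Modules} (hM : IsVectorBundle M 1)
    {U : X.Opens} (e : Γ(M, U)) {x : X} (hx : x ∈ U) (he : val M hx e ≠ 0) :
    ∃ (V : X.Opens) (h : V ≤ U), x ∈ V ∧ IsFrame M fun _ : Fin 1 => res M h e := by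
  obtain ⟨T, hxT, hTU, -, s, hs⟩ := hM.exists_isFrame_affine hx
  obtain ⟨V, hV, hxV, h⟩ := hs.exists_isFrame_of_linearIndependent hxT (fun _ => res M hTU e)
    (LinearIndependent.of_subsingleton (0 : Fin 1) (by rwa [val_res]))
  simp only [res_res] at h
  exact ⟨V, hV.trans hTU, hxV, h⟩

/-- A section of a line bundle on an affine open subset which does not vanish at a given point of
a discrete subset, but vanishes at the other points. -/
theorem IsVectorBundle.exists_val_ne_zero {M : X.Modules} (hM : IsVectorBundle M 1) {U : X.Opens}
    (hU : IsAffineOpen U) {F : Set X} (hF : _root_.IsDiscrete F) {x : X} (hx : x ∈ U) (hxF : x ∈ F) :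
    ∃ e : Γ(M, U), val M hx e ≠ 0 ∧
      ∀ (y : X) (hy : y ∈ U), y ∈ F → y ≠ x → val M hy e = 0 := by
  obtain ⟨O, hO, hxO, hOF⟩ : ∃ O : Set X, IsOpen O ∧ x ∈ O ∧ ∀ y ∈ O, y ∈ F → y = x := by
    obtain ⟨O, hO, hOF⟩ := isDiscrete_iff_forall_mem_exists_isOpen.1 hF x hxF
    have h1 : x ∈ O ∩ F := hOF ▸ rfl
    exact ⟨O, hO, h1.1, fun y hy hyF => (hOF ▸ ⟨hy, hyF⟩ : y ∈ ({x} : Set X))⟩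
  obtain ⟨T, hxT, hTU, -, s, hs⟩ := hM.exists_isFrame_affine hx
  obtain ⟨g, hg, hxg⟩ := hU.exists_basicOpen_le (V := T ⊓ ⟨O, hO⟩) ⟨x, hxT, hxO⟩ hx
  have hgT : X.basicOpen g ≤ T := hg.trans inf_le_left
  obtain ⟨n, m, hm⟩ := hM.exists_res_eq_pow_smul hU g (res M hgT (s 0))
  have hg0 : valO hx g ≠ 0 := (valO_ne_zero_iff hx g).2 hxg
  -- The extension `m` equals `g ^ n` times a frame near `x`, so it is nonzero at `x`, but its
  -- values at the other points of `F` are unknown. These points lie outside the basic open of `g`,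
  -- so the extra factor `g` kills them.
  refine ⟨g • m, ?_, fun y hy hyF hyx => ?_⟩
  · rw [val_smul, ← val_res (X.basicOpen_le g) hxg, hm, val_smul, val_res, map_pow, valO_resO]
    exact smul_ne_zero hg0 (smul_ne_zero (pow_ne_zero _ hg0) (hs.val_ne_zero (hgT hxg)))
  · rw [val_smul, not_not.1 fun h => hyx (hOF y (hg ((valO_ne_zero_iff hy g).1 h)).2 hyF),
      zero_smul]

/-- The fibre over `x` is finite and discrete. Adding sections that are each nonzero at exactly one
of its points gives a section nonzero at all of them, hence a frame on a neighbourhood of the fibre.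
As `f` is closed, this contains the preimage of a neighbourhood of `x`. -/
theorem IsVectorBundle.exists_isFrame_preimage {L : Y.Modules} (hL : IsVectorBundle L 1)
    (f : Y ⟶ X) [IsFinite f] (x : X) :
    ∃ (U : X.Opens) (_ : x ∈ U) (e : Γ(L, f ⁻¹ᵁ U)), IsFrame L fun _ : Fin 1 => e := by
  classical
  obtain ⟨_, ⟨U, hU, rfl⟩, hxU, -⟩ :=
    X.isBasis_affineOpens.exists_subset_of_mem_open (Set.mem_univ x) isOpen_univ
  have hW : IsAffineOpen (f ⁻¹ᵁ U) := hU.preimage f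
  have hFU : ∀ y ∈ f ⁻¹' {x}, y ∈ f ⁻¹ᵁ U := fun y hy => by
    rw [Set.mem_preimage, Set.mem_singleton_iff] at hy
    change f y ∈ U
    rwa [hy]
  have hfin : (f ⁻¹' {x}).Finite := f.finite_preimage_singleton x
  have h1 : ∀ y : f ⁻¹' {x}, ∃ e : Γ(L, f ⁻¹ᵁ U), val L (hFU y y.2) e ≠ 0 ∧
      ∀ (z : Y) (hz : z ∈ f ⁻¹ᵁ U), z ∈ f ⁻¹' {x} → z ≠ y → val L hz e = 0 := fun y =>
    hL.exists_val_ne_zero hW (f.isDiscrete_preimage_singleton x) (hFU y y.2) y.2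
  choose e he he' using h1
  have := hfin.fintype
  have h2 : ∀ y : f ⁻¹' {x}, val L (hFU y y.2) (∑ z, e z) ≠ 0 := by
    intro y
    rw [map_sum, Finset.sum_eq_single y]
    · exact he y
    · intro z _ hz
      exact he' z _ _ y.2 fun h => hz (Subtype.ext h.symm)
    · exact fun h => absurd (Finset.mem_univ _) h
  choose V hV hyV hfr using fun y : f ⁻¹' {x} =>
    hL.exists_isFrame_of_val_ne_zero _ _ (h2 y)
  have hcl : IsClosed (f '' (iSup V : Y.Opens)ᶜ) :=
    f.isClosedMap _ (iSup V).isOpen.isClosed_compl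
  -- The points of `U` whose whole fibre lies in the union of the `V y`.
  let T : X.Opens := U ⊓ ⟨(f '' (iSup V : Y.Opens)ᶜ)ᶜ, hcl.isOpen_compl⟩
  have hxT : x ∈ T := by
    refine ⟨hxU, ?_⟩
    rintro ⟨y, hy, hyx⟩
    exact hy (Opens.mem_iSup.2 ⟨⟨y, hyx⟩, hyV _⟩)
  have hTU : T ≤ U := inf_le_left
  have hTV : ∀ y ∈ f ⁻¹ᵁ T, ∃ z, y ∈ V z := fun y hy => by
    by_contra h
    exact hy.2 ⟨y, fun h' => h (Opens.mem_iSup.1 h'), rfl⟩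
  refine ⟨T, hxT, res L (f.preimage_mono hTU) (∑ z, e z),
    isFrame_of_basis_opens _ (fun W => ∃ z, W ≤ V z) ?_ ?_⟩
  · intro W hW y hy
    obtain ⟨z, hz⟩ := hTV y (hW hy)
    exact ⟨W ⊓ V z, ⟨z, inf_le_right⟩, inf_le_left, hy, hz⟩
  · rintro W hW ⟨z, hz⟩
    have h3 := hfr z W hz
    simp only [res_res] at h3 ⊢
    exact h3

end Generator

/-! ### Split étale algebras acting on a vector space -/

section EtaleCartan

open Module

variable {K V : Type u} [Field K] [AddCommGroup V] [Module K V] [Module.Finite K V] {d : ℕ}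

/-- Each coordinate idempotent acts as a nonzero endomorphism. A nonzero vector in its image is a
common eigenvector on which `c` acts by `c j`. These vectors are independent, and by the dimension
they form a basis. -/
theorem isCartanSubalgebra_range_of_injective {J : Type u} [Finite J]
    (Ψ : (J → K) →ₐ[K] Module.End K V) (hΨ : Function.Injective Ψ) (hJ : Nat.card J = d)
    (hV : finrank K V = d) : IsCartanSubalgebra d (LinearMap.range Ψ.toLinearMap) := by
  classical
  have := Fintype.ofFinite J
  have h1 : ∀ j, ∃ v : V, Ψ (Pi.single j 1) v ≠ 0 := by
    intro j
    by_contra! h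
    have h2 : Ψ (Pi.single j 1) = Ψ 0 := by
      rw [map_zero]
      exact LinearMap.ext h
    have h3 := congrFun (hΨ h2) j
    simp at h3
  choose v hv using h1
  let w : J → V := fun j => Ψ (Pi.single j 1) (v j)
  have hw : ∀ (c : J → K) (j : J), Ψ c (w j) = c j • w j := by
    intro c j
    have h2 : c * Pi.single j 1 = c j • Pi.single j 1 := by
      funext i
      by_cases hij : i = j
      · subst hij
        simp
      · simp [hij]
    change (Ψ c * Ψ (Pi.single j 1)) (v j) = _
    rw [← map_mul, h2, map_smul]
    rfl
  have hli : LinearIndependent K w := by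
    rw [Fintype.linearIndependent_iff]
    intro c hc j
    have h2 := congrArg (Ψ (Pi.single j 1)) hc
    rw [map_sum, map_zero, Finset.sum_eq_single j] at h2
    · rw [map_smul, hw, Pi.single_eq_same, one_smul] at h2
      exact (smul_eq_zero.1 h2).resolve_right (hv j)
    · intro i _ hij
      rw [map_smul, hw, Pi.single_eq_of_ne hij, zero_smul, smul_zero]
    · simp
  rw [Nat.card_eq_fintype_card] at hJ
  let b₀ : Basis J K V := Basis.mk hli
    (hli.span_eq_top_of_card_eq_finrank' (by rw [hJ, hV])).ge
  let e : J ≃ Fin d := Fintype.equivFinOfCardEq hJ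
  let b : Basis (Fin d) K V := b₀.reindex e
  have hb : ∀ i, b i = w (e.symm i) := fun i => by simp [b, b₀]
  have h3 : LinearMap.range Ψ.toLinearMap = LinearMap.range (diagEnd b) := by
    apply le_antisymm
    · rintro _ ⟨c, rfl⟩
      refine ⟨fun i => c (e.symm i), b.ext fun i => ?_⟩
      rw [diagEnd_apply_basis, hb]
      exact (hw c _).symm
    · rintro _ ⟨c, rfl⟩
      refine ⟨fun j => c (e j), b.ext fun i => ?_⟩
      rw [diagEnd_apply_basis, hb]
      refine (hw _ _).trans ?_
      rw [Equiv.apply_symm_apply]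
  rw [h3]
  exact isCartanSubalgebra_range_diagEnd b

theorem finite_primeSpectrum (K Q : Type*) [Field K] [CommRing Q] [Algebra K Q]
    [Module.Finite K Q] : Finite (PrimeSpectrum Q) := by
  have : IsArtinianRing Q := isArtinian_of_tower K inferInstance
  infer_instance

/-- The base change of `B` to `K` is étale over an algebraically closed field, hence a product of
copies of `K`, in number `d` by the rank. It acts faithfully by `hli`, and its image is the span of
the range of `T`. -/
theorem isCartanSubalgebra_of_etale [IsAlgClosed K] {R B : Type u} [CommRing R] [CommRing B]
    [Algebra R B] [Algebra.Etale R B] [Algebra R K] (hV : finrank K V = d) (b : Basis (Fin d) R B)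
    (T : B →+* Module.End K V)
    (hT : ∀ r, T (algebraMap R B r) = algebraMap K (Module.End K V) (algebraMap R K r))
    (hli : ∀ r : Fin d → K, ∑ i, r i • T (b i) = 0 → r = 0) :
    IsCartanSubalgebra d (Submodule.span K (Set.range T)) := by
  let _ : Algebra R (Module.End K V) :=
    ((algebraMap K (Module.End K V)).comp (algebraMap R K)).toAlgebra' fun r x =>
      Algebra.commutes (A := Module.End K V) (algebraMap R K r) x
  have : IsScalarTower R K (Module.End K V) := .of_algebraMap_eq fun _ => rfl
  let T' : B →ₐ[R] Module.End K V := { T with commutes' := hT }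
  let Θ : K ⊗[R] B →ₐ[K] Module.End K V :=
    Algebra.TensorProduct.lift (Algebra.ofId K _) T' fun c a => Algebra.commutes _ _
  have hΘ : ∀ c a, Θ (c ⊗ₜ a) = c • T a := fun c a => by
    refine (Algebra.TensorProduct.lift_tmul _ _ _ c a).trans ?_
    rw [Algebra.ofId_apply, ← Algebra.smul_def]
    rfl
  have hinj : Function.Injective Θ := by
    refine (injective_iff_map_eq_zero Θ).2 fun x hx => ?_
    rw [← (b.baseChange K).sum_repr x, map_sum] at hx
    have h1 := hli ((b.baseChange K).repr x) (by
      rw [← hx]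
      refine Finset.sum_congr rfl fun i _ => ?_
      rw [map_smul, Basis.baseChange_apply, hΘ, one_smul])
    exact (b.baseChange K).ext_elem fun i => by rw [h1, map_zero]; rfl
  let e := Algebra.FormallyEtale.equivPiOfIsSepClosed K (K ⊗[R] B)
  have hfin : Module.Finite K (K ⊗[R] B) := .of_basis (b.baseChange K)
  have : Finite (PrimeSpectrum (K ⊗[R] B)) := finite_primeSpectrum K _
  have hcard : Nat.card (PrimeSpectrum (K ⊗[R] B)) = d := by
    have h1 := e.toLinearEquiv.finrank_eq
    have := Fintype.ofFinite (PrimeSpectrum (K ⊗[R] B))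
    rw [finrank_eq_card_basis (b.baseChange K), Module.finrank_fintype_fun_eq_card,
      Fintype.card_fin] at h1
    rw [Nat.card_eq_fintype_card, h1]
  have h2 := isCartanSubalgebra_range_of_injective (Θ.comp e.symm.toAlgHom)
    (hinj.comp e.symm.injective) hcard hV
  have h3 : Submodule.span K (Set.range T) =
      LinearMap.range (Θ.comp e.symm.toAlgHom).toLinearMap := by
    apply le_antisymm
    · rw [Submodule.span_le]
      rintro _ ⟨a, rfl⟩
      refine ⟨e (1 ⊗ₜ a), ?_⟩
      simp [hΘ]
    · rintro _ ⟨c, rfl⟩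
      change Θ (e.symm c) ∈ _
      induction e.symm c using TensorProduct.induction_on with
      | zero => rw [map_zero]; exact zero_mem _
      | tmul c a => rw [hΘ]; exact Submodule.smul_mem _ _ (Submodule.subset_span ⟨a, rfl⟩)
      | add x y hx hy => rw [map_add]; exact add_mem hx hy
  rw [h3]
  exact h2

theorem isCartanSubalgebra_of_ringHom_etale [IsAlgClosed K] {R B : Type u} [CommRing R]
    [CommRing B] {φ : R →+* B} (hφ : φ.Etale) (ev : R →+* K) (hV : finrank K V = d) (b : Fin d → B)
    (hb : Function.Bijective fun c : Fin d → R => ∑ i, φ (c i) * b i) (T : B →+* Module.End K V)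
    (hT : ∀ r, T (φ r) = algebraMap K (Module.End K V) (ev r))
    (hli : ∀ r : Fin d → K, ∑ i, r i • T (b i) = 0 → r = 0) :
    IsCartanSubalgebra d (Submodule.span K (Set.range T)) := by
  algebraize [φ, ev]
  let b' : Basis (Fin d) R B := .ofEquivFun (LinearEquiv.ofBijective
    (Fintype.linearCombination R b) (by
      convert hb using 1
      funext c
      simp only [Fintype.linearCombination_apply, Algebra.smul_def]
      rfl)).symm
  have hb' : ∀ i, b' i = b i := fun i => by
    classical
    simp [b', Fintype.linearCombination_apply, Pi.single_apply]
  exact isCartanSubalgebra_of_etale hV b' T hT (by simpa only [hb'] using hli)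

end EtaleCartan

/-! ### Multiplication by functions on a direct image -/

section MulEnd

variable {X Y : Scheme.{u}} {f : Y ⟶ X} {L : Y.Modules} {E : X.Modules} (η : directImage f L ≅ E)
  {U V : X.Opens}

/-- Sections of the direct image of `L` as sections of `E`. -/
def directImageEquiv (V : X.Opens) : Γ(L, f ⁻¹ᵁ V) ≃+ Γ(E, V) where
  toFun l := η.hom.app V (toDirectImage f l)
  invFun s := η.inv.app V s
  left_inv l := inv_hom_app η (toDirectImage f l)
  right_inv s := hom_inv_app η s
  map_add' l l' := map_add (η.hom.app V).hom (toDirectImage f l) (toDirectImage f l')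

theorem directImageEquiv_smul (r : Γ(X, V)) (l : Γ(L, f ⁻¹ᵁ V)) :
    directImageEquiv η V (f.app V r • l) = r • directImageEquiv η V l :=
  Scheme.Modules.Hom.app_smul η.hom r (toDirectImage f l)

theorem res_directImageEquiv (h : V ≤ U) (l : Γ(L, f ⁻¹ᵁ U)) :
    res E h (directImageEquiv η U l) = directImageEquiv η V (res L (f.preimage_mono h) l) :=
  (app_res η.hom h (toDirectImage f l)).symm

/-- Multiplication by a function on `f ⁻¹ V`, as an endomorphism of the sections of `E ≅ f_* L`. -/
def mulLinear (a : Γ(Y, f ⁻¹ᵁ V)) : Γ(E, V) →ₗ[Γ(X, V)] Γ(E, V) where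
  toFun s := directImageEquiv η V (a • (directImageEquiv η V).symm s)
  map_add' s t := by rw [map_add, smul_add, map_add]
  map_smul' r s := by
    obtain ⟨l, rfl⟩ := (directImageEquiv η V).surjective s
    rw [RingHom.id_apply, ← directImageEquiv_smul, ← directImageEquiv_smul,
      AddEquiv.symm_apply_apply, AddEquiv.symm_apply_apply, smul_comm]

theorem mulLinear_apply (a : Γ(Y, f ⁻¹ᵁ V)) (l : Γ(L, f ⁻¹ᵁ V)) :
    mulLinear η a (directImageEquiv η V l) = directImageEquiv η V (a • l) :=
  congrArg (fun t => directImageEquiv η V (a • t)) ((directImageEquiv η V).symm_apply_apply l)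

/-- Multiplication by a function on `f ⁻¹ U`, as an endomorphism of `E ≅ f_* L` over `U`. -/
def mulEndSection (a : Γ(Y, f ⁻¹ᵁ U)) : EndSection E U where
  app V h := mulLinear η (resO (f.preimage_mono h) a)
  map_app {V W} hV hW s := by
    obtain ⟨l, rfl⟩ := (directImageEquiv η V).surjective s
    rw [res_directImageEquiv, mulLinear_apply, mulLinear_apply, res_directImageEquiv, res_smul,
      resO_resO]

theorem mulEndSection_app (a : Γ(Y, f ⁻¹ᵁ U)) (h : V ≤ U) (l : Γ(L, f ⁻¹ᵁ V)) :
    (mulEndSection η a).app V h (directImageEquiv η V l) =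
      directImageEquiv η V (resO (f.preimage_mono h) a • l) :=
  mulLinear_apply η _ l

theorem endSection_ext {φ ψ : EndSection E U} (H : ∀ (V : X.Opens) (h : V ≤ U)
    (l : Γ(L, f ⁻¹ᵁ V)), φ.app V h (directImageEquiv η V l) = ψ.app V h (directImageEquiv η V l)) :
    φ = ψ :=
  EndSection.ext' fun V h => LinearMap.ext fun s => by
    obtain ⟨l, rfl⟩ := (directImageEquiv η V).surjective s
    exact H V h l

/-- The action of the functions on `f ⁻¹ U` on `E ≅ f_* L`. -/
def mulEnd : Γ(Y, f ⁻¹ᵁ U) →+* EndSection E U where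
  toFun := mulEndSection η
  map_one' := endSection_ext η fun V h l => by
    rw [mulEndSection_app, map_one, one_smul]
    rfl
  map_mul' a b := endSection_ext η fun V h l => by
    rw [mulEndSection_app, map_mul, mul_smul, ← mulEndSection_app η a h,
      ← mulEndSection_app η b h]
    rfl
  map_zero' := endSection_ext η fun V h l => by
    rw [mulEndSection_app, map_zero, zero_smul, map_zero]
    rfl
  map_add' a b := endSection_ext η fun V h l => by
    rw [mulEndSection_app, map_add, add_smul, map_add, ← mulEndSection_app η a h,
      ← mulEndSection_app η b h]
    rfl

theorem mulEnd_app (a : Γ(Y, f ⁻¹ᵁ U)) (h : V ≤ U) (l : Γ(L, f ⁻¹ᵁ V)) :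
    (mulEnd η a).app V h (directImageEquiv η V l) =
      directImageEquiv η V (resO (f.preimage_mono h) a • l) :=
  mulEndSection_app η a h l

theorem mulEnd_smul (r : Γ(X, U)) (a : Γ(Y, f ⁻¹ᵁ U)) :
    mulEnd η (f.app U r * a) = r • mulEnd η a :=
  endSection_ext η fun V h l => by
    rw [mulEnd_app, EndSection.smul_app, LinearMap.smul_apply, mulEnd_app, map_mul, mul_smul,
      resO_app, directImageEquiv_smul]

/-- The algebra `f_* 𝒪_Y` acting on `E ≅ f_* L`. -/
def mulHom : directImage f (structureSheaf Y) ⟶ endSheaf E :=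
  homOfLinear (M := directImage f (structureSheaf Y)) (N := endSheaf E)
    (fun U =>
      { toFun := fun a => show EndSection E U from mulEnd η (show Γ(Y, f ⁻¹ᵁ U) from a)
        map_add' := fun a b => map_add (mulEnd η) _ _
        map_smul' := fun r a => mulEnd_smul η r _ })
    (fun U V h a => endSection_ext η (U := V) fun W hW l => by
      refine (mulEnd_app η _ hW l).trans ?_
      refine Eq.trans ?_ (mulEnd_app η _ (hW.trans h) l).symm
      exact congrArg (fun t => directImageEquiv η W (t • l))
        (resO_resO (f.preimage_mono h) (f.preimage_mono hW) (show Γ(Y, f ⁻¹ᵁ U) from a)))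

/-- A function on a preimage, as a section of the direct image of the structure sheaf. -/
def functionSection (f : Y ⟶ X) (a : Γ(Y, f ⁻¹ᵁ U)) : Γ(directImage f (structureSheaf Y), U) :=
  toDirectImage f (toSection a)

theorem act_mulHom (a : Γ(Y, f ⁻¹ᵁ U)) : act (mulHom η) (functionSection f a) = mulEnd η a :=
  rfl

theorem evalAt_mulHom (e : Γ(L, f ⁻¹ᵁ U)) (h : V ≤ U) (a : Γ(Y, f ⁻¹ᵁ V)) :
    evalAt (mulHom η) (directImageEquiv η U e) h (functionSection f a) =
      directImageEquiv η V (a • res L (f.preimage_mono h) e) := by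
  rw [evalAt_apply, act_mulHom, res_directImageEquiv]
  refine (mulEnd_app η a le_rfl _).trans ?_
  rw [resO_self]

/-- Evaluation at `e` is `a ↦ a • e`, which is the coordinate map of the frame `e` over `f ⁻¹ V`. -/
theorem IsFrame.isGenerator_directImageEquiv {e : Γ(L, f ⁻¹ᵁ U)}
    (he : IsFrame L fun _ : Fin 1 => e) : IsGenerator (mulHom η) (directImageEquiv η U e) := by
  intro V h
  have h1 := (he _ (f.preimage_mono h)).comp (Equiv.funUnique (Fin 1) Γ(Y, f ⁻¹ᵁ V)).symm.bijective
  have h2 := (directImageEquiv η V).bijective.comp h1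
  change Function.Bijective fun a : Γ(Y, f ⁻¹ᵁ V) =>
    evalAt (mulHom η) (directImageEquiv η U e) h (functionSection f a)
  refine (congrArg Function.Bijective (funext fun a => ?_)).mpr h2
  refine (evalAt_mulHom η e h a).trans ?_
  simp [uniqueElim]

theorem IsVectorBundle.exists_isGenerator_mulHom [IsFinite f] (hL : IsVectorBundle L 1) (x : X) :
    ∃ (U : X.Opens) (_ : x ∈ U) (e : Γ(E, U)), IsGenerator (mulHom η) e := by
  obtain ⟨U, hxU, e, he⟩ := hL.exists_isFrame_preimage f x
  exact ⟨U, hxU, _, he.isGenerator_directImageEquiv η⟩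

end MulEnd

/-! ### Subbundles from local generators -/

section CartanOfGenerator

variable {X : Scheme.{u}} {A E : X.Modules} {ι : A ⟶ endSheaf E} {U V : X.Opens} {d : ℕ}

theorem IsGenerator.exists_isFrame {e : Γ(E, U)} (he : IsGenerator ι e) (h : V ≤ U)
    {s : Fin d → Γ(E, V)} (hs : IsFrame E s) : ∃ a : Fin d → Γ(A, V), IsFrame A a := by
  choose a ha using fun i => (he V h).2 (s i)
  refine ⟨a, fun W hW => ?_⟩
  have h1 : (fun c : Fin d → Γ(X, W) => ∑ i, c i • res E hW (s i)) =
      evalAt ι e (hW.trans h) ∘ fun c : Fin d → Γ(X, W) => ∑ i, c i • res A hW (a i) := by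
    funext c
    rw [Function.comp_apply, map_sum]
    refine Finset.sum_congr rfl fun i _ => ?_
    rw [map_smul, evalAt_res e h hW, ha]
  exact (Function.Bijective.of_comp_iff' (he W (hW.trans h)) _).1 (h1 ▸ hs W hW)

theorem isVectorBundle_of_isGenerator (hE : IsVectorBundle E d)
    (h : ∀ x : X, ∃ (U : X.Opens) (_ : x ∈ U) (e : Γ(E, U)), IsGenerator ι e) :
    IsVectorBundle A d := fun x => by
  obtain ⟨U, hxU, e, he⟩ := h x
  obtain ⟨V, hxV, hVU, -, s, hs⟩ := hE.exists_isFrame_affine hxU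
  obtain ⟨a, ha⟩ := he.exists_isFrame hVU hs
  exact ⟨V, hxV, a, ha⟩

/-- Evaluation at a generator transports frames of `E` to `A`. It factors on fibres through the map
to `End(E)`, which is therefore injective. -/
theorem isSubbundle_of_isGenerator (hE : IsVectorBundle E d)
    (h : ∀ x : X, ∃ (U : X.Opens) (_ : x ∈ U) (e : Γ(E, U)), IsGenerator ι e) :
    IsSubbundle ι d where
  isVectorBundle := isVectorBundle_of_isGenerator hE h
  injective x := by
    obtain ⟨U, hxU, e, he⟩ := h x
    intro v w hvw
    refine (he.fibre_bijective (isVectorBundle_of_isGenerator hE h) hxU).1 ?_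
    simp only [fibreAct, LinearMap.comp_apply, hvw]

end CartanOfGenerator

/-! ### Closed fibres of the direct image algebra -/

section EtaleToCartan

/-- The action of endomorphisms on a fibre, as a ring homomorphism. -/
def EndSection.fibreHom {X : Scheme.{u}} {E : X.Modules} {U : X.Opens} {x : X} (hx : x ∈ U) :
    EndSection E U →+* Module.End (kappa x) (Fibre E x) where
  toFun φ := φ.fibre hx
  map_one' := fibre_one hx
  map_mul' := fibre_mul hx
  map_zero' := LinearMap.ext fun v => by
    obtain ⟨V, hV, h, s, rfl⟩ := exists_val hx v
    rw [fibre_val hV h, zero_app, LinearMap.zero_apply, map_zero]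
    rfl
  map_add' φ ψ := LinearMap.ext fun v => by
    obtain ⟨V, hV, h, s, rfl⟩ := exists_val hx v
    rw [LinearMap.add_apply, fibre_val hV h, fibre_val hV h, fibre_val hV h, add_app,
      LinearMap.add_apply, map_add]

theorem EndSection.fibreHom_algebraMap {X : Scheme.{u}} {E : X.Modules} {U : X.Opens} {x : X}
    (hx : x ∈ U) (r : Γ(X, U)) : fibreHom (E := E) hx (algebraMap _ _ r) =
      algebraMap (kappa x) (Module.End (kappa x) (Fibre E x)) (valO hx r) :=
  LinearMap.ext fun v => by
    obtain ⟨V, hV, h, s, rfl⟩ := exists_val hx v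
    refine (fibre_val hV h _ s).trans ?_
    rw [Module.algebraMap_end_apply, Algebra.algebraMap_eq_smul_one, smul_app,
      LinearMap.smul_apply, val_smul, valO_resO]
    rfl

variable {X Y : Scheme.{u}} {f : Y ⟶ X} {L : Y.Modules} {E : X.Modules} {d : ℕ}

theorem etale_app [Etale f] [IsAffineHom f] {U : X.Opens} (hU : IsAffineOpen U) :
    (f.app U).hom.Etale := by
  have h1 := @HasRingHomProperty.appLE @Etale _ Etale.instHasRingHomPropertyEtale _ _ f ‹_›
    ⟨U, hU⟩ ⟨f ⁻¹ᵁ U, hU.preimage f⟩ le_rfl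
  rwa [Scheme.Hom.appLE_eq_app] at h1

end EtaleToCartan

section EtaleToCartan

variable {X Y : Scheme.{u}} {f : Y ⟶ X} {L : Y.Modules} {E : X.Modules} {d : ℕ} {U V : X.Opens}

theorem fibreHom_mulEnd (η : directImage f L ≅ E) {x : X} (hx : x ∈ U) (c : Γ(Y, f ⁻¹ᵁ U)) :
    EndSection.fibreHom hx (mulEnd η c) =
      fibreAct (mulHom η) x (val (directImage f (structureSheaf Y)) hx (functionSection f c)) :=
  Eq.symm <| (fibreAct_val hx (functionSection f c)).trans <|
    congrArg (EndSection.fibreHom hx) (act_mulHom η c)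

theorem mulEnd_app_eq_algebraMap (η : directImage f L ≅ E) (r : Γ(X, U)) :
    mulEnd η ((f.app U).hom r) = algebraMap Γ(X, U) (EndSection E U) r := by
  have h4 := mulEnd_smul η r (1 : Γ(Y, f ⁻¹ᵁ U))
  rw [mul_one, map_one] at h4
  rw [Algebra.algebraMap_eq_smul_one]
  exact h4

theorem exists_eq_functionSection {a : Fin d → Γ(directImage f (structureSheaf Y), U)} :
    ∃ c : Fin d → Γ(Y, f ⁻¹ᵁ U), a = fun i => functionSection f (c i) := ⟨a, rfl⟩

theorem bijective_of_isFrame_functionSection {c : Fin d → Γ(Y, f ⁻¹ᵁ U)}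
    (hc : IsFrame (directImage f (structureSheaf Y)) fun i => functionSection f (c i)) :
    Function.Bijective fun r : Fin d → Γ(X, U) => ∑ i, (f.app U).hom (r i) * c i := by
  have h4 := hc U le_rfl
  simp only [res_self] at h4
  exact h4

theorem range_fibreAct_mulHom (η : directImage f L ≅ E) {x : X} (hx : x ∈ U)
    {c : Fin d → Γ(Y, f ⁻¹ᵁ U)}
    (hc : IsFrame (directImage f (structureSheaf Y)) fun i => functionSection f (c i)) :
    LinearMap.range (fibreAct (mulHom η) x) = Submodule.span (kappa x)
      (Set.range ((EndSection.fibreHom (E := E) hx).comp (mulEnd η))) := by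
  apply le_antisymm
  · rintro _ ⟨v, rfl⟩
    rw [← (hc.fibreBasis hx).sum_repr v, map_sum]
    refine sum_mem fun i _ => ?_
    rw [map_smul, hc.fibreBasis_apply]
    exact Submodule.smul_mem _ _ (Submodule.subset_span ⟨c i, fibreHom_mulEnd η hx _⟩)
  · rw [Submodule.span_le]
    rintro _ ⟨c, rfl⟩
    exact ⟨_, (fibreHom_mulEnd η hx c).symm⟩

/-- Over an affine `U` the functions on `f ⁻¹ U` form an étale algebra, free on the frame `c`. Its
fibre acts faithfully at `x` by `hinj`, and the linear algebra of split étale algebras applies. -/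
theorem isCartanSubalgebra_range_fibreAct_mulHom [Etale f] [IsAffineHom f]
    (hE : IsVectorBundle E d) (η : directImage f L ≅ E) (hU : IsAffineOpen U) {x : X} (hx : x ∈ U)
    [IsAlgClosed (kappa x)] (hinj : Function.Injective (fibreAct (mulHom η) x))
    {c : Fin d → Γ(Y, f ⁻¹ᵁ U)}
    (hc : IsFrame (directImage f (structureSheaf Y)) fun i => functionSection f (c i)) :
    IsCartanSubalgebra d (LinearMap.range (fibreAct (mulHom η) x)) := by
  have := hE.finite_fibre x
  rw [range_fibreAct_mulHom η hx hc]
  refine isCartanSubalgebra_of_ringHom_etale (etale_app hU) (valO hx) (hE.finrank_fibre x) c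
    (bijective_of_isFrame_functionSection hc) _ (fun r => ?_) ?_
  · rw [RingHom.comp_apply, mulEnd_app_eq_algebraMap, EndSection.fibreHom_algebraMap]
  · intro r hr
    have h1 : fibreAct (mulHom η) x (∑ i, r i • hc.fibreBasis hx i) = 0 := by
      rw [← hr, map_sum]
      refine Finset.sum_congr rfl fun i _ => ?_
      rw [map_smul, hc.fibreBasis_apply]
      exact congrArg (r i • ·) (fibreHom_mulEnd η hx (c i)).symm
    exact funext (Fintype.linearIndependent_iff.1 (hc.fibreBasis hx).linearIndependent r
      (hinj (h1.trans (map_zero _).symm)))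

theorem IsEtaleCovering.isCartanSubbundle_mulHom (hf : IsEtaleCovering f d)
    (hE : IsVectorBundle E d) (hL : IsVectorBundle L 1) (η : directImage f L ≅ E)
    (hk : ∀ x : X, IsClosed ({x} : Set X) → IsAlgClosed (kappa x)) :
    IsCartanSubbundle (mulHom η) d := by
  have h1 := hf.isFinite
  have h2 := hf.etale
  have hgen := hL.exists_isGenerator_mulHom η
  have hsub := isSubbundle_of_isGenerator hE hgen
  refine ⟨hsub, fun x hx => ?_⟩
  have := hk x hx
  obtain ⟨U, hxU, e, he⟩ := hgen x
  obtain ⟨V, hxV, hVU, hV, a, ha⟩ := hsub.isVectorBundle.exists_isFrame_affine hxU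
  obtain ⟨c, rfl⟩ := exists_eq_functionSection (a := a)
  exact isCartanSubalgebra_range_fibreAct_mulHom hE η hV hxV (fun v w hvw =>
    (he.fibre_bijective hsub.isVectorBundle hxU).1 (by simp only [hvw])) ha

end EtaleToCartan

/-! ### Connected components and global functions -/

section Components

/-- A noetherian space has finitely many irreducible components, and every connected component
contains one of them. -/
theorem finite_connectedComponents (Y : Type*) [TopologicalSpace Y] [NoetherianSpace Y] :
    Finite (_root_.ConnectedComponents Y) := by
  have h1 : Finite (irreducibleComponents Y) := NoetherianSpace.finite_irreducibleComponents
  have h2 : ∀ Z : irreducibleComponents Y, ∃ y : Y, y ∈ Z.1 := fun Z => Z.2.1.1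
  choose p hp using h2
  refine Finite.of_surjective (fun Z => _root_.ConnectedComponents.mk (p Z)) fun c => ?_
  obtain ⟨x, rfl⟩ := _root_.ConnectedComponents.surjective_coe c
  let Z : irreducibleComponents Y := ⟨irreducibleComponent x, irreducibleComponent_mem_irreducibleComponents x⟩
  refine ⟨Z, _root_.ConnectedComponents.coe_eq_coe'.2 ?_⟩
  exact isIrreducible_irreducibleComponent.isPreirreducible.isPreconnected.subset_connectedComponent
    mem_irreducibleComponent (hp Z)

theorem discreteTopology_connectedComponents (Y : Type*) [TopologicalSpace Y] [NoetherianSpace Y] :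
    DiscreteTopology (_root_.ConnectedComponents Y) := by
  have := finite_connectedComponents Y
  infer_instance

variable {k : Type u} [Field k] {Y : Scheme.{u}} (q : Y ⟶ Spec (.of k))

theorem valO_scalars_injective {y : Y} {U : Y.Opens} (hy : y ∈ U) :
    Function.Injective ((valO hy).comp (scalars q U)) := RingHom.injective _

theorem isIntegral_scalars [UniversallyClosed q] : (scalars q ⊤).IsIntegral := by
  have h1 : (((Scheme.ΓSpecIso (.of k)).inv ≫ q.appTop).hom : k →+* Γ(Y, ⊤)).IsIntegral :=
    RingHom.isIntegral_respectsIso.2 _ (Scheme.ΓSpecIso _).symm.commRingCatIsoToRingEquiv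
      (isIntegral_appTop_of_universallyClosed q)
  have h2 : q.appLE ⊤ ⊤ le_top = q.appTop := q.appLE_eq_app
  rw [scalars, h2]
  exact h1

/-- A global function satisfies a monic polynomial over `k`, which splits, so every value is one of
finitely many roots. The level sets are closed, and being finitely many they are also open. -/
theorem exists_isLocallyConstant [IsAlgClosed k] [UniversallyClosed q] (g : Γ(Y, ⊤)) :
    ∃ G : Y → k, IsLocallyConstant G ∧
      ∀ y : Y, valO (Opens.mem_top y) g = valO (Opens.mem_top y) (scalars q ⊤ (G y)) := by
  classical
  obtain ⟨p, hp, hpg⟩ := isIntegral_scalars q g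
  have h1 : ∀ y : Y, ∃ a ∈ p.roots.toFinset,
      valO (Opens.mem_top y) g = valO (Opens.mem_top y) (scalars q ⊤ a) := by
    intro y
    have h2 := congrArg (valO (Opens.mem_top y)) hpg
    rw [map_zero, Polynomial.hom_eval₂,
      (IsAlgClosed.splits p).eq_prod_roots_of_monic hp, Polynomial.eval₂_multiset_prod,
      Multiset.map_map, Multiset.prod_eq_zero_iff, Multiset.mem_map] at h2
    obtain ⟨a, ha, h2⟩ := h2
    refine ⟨a, Multiset.mem_toFinset.2 ha, ?_⟩
    rw [Function.comp_apply, Polynomial.eval₂_sub, Polynomial.eval₂_X, Polynomial.eval₂_C] at h2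
    exact sub_eq_zero.1 h2
  choose G hG hG' using h1
  refine ⟨G, ?_, hG'⟩
  have h3 : ∀ a y, G y = a ↔ valO (Opens.mem_top y) (g - scalars q ⊤ a) = 0 := by
    intro a y
    rw [map_sub, hG', sub_eq_zero]
    exact ⟨fun h => by rw [h], fun h => valO_scalars_injective q (Opens.mem_top y) h⟩
  have h4 : ∀ a, IsClosed (G ⁻¹' {a}) := by
    intro a
    have h5 : G ⁻¹' {a} = ((Y.basicOpen (g - scalars q ⊤ a) : Y.Opens) : Set Y)ᶜ := by
      ext y
      rw [Set.mem_preimage, Set.mem_singleton_iff, h3, Set.mem_compl_iff, SetLike.mem_coe,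
        ← valO_ne_zero_iff (Opens.mem_top y), not_not]
    rw [h5]
    exact (Y.basicOpen _).isOpen.isClosed_compl
  refine IsLocallyConstant.iff_isOpen_fiber.2 fun a => ?_
  have h5 : G ⁻¹' {a} = (⋃ b ∈ p.roots.toFinset.erase a, G ⁻¹' {b})ᶜ := by
    ext y
    simp only [Set.mem_preimage, Set.mem_singleton_iff, Set.mem_compl_iff, Set.mem_iUnion,
      Finset.mem_erase, not_exists]
    constructor
    · rintro rfl b ⟨hb, -⟩ h
      exact hb h.symm
    · intro h
      by_contra h'
      exact h (G y) ⟨h', hG y⟩ rfl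
  rw [h5]
  exact (isClosed_biUnion_finset fun b _ => h4 b).isOpen_compl

theorem exists_of_isLocallyConstant {G : Y → k} (hG : IsLocallyConstant G) :
    ∃ g : Γ(Y, ⊤), ∀ y : Y,
      valO (Opens.mem_top y) g = valO (Opens.mem_top y) (scalars q ⊤ (G y)) := by
  let W : k → Y.Opens := fun a => ⟨G ⁻¹' {a}, hG.isOpen_fiber a⟩
  obtain ⟨g, hg⟩ := resO_glue (V := ⊤) (T := W) (fun _ => le_top)
    (fun y _ => Opens.mem_iSup.2 ⟨G y, rfl⟩) (fun a => scalars q (W a) a) fun a b => by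
      rw [resO_scalars, resO_scalars]
      by_cases h : a = b
      · rw [h]
      · have h1 : W a ⊓ W b = ⊥ := by
          rw [eq_bot_iff]
          rintro y ⟨h2, h3⟩
          exact h (h2.symm.trans h3)
        have h2 : Subsingleton Γ(Y, W a ⊓ W b) := by
          rw [h1]
          infer_instance
        exact Subsingleton.elim _ _
  refine ⟨g, fun y => ?_⟩
  have hy : y ∈ W (G y) := rfl
  rw [← valO_resO le_top hy, hg, ← valO_resO le_top hy, resO_scalars]

/-- The functions on a scheme which is universally closed over an algebraically closed field `k` are
the `k`-valued functions on the set of its connected components. -/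
theorem nonempty_globalSections_linearEquiv [IsAlgClosed k] [UniversallyClosed q] [NoetherianSpace Y]
    (h0 : ∀ g : Γ(Y, ⊤), (∀ y : Y, valO (Opens.mem_top y) g = 0) → g = 0) [Module k Γ(Y, ⊤)]
    (hk : ∀ (a : k) (g : Γ(Y, ⊤)), a • g = scalars q ⊤ a * g) :
    Nonempty (Γ(Y, ⊤) ≃ₗ[k] (_root_.ConnectedComponents Y → k)) := by
  choose G hG hG' using exists_isLocallyConstant q
  have huniq : ∀ (g : Γ(Y, ⊤)) (y : Y) (a : k),
      valO (Opens.mem_top y) g = valO (Opens.mem_top y) (scalars q ⊤ a) → G g y = a :=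
    fun g y a h => valO_scalars_injective q (Opens.mem_top y) ((hG' g y).symm.trans h)
  have hconst : ∀ (g : Γ(Y, ⊤)) (x y : Y),
      _root_.ConnectedComponents.mk x = _root_.ConnectedComponents.mk y → G g x = G g y :=
    fun g x y h => (hG g).apply_eq_of_isPreconnected isPreconnected_connectedComponent
      (_root_.ConnectedComponents.coe_eq_coe'.1 h) mem_connectedComponent
  choose r hr using _root_.ConnectedComponents.surjective_coe (α := Y)
  let Ψ : Γ(Y, ⊤) →ₗ[k] (_root_.ConnectedComponents Y → k) :=
    { toFun := fun g c => G g (r c)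
      map_add' := fun g g' => funext fun c => huniq _ _ _ (by
        rw [Pi.add_apply, map_add, map_add, map_add, hG' g, hG' g'])
      map_smul' := fun a g => funext fun c => huniq _ _ _ (by
        rw [RingHom.id_apply, Pi.smul_apply, hk, map_mul, smul_eq_mul, map_mul, map_mul, hG' g]) }
  refine ⟨LinearEquiv.ofBijective Ψ ⟨(injective_iff_map_eq_zero Ψ).2 fun g hg => h0 g fun y => ?_,
    fun φ => ?_⟩⟩
  · have h1 : G g y = 0 := by
      rw [hconst g y _ (hr (_root_.ConnectedComponents.mk y)).symm]
      exact congrFun hg _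
    rw [hG', h1, map_zero, map_zero]
  · have := discreteTopology_connectedComponents Y
    obtain ⟨g, hg⟩ := exists_of_isLocallyConstant q (G := fun y => φ (_root_.ConnectedComponents.mk y))
      ((IsLocallyConstant.of_discrete φ).comp_continuous _root_.ConnectedComponents.continuous_coe)
    refine ⟨g, funext fun c => ?_⟩
    refine (huniq _ _ _ (hg _)).trans ?_
    exact congrArg φ (hr c)

end Components

/-! ### Reducedness of étale coverings of an integral scheme -/

section Reduced

/-- By flatness `B` embeds in its base change to the fraction field of `R`, and an étale algebra
over a field is reduced. -/
theorem isReduced_of_etale {R B : Type u} [CommRing R] [IsDomain R] [CommRing B] [Algebra R B]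
    [Algebra.Etale R B] : _root_.IsReduced B := by
  have : Module.Flat R B := inferInstance
  have h1 : Function.Injective
      (Algebra.TensorProduct.includeRight : B →ₐ[R] FractionRing R ⊗[R] B) :=
    Algebra.TensorProduct.includeRight_injective (IsFractionRing.injective R (FractionRing R))
  have : _root_.IsReduced (FractionRing R ⊗[R] B) :=
    Algebra.FormallyUnramified.isReduced_of_field (FractionRing R) _
  exact isReduced_of_injective _ h1

/-- A function with no nonzero value has empty basic open, so it is nilpotent on the preimage of
each affine open, where the ring of functions is reduced. -/
theorem eq_zero_of_valO_of_etale {X Y : Scheme.{u}} [IsIntegral X] (f : Y ⟶ X) [Etale f]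
    [IsAffineHom f] (g : Γ(Y, ⊤)) (hg : ∀ y : Y, valO (Opens.mem_top y) g = 0) :
    g = 0 := by
  have h1 : ∀ y : Y, ∃ U : X.Opens, IsAffineOpen U ∧ f y ∈ U := fun y => by
    obtain ⟨_, ⟨U, hU, rfl⟩, hyU, -⟩ :=
      X.isBasis_affineOpens.exists_subset_of_mem_open (Set.mem_univ (f y)) isOpen_univ
    exact ⟨U, hU, hyU⟩
  choose U hU hyU using h1
  refine resO_ext (T := fun y => f ⁻¹ᵁ U y) (fun _ => le_top)
    (fun y _ => Opens.mem_iSup.2 ⟨y, hyU y⟩) fun y => ?_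
  rw [map_zero]
  have : Nonempty (U y) := ⟨⟨f y, hyU y⟩⟩
  have h2 : _root_.IsReduced Γ(Y, f ⁻¹ᵁ U y) := by
    have h3 := etale_app (f := f) (hU y)
    algebraize [(f.app (U y)).hom]
    exact isReduced_of_etale (R := Γ(X, U y))
  have h3 : IsNilpotent (resO (le_top : f ⁻¹ᵁ U y ≤ ⊤) g) := by
    refine (Scheme.isNilpotent_iff_basicOpen_eq_bot_of_isCompact
      ((hU y).preimage f).isCompact _).2 ?_
    rw [eq_bot_iff]
    intro z hz
    rw [basicOpen_resO] at hz
    exact (valO_ne_zero_iff (Opens.mem_top z) g).2 hz.2 (hg z)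
  exact h3.eq_zero

end Reduced

/-! ### Projective varieties -/

section Main

variable {k : Type u} [Field k] {X : Scheme.{u}} {π : X ⟶ Spec (.of k)}

/-- The residue field at a closed point of a scheme of finite type over the algebraically closed
field `k` is `k` itself. -/
theorem isAlgClosed_kappa [IsAlgClosed k] [LocallyOfFiniteType π] {x : X}
    (hx : IsClosed ({x} : Set X)) : IsAlgClosed (kappa x) :=
  IsAlgClosed.of_ringEquiv k (kappa x)
    (residueFieldIsoBase π x hx).symm.commRingCatIsoToRingEquiv

theorem IsProjective.isNoetherian (hπ : IsProjective π) : IsNoetherian X := by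
  have := hπ.isProper
  have h1 : IsLocallyNoetherian X := LocallyOfFiniteType.isLocallyNoetherian π
  have h2 : CompactSpace X := QuasiCompact.compactSpace_of_compactSpace π
  exact { }

variable (π) in
theorem app_scalars {Y : Scheme.{u}} (f : Y ⟶ X) (a : k) :
    f.app ⊤ (scalars π ⊤ a) = scalars (f ≫ π) (f ⁻¹ᵁ ⊤) a := by
  have h1 : π.appLE ⊤ ⊤ le_top ≫ f.app ⊤ = (f ≫ π).appLE ⊤ (f ⁻¹ᵁ ⊤) le_top :=
    (congrArg (· ≫ f.app ⊤) π.appLE_eq_app).trans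
      ((Scheme.Hom.comp_app f π ⊤).symm.trans (f ≫ π).appLE_eq_app.symm)
  have h2 := congrArg (fun φ => (Scheme.ΓSpecIso (.of k)).inv ≫ φ) h1
  exact RingHom.congr_fun (congrArg CommRingCat.Hom.hom h2) a

theorem smul_H0 {M : X.Modules} (a : k) (s : H0 π M) :
    a • s = (show H0 π M from (scalars π ⊤ a • (show Γ(M, ⊤) from s) : Γ(M, ⊤))) := by
  have h2 : π.appLE ⊤ ⊤ le_top = π.appTop := π.appLE_eq_app
  rw [scalars, h2]
  rfl

/-- The isomorphism `θ` identifies `H⁰(X, A)` with the global functions on `Y`. Being finite over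
`X`, the scheme `Y` is projective, so these are the `k`-valued functions on its finite set of
components. -/
theorem IsEtaleCovering.finrank_H0 [IsAlgClosed k] [IsIntegral X] (hπ : IsProjective π)
    {Y : Scheme.{u}} {f : Y ⟶ X} {d : ℕ} (hf : IsEtaleCovering f d) {A : X.Modules}
    (θ : directImage f (structureSheaf Y) ≅ A) :
    Finite (_root_.ConnectedComponents Y) ∧ Module.Finite k (H0 π A) ∧
      Nat.card (_root_.ConnectedComponents Y) = Module.finrank k (H0 π A) := by
  have := hf.isFinite
  have := hf.etale
  have := hπ.isProper
  have hY : IsProjective (f ≫ π) := hπ.of_isFinite f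
  have := hY.isProper
  have := hY.isNoetherian
  have hY' : NoetherianSpace Y := inferInstance
  let _ : Module k Γ(Y, ⊤) := Module.compHom Γ(Y, ⊤) (scalars (f ≫ π) ⊤)
  obtain ⟨e⟩ := nonempty_globalSections_linearEquiv (f ≫ π) (eq_zero_of_valO_of_etale f) fun _ _ => rfl
  let Θ : Γ(Y, ⊤) ≃ₗ[k] H0 π A :=
    { directImageEquiv θ ⊤ with
      map_smul' := fun a g => by
        refine Eq.trans ?_ (smul_H0 a _).symm
        refine Eq.trans ?_ (directImageEquiv_smul θ (scalars π ⊤ a) g)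
        rw [app_scalars]
        rfl }
  have := finite_connectedComponents Y
  have := Fintype.ofFinite (_root_.ConnectedComponents Y)
  refine ⟨inferInstance, Module.Finite.equiv (e.symm.trans Θ), ?_⟩
  rw [← (e.symm.trans Θ).finrank_eq, Module.finrank_fintype_fun_eq_card, Nat.card_eq_fintype_card]

end Main

end

end EtaleDirectImage

theorem theorem2p3 {k : Type u} [Field k] [IsAlgClosed k] {X : Scheme.{u}}
    (π : X ⟶ Spec (.of k)) (hπ : EtaleDirectImage.IsProjective π) [IsIntegral X]
    (d : ℕ) (E : X.Modules) (hE : EtaleDirectImage.IsVectorBundle E d) :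
    ((∃ (Y : Scheme.{u}) (f : Y ⟶ X) (L : Y.Modules),
        EtaleDirectImage.IsEtaleCovering f d ∧ EtaleDirectImage.IsProjective (f ≫ π) ∧
          EtaleDirectImage.IsVectorBundle L 1 ∧
          Nonempty (EtaleDirectImage.directImage f L ≅ E)) ↔
      ∃ (A : X.Modules) (ι : A ⟶ EtaleDirectImage.endSheaf E),
        EtaleDirectImage.IsCartanSubbundle ι d) ∧
    ∀ (A : X.Modules) (ι : A ⟶ EtaleDirectImage.endSheaf E),
      EtaleDirectImage.IsCartanSubbundle ι d →
        (∃ (Y : Scheme.{u}) (f : Y ⟶ X) (L : Y.Modules)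
            (η : EtaleDirectImage.directImage f L ≅ E),
          EtaleDirectImage.IsEtaleCovering f d ∧ EtaleDirectImage.IsProjective (f ≫ π) ∧
            EtaleDirectImage.IsVectorBundle L 1 ∧
            EtaleDirectImage.IsDirectImageOfStructureSheaf f η ι) ∧
        ∀ (Y : Scheme.{u}) (f : Y ⟶ X), EtaleDirectImage.IsEtaleCovering f d →
          Nonempty (EtaleDirectImage.directImage f (EtaleDirectImage.structureSheaf Y) ≅ A) →
            Finite (_root_.ConnectedComponents Y) ∧
            Module.Finite k (EtaleDirectImage.H0 π A) ∧
            Nat.card (_root_.ConnectedComponents Y) = Module.finrank k (EtaleDirectImage.H0 π A) := by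
  have := hπ.isProper
  -- Properness over `k` makes `X` Jacobson, so that closed fibres decide, and noetherian, so that
  -- finite algebras over affine opens are finitely presented.
  have : JacobsonSpace X := LocallyOfFiniteType.jacobsonSpace π
  have := hπ.isNoetherian
  have hN : ∀ U : X.affineOpens, IsNoetherianRing Γ(X, U.1) :=
    IsLocallyNoetherian.component_noetherian
  refine ⟨⟨?_, ?_⟩, fun A ι hι => ⟨?_, ?_⟩⟩
  · rintro ⟨Y, f, L, hf, -, hL, ⟨η⟩⟩
    exact ⟨_, EtaleDirectImage.mulHom η, hf.isCartanSubbundle_mulHom hE hL η fun x hx =>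
      EtaleDirectImage.isAlgClosed_kappa (π := π) hx⟩
  · rintro ⟨A, ι, hι⟩
    obtain ⟨Y, f, L, η, hf, hL, -⟩ := hι.exists_etaleCovering hN hE
    have := hf.isFinite
    exact ⟨Y, f, L, hf, hπ.of_isFinite f, hL, ⟨η⟩⟩
  · obtain ⟨Y, f, L, η, hf, hL, h⟩ := hι.exists_etaleCovering hN hE
    have := hf.isFinite
    exact ⟨Y, f, L, η, hf, hπ.of_isFinite f, hL, h⟩
  · rintro Y f hf ⟨θ⟩
    exact hf.finrank_H0 hπ θ
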